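/- **Theorem (dual formulation of the obstacle problem with standard growth).** Let $n\ge 2$, let $\Omega\subset\mathbb R^n$ be a bounded open set, let $1<p<\infty$ and $p'=\frac{p}{p-1}$. Let $G:\mathbb R^n\to\mathbb R$ be $C^1$ and strictly convex, with constants $\ell>0$ and $L$ such that $$\ell\,(|\xi|^p-1)\le G(\xi)\le L\,(1+|\xi|^p)\qquad\text{for all }\xi\in\mathbb R^n,$$ and let $G^*(\zeta)=\sup_{\xi\in\mathbb R^n}\big(\langle\zeta,\xi\rangle-G(\xi)\big)$ be its Fenchel conjugate. Let $\psi,u_0\in W^{1,p}(\Omega)$ be such that $$\mathcal K_\psi(\Omega)=\{v\in u_0+W^{1,p}_0(\Omega):\ v\ge\psi\ \text{a.e. in }\Omega\}$$ is not empty, and let $$S^{p'}_-(\Omega)=\{\sigma\in L^{p'}(\Omega;\mathbb R^n):\ \operatorname{div}\sigma\le 0\ \text{in }\mathcal D'(\Omega)\}.$$ For $\sigma\in S^{p'}_-(\Omega)$ the distribution $-\operatorname{div}\sigma$ is a non-negative Radon measure on $\Omega$, and we set $$[\![\sigma,D\psi]\!]_{u_0}(\overline\Omega)=\int_\Omega(\psi-u_0)\,d(-\operatorname{div}\sigma)+\int_\Omega\langle\sigma,Du_0\rangle\,dx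 ,$$ where $\psi-u_0$ stands for its $p$-quasicontinuous representative. Then $G^*$ is finite on $\mathbb R^n$; $G(Dv)\in L^1(\Omega)$ for all $v\in\mathcal K_\psi(\Omega)$; and for all $\sigma\in S^{p'}_-(\Omega)$ both $G^*(\sigma)$ and $\langle\sigma,Du_0\rangle$ are in $L^1(\Omega)$ and $\int_\Omega(\psi-u_0)^+\,d(-\operatorname{div}\sigma)<\infty$, so that $[\![\sigma,D\psi]\!]_{u_0}(\overline\Omega)$ is well defined in $[-\infty,\infty)$. Moreover $$\min_{v\in\mathcal K_\psi(\Omega)}\int_\Omega G(Dv)\,dx=\max_{\sigma\in S^{p'}_-(\Omega)}\Big([\![\sigma,D\psi]\!]_{u_0}(\overline\Omega)-\int_\Omega G^*(\sigma)\,dx\Big),$$ where the minimum and the maximum are attained and their common value is finite. If $u\in\mathcal K_\psi(\Omega)$ is a minimizer, then $G'(Du)\in S^{p'}_-(\Omega)$, the maximum is attained at $\sigma=G'(Du)$, and $$\int_\Omega G(Du)\,dx=[\![G'(Du),D\psi]\!]_{u_0}(\overline\Omega)-\int_\Omega G^*(G'(Du))\,dx .$$ -/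

import Mathlib

open MeasureTheory Set Filter Topology
open scoped ENNReal ContDiff

noncomputable section

/-- The space `ℝⁿ` with its Euclidean norm. -/
abbrev Rn (n : ℕ) : Type := EuclideanSpace ℝ (Fin n)

/-- `φ ∈ C_c^∞(Ω)`. -/
structure IsTestFun {n : ℕ} (Ω : Set (Rn n)) (φ : Rn n → ℝ) : Prop where
  smooth : ContDiff ℝ ∞ φ
  compact : HasCompactSupport φ
  subset : tsupport φ ⊆ Ω

/-- `g` is a weak gradient of `v` on `Ω`. -/
structure HasWeakGradient {n : ℕ} (Ω : Set (Rn n)) (v : Rn n → ℝ) (g : Rn n → Rn n) : Prop where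
  locInt : LocallyIntegrableOn v Ω volume
  locInt_grad : LocallyIntegrableOn g Ω volume
  parts : ∀ φ : Rn n → ℝ, IsTestFun Ω φ →
    ∫ x in Ω, v x • gradient φ x = - ∫ x in Ω, φ x • g x

open Classical in
/-- The weak gradient `Dv` on `Ω` (unique up to null sets of `Ω`; `0` if there is none). -/
def weakGradient {n : ℕ} (Ω : Set (Rn n)) (v : Rn n → ℝ) : Rn n → Rn n :=
  if h : ∃ g, HasWeakGradient Ω v g then h.choose else 0

/-- `v ∈ W^{1,p}(Ω)`. -/
def MemW1p {n : ℕ} (Ω : Set (Rn n)) (p : ℝ) (v : Rn n → ℝ) : Prop :=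
  (∃ g, HasWeakGradient Ω v g) ∧
  MemLp v (ENNReal.ofReal p) (volume.restrict Ω) ∧
  MemLp (weakGradient Ω v) (ENNReal.ofReal p) (volume.restrict Ω)

/-- `v ∈ W^{1,p}_0(Ω)`, the closure of `C_c^∞(Ω)` in `W^{1,p}(Ω)`. -/
def MemW1p0 {n : ℕ} (Ω : Set (Rn n)) (p : ℝ) (v : Rn n → ℝ) : Prop :=
  MemW1p Ω p v ∧ ∃ φ : ℕ → Rn n → ℝ, (∀ k, IsTestFun Ω (φ k)) ∧
    Tendsto (fun k => eLpNorm (fun x => φ k x - v x) (ENNReal.ofReal p) (volume.restrict Ω))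
      atTop (𝓝 0) ∧
    Tendsto (fun k => eLpNorm (fun x => gradient (φ k) x - weakGradient Ω v x)
      (ENNReal.ofReal p) (volume.restrict Ω)) atTop (𝓝 0)

/-- The class `K_ψ(Ω)` of all `v ∈ u₀ + W^{1,p}_0(Ω)` with `v ≥ ψ` a.e. in `Ω`. -/
def obstacleClass {n : ℕ} (Ω : Set (Rn n)) (p : ℝ) (ψ u₀ : Rn n → ℝ) : Set (Rn n → ℝ) :=
  {v | MemW1p0 Ω p (fun x => v x - u₀ x) ∧ ∀ᵐ x ∂(volume.restrict Ω), ψ x ≤ v x}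

/-- The primal functional `v ↦ ∫_Ω G(Dv)`. -/
def energy {n : ℕ} (Ω : Set (Rn n)) (G : Rn n → ℝ) (v : Rn n → ℝ) : ℝ :=
  ∫ x in Ω, G (weakGradient Ω v x)

/-- The polar (Fenchel conjugate) `G^*`. The supremum is a genuine one as soon as `G` has
superlinear growth. -/
def polar {n : ℕ} (G : Rn n → ℝ) (ζ : Rn n) : ℝ :=
  ⨆ ξ : Rn n, (inner ℝ ζ ξ - G ξ)

/-- The class `S^{p'}_-(Ω)` of fields `σ ∈ L^{p'}(Ω; ℝⁿ)`, `p' = p / (p - 1)`, with `div σ ≤ 0` in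
the sense of distributions. -/
def fieldClass {n : ℕ} (Ω : Set (Rn n)) (p : ℝ) : Set (Rn n → Rn n) :=
  {σ | MemLp σ (ENNReal.ofReal p.conjExponent) (volume.restrict Ω) ∧
    ∀ φ : Rn n → ℝ, IsTestFun Ω φ → (∀ x, 0 ≤ φ x) → 0 ≤ ∫ x in Ω, inner ℝ (σ x) (gradient φ x)}

/-- `μ` is the non-negative Radon measure on the open set `Ω` (extended by `0` outside `Ω`) which
represents the distribution `-div σ`. -/
structure IsNegDivMeasure {n : ℕ} (Ω : Set (Rn n)) (σ : Rn n → Rn n) (μ : Measure (Rn n)) :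
    Prop where
  compl : μ Ωᶜ = 0
  finite : ∀ K : Set (Rn n), IsCompact K → K ⊆ Ω → μ K < ⊤
  integral_eq : ∀ φ : Rn n → ℝ, IsTestFun Ω φ →
    ∫ x, φ x ∂μ = ∫ x in Ω, inner ℝ (σ x) (gradient φ x)

open Classical in
/-- The measure `-div σ` on `Ω` (it is unique; `0` if `-div σ` is not a non-negative measure). -/
def negDiv {n : ℕ} (Ω : Set (Rn n)) (σ : Rn n → Rn n) : Measure (Rn n) :=
  if h : ∃ μ, IsNegDivMeasure Ω σ μ then h.choose else 0

/-- The Sobolev `p`-capacity of `A ⊆ ℝⁿ`: the infimum of `∫ |u|^p + |Du|^p` over all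
`u ∈ W^{1,p}(ℝⁿ)` with `u ≥ 1` a.e. in an open neighbourhood of `A`. -/
def sobolevCap {n : ℕ} (p : ℝ) (A : Set (Rn n)) : ℝ≥0∞ :=
  ⨅ (u : Rn n → ℝ) (_ : MemW1p univ p u ∧
      ∃ V : Set (Rn n), IsOpen V ∧ A ⊆ V ∧ ∀ᵐ x ∂(volume.restrict V), 1 ≤ u x),
    ∫⁻ x, (‖u x‖ₑ ^ p + ‖weakGradient univ u x‖ₑ ^ p)

/-- `w` is a `p`-quasicontinuous representative of `f` on `Ω`: it equals `f` a.e. in `Ω`, and off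
open sets of arbitrarily small capacity it is continuous. -/
def IsQuasicontRep {n : ℕ} (Ω : Set (Rn n)) (p : ℝ) (f w : Rn n → ℝ) : Prop :=
  (∀ᵐ x ∂(volume.restrict Ω), w x = f x) ∧
  ∀ ε : ℝ≥0∞, 0 < ε → ∃ V : Set (Rn n), IsOpen V ∧ sobolevCap p V < ε ∧ ContinuousOn w (Ω \ V)

open Classical in
/-- The `p`-quasicontinuous representative of `f ∈ W^{1,p}(Ω)`; it exists and is unique up to sets
of `p`-capacity zero, and these are null sets of `-div σ` for `σ ∈ L^{p'}` with `div σ ≤ 0`. -/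
def quasicontRep {n : ℕ} (Ω : Set (Rn n)) (p : ℝ) (f : Rn n → ℝ) : Rn n → ℝ :=
  if h : ∃ w, IsQuasicontRep Ω p f w then h.choose else f

/-- The integral `∫ w dμ` as an extended real number, for `w` whose positive part has a finite
integral. -/
def extIntegral {n : ℕ} (μ : Measure (Rn n)) (w : Rn n → ℝ) : EReal :=
  ((∫⁻ x, ENNReal.ofReal (w x) ∂μ : ℝ≥0∞) : EReal) -
    ((∫⁻ x, ENNReal.ofReal (-w x) ∂μ : ℝ≥0∞) : EReal)

/-- The pairing `[[σ, DU]]_{u₀}(Ω̄) = ∫_Ω (U - u₀) d(-div σ) + ∫_Ω ⟨σ, Du₀⟩ dx`. The Sobolev function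
`U - u₀` is integrated against the measure `-div σ`, possibly singular and of infinite mass,
through its quasicontinuous representative. -/
def pairing {n : ℕ} (Ω : Set (Rn n)) (p : ℝ) (u₀ : Rn n → ℝ) (σ : Rn n → Rn n) (U : Rn n → ℝ) :
    EReal :=
  extIntegral (negDiv Ω σ) (quasicontRep Ω p (fun x => U x - u₀ x)) +
    ((∫ x in Ω, inner ℝ (σ x) (weakGradient Ω u₀ x) : ℝ) : EReal)

/-- The dual functional `σ ↦ [[σ, Dψ]]_{u₀}(Ω̄) - ∫_Ω G^*(σ)`. -/
def dualEnergy {n : ℕ} (Ω : Set (Rn n)) (p : ℝ) (G : Rn n → ℝ) (ψ u₀ : Rn n → ℝ)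
    (σ : Rn n → Rn n) : EReal :=
  pairing Ω p u₀ σ ψ - ((∫ x in Ω, polar G (σ x) : ℝ) : EReal)

end

/-!
The duality rests on one computation. For `σ ∈ L^{p'}` with `div σ ≤ 0` and `v = u₀ + w`,
`w ∈ W^{1,p}_0(Ω)`, integration by parts against the measure `μ = -div σ` reads
`∫ w dμ = ∫ ⟨σ, Dw⟩`, where `w` on the left is quasicontinuous. If `v ≥ ψ`, then `ψ - u₀ ≤ w` holds
`μ`-almost everywhere, so that `[[σ, Dψ]]_{u₀} ≤ ∫ ⟨σ, Dv⟩`, and the Fenchel–Young inequality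
`⟨σ, Dv⟩ ≤ G(Dv) + G^*(σ)` gives weak duality. Conversely let `u` be a minimizer and `σ = G'(Du)`.
The variational inequality for `u + φ`, `φ ≥ 0`, says that `div σ ≤ 0`; for the competitors
`u - η (u - ψ)` with cutoff functions `0 ≤ η ≤ 1` it says that `μ` does not charge the set `u > ψ`.
Both inequalities above are then equalities.

Behind the formula `∫ w dμ = ∫ ⟨σ, Dw⟩` (`IsNegDivMeasure.integral_quasicontRep`) stands the estimate
`∫ |φ| dμ ≤ ‖σ‖_{p'} ‖Dφ‖_p` for test functions `φ` (`IsNegDivMeasure.lintegral_enorm_le`), by which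
`W^{1,p}`-convergent test functions converge in `L¹(μ)`. That the limit is the quasicontinuous
representative is a matter of capacity: the same estimate, in the form of
`IsNegDivMeasure.measure_le_of_one_le`, bounds `μ` on sets where a Sobolev function exceeds `1`, hence
on sets of small capacity, and off such a set the deviation of `φ` from the representative is an open
condition. Local mollification makes all this available for functions that do not vanish on the
boundary. The existence of quasicontinuous representatives
(`IsSobolevPair.exists_isQuasicontRep`) comes from a fast converging sequence of mollifications, and
that of `μ` (`exists_isNegDivMeasure`) from the extension theorem of M. Riesz together with the
Riesz–Markov–Kakutani theorem.

A minimizer is found without weak compactness (`exists_isMinOn_energy`). In the sublevel sets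
`{energy ≤ m + 1/(k+1)}` of the convex class `K_ψ(Ω)`, elements that nearly minimize `∫ |Dv|^p` form
a sequence with gradients converging in `L^p`, by a quantitative strict convexity of `|·|^p`. The
Poincaré inequality provides the convergence of the functions, and Fatou's lemma the bound for the
energy of the limit.
-/

/-! ### Gradients and test functions -/

section Gradient

variable {n : ℕ}

lemma gradient_add' {f g : Rn n → ℝ} {x : Rn n} (hf : DifferentiableAt ℝ f x)
    (hg : DifferentiableAt ℝ g x) :
    gradient (fun y => f y + g y) x = gradient f x + gradient g x := by
  simp only [gradient]
  rw [fderiv_fun_add hf hg, map_add]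

lemma gradient_sub' {f g : Rn n → ℝ} {x : Rn n} (hf : DifferentiableAt ℝ f x)
    (hg : DifferentiableAt ℝ g x) :
    gradient (fun y => f y - g y) x = gradient f x - gradient g x := by
  simp only [gradient]
  rw [fderiv_fun_sub hf hg, map_sub]

lemma gradient_mul' {f g : Rn n → ℝ} {x : Rn n} (hf : DifferentiableAt ℝ f x)
    (hg : DifferentiableAt ℝ g x) :
    gradient (fun y => f y * g y) x = f x • gradient g x + g x • gradient f x := by
  simp only [gradient]
  rw [fderiv_fun_mul hf hg, map_add]
  simp

lemma gradient_const_mul' {f : Rn n → ℝ} {x : Rn n} (c : ℝ) (hf : DifferentiableAt ℝ f x) :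
    gradient (fun y => c * f y) x = c • gradient f x := by
  simp only [gradient]
  rw [fderiv_const_mul hf]
  simp

lemma gradient_comp' {h : ℝ → ℝ} {f : Rn n → ℝ} {x : Rn n} (hh : DifferentiableAt ℝ h (f x))
    (hf : DifferentiableAt ℝ f x) :
    gradient (fun y => h (f y)) x = deriv h (f x) • gradient f x := by
  have : HasFDerivAt (fun y => h (f y)) (deriv h (f x) • fderiv ℝ f x) x :=
    hh.hasDerivAt.comp_hasFDerivAt x hf.hasFDerivAt
  simp only [gradient]
  rw [this.fderiv]
  simp

lemma continuous_gradient {f : Rn n → ℝ} (hf : ContDiff ℝ 1 f) :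
    Continuous (fun x => gradient f x) :=
  (InnerProductSpace.toDual ℝ (Rn n)).symm.continuous.comp (hf.continuous_fderiv one_ne_zero)

lemma norm_gradient (f : Rn n → ℝ) (x : Rn n) : ‖gradient f x‖ = ‖fderiv ℝ f x‖ := by
  simp [gradient]

lemma tsupport_gradient_subset (f : Rn n → ℝ) : tsupport (fun x => gradient f x) ⊆ tsupport f := by
  refine closure_minimal (fun x hx => ?_) (isClosed_tsupport f)
  have : fderiv ℝ f x ≠ 0 := by
    intro h
    apply hx
    simp [gradient, h]
  exact support_fderiv_subset ℝ this

end Gradient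

namespace IsTestFun

variable {n : ℕ} {Ω : Set (Rn n)} {φ χ : Rn n → ℝ}

lemma differentiable (hφ : IsTestFun Ω φ) : Differentiable ℝ φ :=
  hφ.smooth.differentiable (by simp)

lemma contDiff_one (hφ : IsTestFun Ω φ) : ContDiff ℝ 1 φ := hφ.smooth.of_le (by exact_mod_cast le_top)

lemma continuous (hφ : IsTestFun Ω φ) : Continuous φ := hφ.smooth.continuous

lemma continuous_grad (hφ : IsTestFun Ω φ) : Continuous (fun x => gradient φ x) :=
  continuous_gradient hφ.contDiff_one

lemma hasCompactSupport_grad (hφ : IsTestFun Ω φ) : HasCompactSupport (fun x => gradient φ x) :=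
  hφ.compact.mono' ((subset_tsupport _).trans (tsupport_gradient_subset φ))

lemma tsupport_grad_subset (hφ : IsTestFun Ω φ) : tsupport (fun x => gradient φ x) ⊆ Ω :=
  (tsupport_gradient_subset φ).trans hφ.subset

lemma zero_of_notMem (hφ : IsTestFun Ω φ) {x : Rn n} (hx : x ∉ Ω) : φ x = 0 :=
  image_eq_zero_of_notMem_tsupport (fun h => hx (hφ.subset h))

lemma grad_zero_of_notMem (hφ : IsTestFun Ω φ) {x : Rn n} (hx : x ∉ Ω) : gradient φ x = 0 :=
  image_eq_zero_of_notMem_tsupport (f := fun x => gradient φ x)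
    (fun h => hx (hφ.tsupport_grad_subset h))

lemma mono {Ω' : Set (Rn n)} (hφ : IsTestFun Ω φ) (h : Ω ⊆ Ω') : IsTestFun Ω' φ :=
  ⟨hφ.smooth, hφ.compact, hφ.subset.trans h⟩

lemma zero : IsTestFun Ω (fun _ => 0) :=
  ⟨contDiff_const, HasCompactSupport.zero, by simp [tsupport, Function.support]⟩

lemma add (hφ : IsTestFun Ω φ) (hχ : IsTestFun Ω χ) : IsTestFun Ω (fun x => φ x + χ x) :=
  ⟨hφ.smooth.add hχ.smooth, hφ.compact.add hχ.compact,
    (tsupport_add φ χ).trans (union_subset hφ.subset hχ.subset)⟩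

lemma mul_left (hφ : IsTestFun Ω φ) (hχ : ContDiff ℝ ∞ χ) : IsTestFun Ω (fun x => φ x * χ x) :=
  ⟨hφ.smooth.mul hχ, hφ.compact.mul_right, (tsupport_mul_subset_left).trans hφ.subset⟩

lemma const_mul (hφ : IsTestFun Ω φ) (c : ℝ) : IsTestFun Ω (fun x => c * φ x) := by
  simpa only [mul_comm] using hφ.mul_left (χ := fun _ => c) contDiff_const

lemma sub (hφ : IsTestFun Ω φ) (hχ : IsTestFun Ω χ) : IsTestFun Ω (fun x => φ x - χ x) := by
  simpa [sub_eq_add_neg] using hφ.add (hχ.const_mul (-1))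

lemma comp (hφ : IsTestFun Ω φ) {h : ℝ → ℝ} (hh : ContDiff ℝ ∞ h) (h0 : h 0 = 0) :
    IsTestFun Ω (fun x => h (φ x)) :=
  ⟨hh.comp hφ.smooth, hφ.compact.comp_left h0,
    (closure_mono (Function.support_comp_subset h0 φ)).trans hφ.subset⟩

lemma sum {ι : Type*} (s : Finset ι) {φ : ι → Rn n → ℝ} (h : ∀ i, IsTestFun Ω (φ i)) :
    IsTestFun Ω (fun x => ∑ i ∈ s, φ i x) := by
  classical
  induction s using Finset.induction_on with
  | empty => simpa using zero
  | insert a s ha ih => simpa [Finset.sum_insert ha] using (h a).add ih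

lemma memLp (hφ : IsTestFun Ω φ) (q : ℝ≥0∞) (μ : Measure (Rn n)) [IsFiniteMeasureOnCompacts μ] :
    MemLp φ q μ := hφ.continuous.memLp_of_hasCompactSupport hφ.compact

lemma memLp_grad (hφ : IsTestFun Ω φ) (q : ℝ≥0∞) (μ : Measure (Rn n))
    [IsFiniteMeasureOnCompacts μ] : MemLp (fun x => gradient φ x) q μ :=
  hφ.continuous_grad.memLp_of_hasCompactSupport hφ.hasCompactSupport_grad

lemma exists_bound (hφ : IsTestFun Ω φ) : ∃ C, 0 ≤ C ∧ ∀ x, ‖φ x‖ ≤ C ∧ ‖gradient φ x‖ ≤ C := by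
  obtain ⟨C, hC⟩ := hφ.compact.exists_bound_of_continuous hφ.continuous
  obtain ⟨C', hC'⟩ := hφ.hasCompactSupport_grad.exists_bound_of_continuous hφ.continuous_grad
  exact ⟨max C C', (norm_nonneg _).trans ((hC 0).trans (le_max_left _ _)),
    fun x => ⟨(hC x).trans (le_max_left _ _), (hC' x).trans (le_max_right _ _)⟩⟩

end IsTestFun

lemma exists_isTestFun_cutoff {n : ℕ} {Ω K : Set (Rn n)} (hΩ : IsOpen Ω) (hK : IsCompact K)
    (h : K ⊆ Ω) :
    ∃ η : Rn n → ℝ, IsTestFun Ω η ∧ (∀ x, 0 ≤ η x ∧ η x ≤ 1) ∧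
      ∃ O, IsOpen O ∧ K ⊆ O ∧ O ⊆ Ω ∧ ∀ x ∈ O, η x = 1 := by
  obtain ⟨K', hK', hKK', hK'Ω⟩ := exists_compact_between hK hΩ h
  obtain ⟨K'', hK'', hKK'', hK''Ω⟩ := exists_compact_between hK' hΩ hK'Ω
  obtain ⟨f, hf, hr, hs, h1⟩ := exists_contMDiff_support_eq_eq_one_iff (n := (⊤ : ℕ∞))
    (modelWithCornersSelf ℝ (Rn n)) (isOpen_interior (s := K'')) hK'.isClosed hKK''
  have hts : tsupport f ⊆ K'' := by
    rw [tsupport, hs]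
    exact closure_minimal interior_subset hK''.isClosed
  refine ⟨f, ⟨hf.contDiff, HasCompactSupport.of_support_subset_isCompact hK''
      ((subset_tsupport f).trans hts), hts.trans hK''Ω⟩,
    fun x => ⟨(hr ⟨x, rfl⟩).1, (hr ⟨x, rfl⟩).2⟩, interior K', isOpen_interior, hKK',
    interior_subset.trans hK'Ω, fun x hx => (h1 x).1 (interior_subset hx)⟩

/-! ### Integrals over compact sets -/

section LocalIntegrability

variable {n : ℕ} {Ω : Set (Rn n)} {E F H : Type*} [NormedAddCommGroup E] [NormedSpace ℝ E]
  [NormedAddCommGroup F] [NormedSpace ℝ F] [NormedAddCommGroup H] [NormedSpace ℝ H]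

lemma integrableOn_bilin_of_compact (B : E →L[ℝ] F →L[ℝ] H) {f : Rn n → E} {ψ : Rn n → F}
    (hΩ : MeasurableSet Ω)
    (hf : LocallyIntegrableOn f Ω) (hψ : Continuous ψ) (hc : HasCompactSupport ψ)
    (hs : tsupport ψ ⊆ Ω) : IntegrableOn (fun x => B (f x) (ψ x)) Ω := by
  have h1 : IntegrableOn f (tsupport ψ) := hf.integrableOn_compact_subset hs hc
  obtain ⟨C, hC⟩ := hc.exists_bound_of_continuous hψ
  have h2 : IntegrableOn (fun x => B (f x) (ψ x)) (tsupport ψ) := by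
    refine Integrable.mono' (h1.norm.const_mul (‖B‖ * C)) ?_ (Eventually.of_forall fun x => ?_)
    · exact B.aestronglyMeasurable_comp₂ h1.aestronglyMeasurable
        hψ.aestronglyMeasurable.restrict
    · calc ‖B (f x) (ψ x)‖ ≤ ‖B‖ * ‖f x‖ * ‖ψ x‖ := B.le_opNorm₂ _ _
        _ ≤ ‖B‖ * ‖f x‖ * C := by gcongr; exact hC x
        _ = ‖B‖ * C * ‖f x‖ := by ring
  refine h2.of_forall_sdiff_eq_zero hΩ (fun x hx => ?_)
  simp [image_eq_zero_of_notMem_tsupport hx.2]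

/-- Integration against a continuous compactly supported function is continuous under `L¹`
convergence on compact sets. -/
lemma tendsto_integral_bilin_of_compact (B : E →L[ℝ] F →L[ℝ] H) {f : Rn n → E}
    {fk : ℕ → Rn n → E} {ψ : Rn n → F} (hΩ : MeasurableSet Ω) (hf : LocallyIntegrableOn f Ω)
    (hfk : ∀ k, LocallyIntegrableOn (fk k) Ω) (hψ : Continuous ψ) (hc : HasCompactSupport ψ)
    (hs : tsupport ψ ⊆ Ω)
    (hlim : Tendsto (fun k => ∫⁻ x in tsupport ψ, ‖fk k x - f x‖ₑ) atTop (𝓝 0)) :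
    Tendsto (fun k => ∫ x in Ω, B (fk k x) (ψ x)) atTop (𝓝 (∫ x in Ω, B (f x) (ψ x))) := by
  obtain ⟨C, hC⟩ := hc.exists_bound_of_continuous hψ
  refine tendsto_integral_of_L1 _ (integrableOn_bilin_of_compact B hΩ hf hψ hc hs).1
    (Eventually.of_forall fun k => integrableOn_bilin_of_compact B hΩ (hfk k) hψ hc hs) ?_
  have hub : ∀ k, ∫⁻ x in Ω, ‖B (fk k x) (ψ x) - B (f x) (ψ x)‖ₑ ≤
      ENNReal.ofReal (‖B‖ * C) * ∫⁻ x in tsupport ψ, ‖fk k x - f x‖ₑ := by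
    intro k
    rw [← lintegral_const_mul' _ _ ENNReal.ofReal_ne_top,
      ← lintegral_indicator (isClosed_tsupport ψ).measurableSet]
    refine (setLIntegral_le_lintegral _ _).trans (lintegral_mono fun x => ?_)
    by_cases hx : x ∈ tsupport ψ
    · rw [indicator_of_mem hx, ← sub_apply, ← map_sub, ← ofReal_norm,
        ← ofReal_norm, ← ENNReal.ofReal_mul' (norm_nonneg _)]
      apply ENNReal.ofReal_le_ofReal
      calc ‖B (fk k x - f x) (ψ x)‖ ≤ ‖B‖ * ‖fk k x - f x‖ * ‖ψ x‖ := B.le_opNorm₂ _ _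
        _ ≤ ‖B‖ * ‖fk k x - f x‖ * C := by gcongr; exact hC x
        _ = ‖B‖ * C * ‖fk k x - f x‖ := by ring
    · simp [image_eq_zero_of_notMem_tsupport hx]
  have h0 := ENNReal.Tendsto.const_mul (a := ENNReal.ofReal (‖B‖ * C)) hlim
    (Or.inr ENNReal.ofReal_ne_top)
  rw [mul_zero] at h0
  exact tendsto_of_tendsto_of_tendsto_of_le_of_le tendsto_const_nhds h0 (fun _ => zero_le) hub

lemma locallyIntegrableOn_of_memLp {M : Type*} [NormedAddCommGroup M] {q : ℝ≥0∞} (hq : 1 ≤ q)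
    {f : Rn n → M}
    (hf : MemLp f q (volume.restrict Ω)) : LocallyIntegrableOn f Ω :=
  locallyIntegrableOn_of_locallyIntegrable_restrict (hf.locallyIntegrable hq)

lemma tendsto_lintegral_of_eLpNorm {M : Type*} [NormedAddCommGroup M] {q : ℝ≥0∞} (hq : 1 ≤ q)
    {f : Rn n → M} {fk : ℕ → Rn n → M}
    {K : Set (Rn n)} (hK : IsCompact K) (hf : AEStronglyMeasurable f (volume.restrict K))
    (hfk : ∀ k, AEStronglyMeasurable (fk k) (volume.restrict K))
    (hlim : Tendsto (fun k => eLpNorm (fun x => fk k x - f x) q (volume.restrict K)) atTop (𝓝 0)) :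
    Tendsto (fun k => ∫⁻ x in K, ‖fk k x - f x‖ₑ) atTop (𝓝 0) := by
  set C : ℝ≥0∞ := (volume.restrict K) univ ^ (1 / (1 : ℝ≥0∞).toReal - 1 / q.toReal) with hC
  have hCtop : C ≠ ⊤ := by
    refine ENNReal.rpow_ne_top_of_nonneg ?_ ?_
    · rcases eq_or_ne q ⊤ with rfl | h
      · simp
      · have : 1 ≤ q.toReal := by simpa using ENNReal.toReal_mono h hq
        simp only [ENNReal.toReal_one, div_one, one_div]
        linarith [inv_le_one_of_one_le₀ this]
    · simpa using hK.measure_lt_top.ne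
  have hub : ∀ k, ∫⁻ x in K, ‖fk k x - f x‖ₑ ≤
      eLpNorm (fun x => fk k x - f x) q (volume.restrict K) * C := by
    intro k
    rw [← eLpNorm_one_eq_lintegral_enorm]
    exact eLpNorm_le_eLpNorm_mul_rpow_measure_univ hq ((hfk k).sub hf)
  have h0 := ENNReal.Tendsto.mul_const (b := C) hlim (Or.inr hCtop)
  rw [zero_mul] at h0
  exact tendsto_of_tendsto_of_tendsto_of_le_of_le tendsto_const_nhds h0 (fun _ => zero_le) hub

end LocalIntegrability

/-! ### Weak gradients -/

namespace HasWeakGradient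

variable {n : ℕ} {Ω : Set (Rn n)} {v w : Rn n → ℝ} {g h : Rn n → Rn n}

lemma integrable_left (hΩ : IsOpen Ω) (hv : LocallyIntegrableOn v Ω) {φ : Rn n → ℝ}
    (hφ : IsTestFun Ω φ) : IntegrableOn (fun x => v x • gradient φ x) Ω :=
  integrableOn_bilin_of_compact (ContinuousLinearMap.lsmul ℝ ℝ) hΩ.measurableSet hv
    hφ.continuous_grad hφ.hasCompactSupport_grad hφ.tsupport_grad_subset

lemma integrable_right (hΩ : IsOpen Ω) (hg : LocallyIntegrableOn g Ω) {φ : Rn n → ℝ}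
    (hφ : IsTestFun Ω φ) : IntegrableOn (fun x => φ x • g x) Ω :=
  integrableOn_bilin_of_compact (ContinuousLinearMap.lsmul ℝ ℝ).flip hΩ.measurableSet hg
    hφ.continuous hφ.compact hφ.subset

lemma add (hΩ : IsOpen Ω) (hv : HasWeakGradient Ω v g) (hw : HasWeakGradient Ω w h) :
    HasWeakGradient Ω (fun x => v x + w x) (fun x => g x + h x) := by
  refine ⟨hv.locInt.add hw.locInt, hv.locInt_grad.add hw.locInt_grad, fun φ hφ => ?_⟩
  simp only [add_smul, smul_add]
  rw [integral_add (integrable_left hΩ hv.locInt hφ) (integrable_left hΩ hw.locInt hφ),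
    integral_add (integrable_right hΩ hv.locInt_grad hφ) (integrable_right hΩ hw.locInt_grad hφ),
    hv.parts φ hφ, hw.parts φ hφ, neg_add]

lemma const_mul (hv : HasWeakGradient Ω v g) (c : ℝ) :
    HasWeakGradient Ω (fun x => c * v x) (fun x => c • g x) := by
  refine ⟨hv.locInt.smul c, hv.locInt_grad.smul c, fun φ hφ => ?_⟩
  simp only [mul_smul, smul_comm _ c]
  rw [integral_smul, integral_smul, hv.parts φ hφ, smul_neg]

lemma sub (hΩ : IsOpen Ω) (hv : HasWeakGradient Ω v g) (hw : HasWeakGradient Ω w h) :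
    HasWeakGradient Ω (fun x => v x - w x) (fun x => g x - h x) := by
  simpa [sub_eq_add_neg] using hv.add hΩ (hw.const_mul (-1))

lemma mono {Ω' : Set (Rn n)} (hΩ' : Ω' ⊆ Ω)
    (hv : HasWeakGradient Ω v g) : HasWeakGradient Ω' v g := by
  refine ⟨hv.locInt.mono_set hΩ', hv.locInt_grad.mono_set hΩ', fun φ hφ => ?_⟩
  have h1 : ∫ x in Ω', v x • gradient φ x = ∫ x in Ω, v x • gradient φ x := by
    rw [setIntegral_eq_integral_of_forall_compl_eq_zero, setIntegral_eq_integral_of_forall_compl_eq_zero]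
    · intro x hx; simp [hφ.grad_zero_of_notMem (fun h => hx (hΩ' h))]
    · intro x hx; simp [hφ.grad_zero_of_notMem hx]
  have h2 : ∫ x in Ω', φ x • g x = ∫ x in Ω, φ x • g x := by
    rw [setIntegral_eq_integral_of_forall_compl_eq_zero, setIntegral_eq_integral_of_forall_compl_eq_zero]
    · intro x hx; simp [hφ.zero_of_notMem (fun h => hx (hΩ' h))]
    · intro x hx; simp [hφ.zero_of_notMem hx]
  rw [h1, h2, hv.parts φ (hφ.mono hΩ')]

lemma ae_unique (hΩ : IsOpen Ω) (hv : HasWeakGradient Ω v g) (hw : HasWeakGradient Ω v h) :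
    g =ᵐ[volume.restrict Ω] h := by
  have key := hΩ.ae_eq_zero_of_integral_contDiff_smul_eq_zero (μ := volume.restrict Ω)
    (f := fun x => g x - h x) ?_ ?_
  · rw [ae_restrict_iff' hΩ.measurableSet] at key
    rw [EventuallyEq, ae_restrict_iff' hΩ.measurableSet]
    filter_upwards [key] with x hx hxΩ
    exact sub_eq_zero.1 (hx hxΩ hxΩ)
  · exact (hv.locInt_grad.sub hw.locInt_grad).mono_measure Measure.restrict_le_self
  · intro φ h1 h2 h3
    have hφ : IsTestFun Ω φ := ⟨h1, h2, h3⟩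
    simp only [smul_sub]
    rw [integral_sub (integrable_right hΩ hv.locInt_grad hφ)
      (integrable_right hΩ hw.locInt_grad hφ), sub_eq_zero]
    have e1 := hv.parts φ hφ
    have e2 := hw.parts φ hφ
    rw [e1] at e2
    exact neg_injective e2

/-- Weak gradients are stable under `L¹` convergence on compact subsets. -/
lemma of_tendsto (hΩ : IsOpen Ω) {vk : ℕ → Rn n → ℝ} {gk : ℕ → Rn n → Rn n}
    (hk : ∀ k, HasWeakGradient Ω (vk k) (gk k)) (hv : LocallyIntegrableOn v Ω)
    (hg : LocallyIntegrableOn g Ω)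
    (h1 : ∀ K, IsCompact K → K ⊆ Ω →
      Tendsto (fun k => ∫⁻ x in K, ‖vk k x - v x‖ₑ) atTop (𝓝 0))
    (h2 : ∀ K, IsCompact K → K ⊆ Ω →
      Tendsto (fun k => ∫⁻ x in K, ‖gk k x - g x‖ₑ) atTop (𝓝 0)) : HasWeakGradient Ω v g := by
  refine ⟨hv, hg, fun φ hφ => ?_⟩
  have l1 := tendsto_integral_bilin_of_compact (ContinuousLinearMap.lsmul ℝ ℝ)
    hΩ.measurableSet hv (fun k => (hk k).locInt)
    hφ.continuous_grad hφ.hasCompactSupport_grad hφ.tsupport_grad_subset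
    (h1 _ hφ.hasCompactSupport_grad hφ.tsupport_grad_subset)
  have l2 := tendsto_integral_bilin_of_compact (ContinuousLinearMap.lsmul ℝ ℝ).flip
    hΩ.measurableSet hg (fun k => (hk k).locInt_grad)
    hφ.continuous hφ.compact hφ.subset (h2 _ hφ.compact hφ.subset)
  refine tendsto_nhds_unique l1 (l2.neg.congr fun k => ?_)
  exact ((hk k).parts φ hφ).symm

lemma weakGradient_ae_eq (hΩ : IsOpen Ω) (hv : HasWeakGradient Ω v g) :
    weakGradient Ω v =ᵐ[volume.restrict Ω] g := by
  have h : ∃ g, HasWeakGradient Ω v g := ⟨g, hv⟩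
  rw [weakGradient, dif_pos h]
  exact h.choose_spec.ae_unique hΩ hv

/-- The classical gradient of a test function on any larger domain is a weak gradient. -/
lemma of_isTestFun {χ : Rn n → ℝ} (hχ : IsTestFun univ χ) :
    HasWeakGradient Ω χ (fun x => gradient χ x) := by
  refine ⟨(hχ.continuous.locallyIntegrable).locallyIntegrableOn _,
    (hχ.continuous_grad.locallyIntegrable).locallyIntegrableOn _, fun φ hφ => ?_⟩
  rw [setIntegral_eq_integral_of_forall_compl_eq_zero,
    setIntegral_eq_integral_of_forall_compl_eq_zero]
  rotate_left
  · intro x hx; simp [hφ.zero_of_notMem hx]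
  · intro x hx; simp [hφ.grad_zero_of_notMem hx]
  have hi1 : Integrable (fun x => χ x • gradient φ x) := by
    simpa using integrable_left isOpen_univ
      ((hχ.continuous.locallyIntegrable (μ := volume)).locallyIntegrableOn univ)
      (hφ.mono (subset_univ _))
  have hi2 : Integrable (fun x => φ x • gradient χ x) := by
    simpa using integrable_right isOpen_univ
      ((hχ.continuous_grad.locallyIntegrable (μ := volume)).locallyIntegrableOn univ)
      (hφ.mono (subset_univ _))
  refine ext_inner_left ℝ fun y => ?_
  rw [inner_neg_right, ← integral_inner hi1, ← integral_inner hi2]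
  have hg : ∀ (f : Rn n → ℝ) x, inner ℝ y (gradient f x) = fderiv ℝ f x y := fun f x => by
    rw [real_inner_comm]; exact inner_gradient_left
  have e1 : ∀ x, inner ℝ y (χ x • gradient φ x) = χ x * fderiv ℝ φ x y := fun x => by
    rw [inner_smul_right, hg]
  have e2 : ∀ x, inner ℝ y (φ x • gradient χ x) = fderiv ℝ χ x y * φ x := fun x => by
    rw [inner_smul_right, hg, mul_comm]
  simp only [e1, e2]
  refine integral_mul_fderiv_eq_neg_fderiv_mul_of_integrable ?_ ?_ ?_
    (fun x _ => hχ.differentiable x) (fun x _ => hφ.differentiable x)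
  · exact (hi2.const_inner y).congr (Eventually.of_forall e2)
  · exact (hi1.const_inner y).congr (Eventually.of_forall e1)
  · exact (hχ.continuous.mul hφ.continuous).integrable_of_hasCompactSupport hφ.compact.mul_left

end HasWeakGradient

/-! ### Sobolev functions and limits of test functions -/

/-- A function `v ∈ L^p(Ω)` together with a weak gradient `g ∈ L^p(Ω)`. Carrying the gradient along
avoids the choice in `weakGradient`. -/
structure IsSobolevPair {n : ℕ} (Ω : Set (Rn n)) (p : ℝ) (v : Rn n → ℝ) (g : Rn n → Rn n) :
    Prop where
  weak : HasWeakGradient Ω v g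
  memLp : MemLp v (ENNReal.ofReal p) (volume.restrict Ω)
  memLp_grad : MemLp g (ENNReal.ofReal p) (volume.restrict Ω)

/-- The test functions `φ k` converge to `v`, and their gradients to `g`, in `L^p(Ω)`; thus
`v ∈ W^{1,p}_0(Ω)` with weak gradient `g`. -/
structure SobolevTendsto {n : ℕ} (Ω : Set (Rn n)) (p : ℝ) (φ : ℕ → Rn n → ℝ) (v : Rn n → ℝ)
    (g : Rn n → Rn n) : Prop where
  test : ∀ k, IsTestFun Ω (φ k)
  memLp : MemLp v (ENNReal.ofReal p) (volume.restrict Ω)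
  memLp_grad : MemLp g (ENNReal.ofReal p) (volume.restrict Ω)
  tendsto : Tendsto (fun k => eLpNorm (fun x => φ k x - v x) (ENNReal.ofReal p)
    (volume.restrict Ω)) atTop (𝓝 0)
  tendsto_grad : Tendsto (fun k => eLpNorm (fun x => gradient (φ k) x - g x) (ENNReal.ofReal p)
    (volume.restrict Ω)) atTop (𝓝 0)

section SobolevPair

variable {n : ℕ} {Ω : Set (Rn n)} {p : ℝ} {v w : Rn n → ℝ} {g h : Rn n → Rn n}
  {φ χ : ℕ → Rn n → ℝ}

lemma one_le_ofReal (hp : 1 < p) : 1 ≤ ENNReal.ofReal p := by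
  rw [← ENNReal.ofReal_one]; exact ENNReal.ofReal_le_ofReal hp.le

namespace IsSobolevPair

lemma add (hΩ : IsOpen Ω) (hv : IsSobolevPair Ω p v g) (hw : IsSobolevPair Ω p w h) :
    IsSobolevPair Ω p (fun x => v x + w x) (fun x => g x + h x) :=
  ⟨hv.weak.add hΩ hw.weak, hv.memLp.add hw.memLp, hv.memLp_grad.add hw.memLp_grad⟩

lemma sub (hΩ : IsOpen Ω) (hv : IsSobolevPair Ω p v g) (hw : IsSobolevPair Ω p w h) :
    IsSobolevPair Ω p (fun x => v x - w x) (fun x => g x - h x) :=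
  ⟨hv.weak.sub hΩ hw.weak, hv.memLp.sub hw.memLp, hv.memLp_grad.sub hw.memLp_grad⟩

lemma const_mul (hv : IsSobolevPair Ω p v g) (c : ℝ) :
    IsSobolevPair Ω p (fun x => c * v x) (fun x => c • g x) :=
  ⟨hv.weak.const_mul c, hv.memLp.const_mul c, hv.memLp_grad.const_smul c⟩

lemma mono {Ω' : Set (Rn n)} (h : Ω' ⊆ Ω) (hv : IsSobolevPair Ω p v g) :
    IsSobolevPair Ω' p v g :=
  ⟨hv.weak.mono h, hv.memLp.mono_measure (Measure.restrict_mono h le_rfl),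
    hv.memLp_grad.mono_measure (Measure.restrict_mono h le_rfl)⟩

lemma memW1p (hΩ : IsOpen Ω) (hv : IsSobolevPair Ω p v g) : MemW1p Ω p v :=
  ⟨⟨g, hv.weak⟩, hv.memLp, (memLp_congr_ae (hv.weak.weakGradient_ae_eq hΩ)).2 hv.memLp_grad⟩

lemma of_memW1p (hv : MemW1p Ω p v) : IsSobolevPair Ω p v (weakGradient Ω v) := by
  refine ⟨?_, hv.2.1, hv.2.2⟩
  rw [weakGradient, dif_pos hv.1]
  exact hv.1.choose_spec

lemma of_isTestFun {φ : Rn n → ℝ} (hφ : IsTestFun univ φ) :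
    IsSobolevPair Ω p φ (fun x => gradient φ x) :=
  ⟨HasWeakGradient.of_isTestFun hφ, hφ.memLp _ _, hφ.memLp_grad _ _⟩

end IsSobolevPair

namespace SobolevTendsto

/-- The limit of the gradients of test functions is a weak gradient of their limit. -/
lemma isSobolevPair (hΩ : IsOpen Ω) (hp : 1 < p) (hv : SobolevTendsto Ω p φ v g) :
    IsSobolevPair Ω p v g := by
  have hq := one_le_ofReal hp
  refine ⟨?_, hv.memLp, hv.memLp_grad⟩
  refine HasWeakGradient.of_tendsto hΩ
    (fun k => HasWeakGradient.of_isTestFun ((hv.test k).mono (subset_univ _)))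
    (locallyIntegrableOn_of_memLp hq hv.memLp) (locallyIntegrableOn_of_memLp hq hv.memLp_grad) ?_ ?_
  · intro K hK hKΩ
    refine tendsto_lintegral_of_eLpNorm hq hK
      (hv.memLp.1.mono_measure (Measure.restrict_mono hKΩ le_rfl))
      (fun k => (hv.test k).continuous.aestronglyMeasurable) ?_
    exact tendsto_of_tendsto_of_tendsto_of_le_of_le tendsto_const_nhds hv.tendsto
      (fun _ => zero_le) (fun k => eLpNorm_mono_measure _ (Measure.restrict_mono hKΩ le_rfl))
  · intro K hK hKΩ
    refine tendsto_lintegral_of_eLpNorm hq hK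
      (hv.memLp_grad.1.mono_measure (Measure.restrict_mono hKΩ le_rfl))
      (fun k => (hv.test k).continuous_grad.aestronglyMeasurable) ?_
    exact tendsto_of_tendsto_of_tendsto_of_le_of_le tendsto_const_nhds hv.tendsto_grad
      (fun _ => zero_le) (fun k => eLpNorm_mono_measure _ (Measure.restrict_mono hKΩ le_rfl))

lemma congr (hv : SobolevTendsto Ω p φ v g) (h1 : v =ᵐ[volume.restrict Ω] w)
    (h2 : g =ᵐ[volume.restrict Ω] h) : SobolevTendsto Ω p φ w h := by
  refine ⟨hv.test, (memLp_congr_ae h1).1 hv.memLp, (memLp_congr_ae h2).1 hv.memLp_grad,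
    hv.tendsto.congr fun k => eLpNorm_congr_ae ?_, hv.tendsto_grad.congr fun k => eLpNorm_congr_ae ?_⟩
  · filter_upwards [h1] with x hx; rw [hx]
  · filter_upwards [h2] with x hx; rw [hx]

lemma memW1p0 (hΩ : IsOpen Ω) (hp : 1 < p) (hv : SobolevTendsto Ω p φ v g) : MemW1p0 Ω p v := by
  have h := hv.isSobolevPair hΩ hp
  have h' := hv.congr (EventuallyEq.refl _ v) (h.weak.weakGradient_ae_eq hΩ).symm
  exact ⟨h.memW1p hΩ, φ, h'.test, h'.tendsto, h'.tendsto_grad⟩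

lemma of_memW1p0 (hv : MemW1p0 Ω p v) : ∃ φ, SobolevTendsto Ω p φ v (weakGradient Ω v) := by
  obtain ⟨h, φ, h1, h2, h3⟩ := hv
  exact ⟨φ, h1, h.2.1, h.2.2, h2, h3⟩

lemma add (hp : 1 < p) (hv : SobolevTendsto Ω p φ v g) (hw : SobolevTendsto Ω p χ w h) :
    SobolevTendsto Ω p (fun k x => φ k x + χ k x) (fun x => v x + w x) (fun x => g x + h x) := by
  have hq := one_le_ofReal hp
  refine ⟨fun k => (hv.test k).add (hw.test k), hv.memLp.add hw.memLp,
    hv.memLp_grad.add hw.memLp_grad, ?_, ?_⟩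
  · have h0 := hv.tendsto.add hw.tendsto
    rw [add_zero] at h0
    refine tendsto_of_tendsto_of_tendsto_of_le_of_le tendsto_const_nhds h0 (fun _ => zero_le)
      (fun k => ?_)
    have e : (fun x => φ k x + χ k x - (v x + w x)) =
      (fun x => φ k x - v x) + (fun x => χ k x - w x) := by ext x; simp; ring
    rw [e]
    exact eLpNorm_add_le (((hv.test k).memLp (ENNReal.ofReal p) _).sub hv.memLp).1
      (((hw.test k).memLp (ENNReal.ofReal p) _).sub hw.memLp).1 hq
  · have h0 := hv.tendsto_grad.add hw.tendsto_grad
    rw [add_zero] at h0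
    refine tendsto_of_tendsto_of_tendsto_of_le_of_le tendsto_const_nhds h0 (fun _ => zero_le)
      (fun k => ?_)
    have e : (fun x => gradient (fun y => φ k y + χ k y) x - (g x + h x)) =
        (fun x => gradient (φ k) x - g x) + (fun x => gradient (χ k) x - h x) := by
      ext1 x
      rw [gradient_add' ((hv.test k).differentiable x) ((hw.test k).differentiable x)]
      simp only [Pi.add_apply]
      abel
    rw [e]
    exact eLpNorm_add_le (((hv.test k).memLp_grad (ENNReal.ofReal p) _).sub hv.memLp_grad).1
      (((hw.test k).memLp_grad (ENNReal.ofReal p) _).sub hw.memLp_grad).1 hq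

lemma const_mul (hv : SobolevTendsto Ω p φ v g) (c : ℝ) :
    SobolevTendsto Ω p (fun k x => c * φ k x) (fun x => c * v x) (fun x => c • g x) := by
  refine ⟨fun k => (hv.test k).const_mul c, hv.memLp.const_mul c, hv.memLp_grad.const_smul c, ?_, ?_⟩
  · have h0 := ENNReal.Tendsto.const_mul (a := ‖c‖ₑ) hv.tendsto (Or.inr enorm_ne_top)
    rw [mul_zero] at h0
    refine h0.congr fun k => ?_
    rw [← eLpNorm_const_smul]
    congr 1; ext x; simp; ring
  · have h0 := ENNReal.Tendsto.const_mul (a := ‖c‖ₑ) hv.tendsto_grad (Or.inr enorm_ne_top)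
    rw [mul_zero] at h0
    refine h0.congr fun k => ?_
    rw [← eLpNorm_const_smul]
    congr 1; ext1 x
    rw [gradient_const_mul' c ((hv.test k).differentiable x)]
    simp [smul_sub]

lemma sub (hp : 1 < p) (hv : SobolevTendsto Ω p φ v g) (hw : SobolevTendsto Ω p χ w h) :
    SobolevTendsto Ω p (fun k x => φ k x - χ k x) (fun x => v x - w x) (fun x => g x - h x) := by
  simpa [sub_eq_add_neg] using hv.add hp (hw.const_mul (-1))

end SobolevTendsto

section Localize

variable {E F : Type*} [NormedAddCommGroup E] [NormedAddCommGroup F]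

lemma eLpNorm_le_of_support {q : ℝ≥0∞} {K : Set (Rn n)} (hK : MeasurableSet K) {C : ℝ}
    {f : Rn n → E} {H : Rn n → F} (hb : ∀ x, ‖H x‖ ≤ C * ‖f x‖) (h0 : ∀ x, x ∉ K → H x = 0) :
    eLpNorm H q (volume.restrict Ω) ≤ ENNReal.ofReal C * eLpNorm f q (volume.restrict K) := by
  have e : H = K.indicator H := by
    ext1 x
    by_cases hx : x ∈ K
    · simp [hx]
    · simp [hx, h0 x hx]
  calc eLpNorm H q (volume.restrict Ω) ≤ eLpNorm H q volume :=
        eLpNorm_mono_measure _ Measure.restrict_le_self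
    _ = eLpNorm (K.indicator H) q volume := by rw [← e]
    _ = eLpNorm H q (volume.restrict K) := eLpNorm_indicator_eq_eLpNorm_restrict hK
    _ ≤ _ := eLpNorm_le_mul_eLpNorm_of_ae_le_mul (Eventually.of_forall hb) q

lemma memLp_of_support {q : ℝ≥0∞} {K : Set (Rn n)} (hK : MeasurableSet K) {C : ℝ}
    {f : Rn n → E} {H : Rn n → F} (hf : MemLp f q (volume.restrict K))
    (hH : AEStronglyMeasurable H (volume.restrict K))
    (hb : ∀ x, ‖H x‖ ≤ C * ‖f x‖) (h0 : ∀ x, x ∉ K → H x = 0) :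
    MemLp H q (volume.restrict Ω) := by
  have e : H = K.indicator H := by
    ext1 x
    by_cases hx : x ∈ K
    · simp [hx]
    · simp [hx, h0 x hx]
  have : MemLp H q volume := by
    rw [e, memLp_indicator_iff_restrict hK]
    exact hf.of_le_mul hH (Eventually.of_forall hb)
  exact this.mono_measure Measure.restrict_le_self

end Localize

lemma IsTestFun.eLpNorm_mul_le {η : Rn n → ℝ} (_hη : IsTestFun Ω η) {C : ℝ}
    (hC : ∀ x, ‖η x‖ ≤ C ∧ ‖gradient η x‖ ≤ C) (q : ℝ≥0∞) (v : Rn n → ℝ) :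
    eLpNorm (fun x => η x * v x) q (volume.restrict Ω) ≤
      ENNReal.ofReal C * eLpNorm v q (volume.restrict (tsupport η)) := by
  refine eLpNorm_le_of_support (isClosed_tsupport η).measurableSet (fun x => ?_) (fun x hx => ?_)
  · rw [norm_mul]; gcongr; exact (hC x).1
  · simp [image_eq_zero_of_notMem_tsupport hx]

lemma IsTestFun.eLpNorm_mul_grad_le {η : Rn n → ℝ} (hη : IsTestFun Ω η) {C : ℝ}
    (hC : ∀ x, ‖η x‖ ≤ C ∧ ‖gradient η x‖ ≤ C) {q : ℝ≥0∞} (hq : 1 ≤ q) {v : Rn n → ℝ}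
    {g : Rn n → Rn n} (hv : AEStronglyMeasurable v (volume.restrict (tsupport η)))
    (hg : AEStronglyMeasurable g (volume.restrict (tsupport η))) :
    eLpNorm (fun x => v x • gradient η x + η x • g x) q (volume.restrict Ω) ≤
      ENNReal.ofReal C * (eLpNorm v q (volume.restrict (tsupport η)) +
        eLpNorm g q (volume.restrict (tsupport η))) := by
  have hK := (isClosed_tsupport η).measurableSet
  have hg0 : ∀ x, x ∉ tsupport η → gradient η x = 0 := fun x hx =>
    image_eq_zero_of_notMem_tsupport (f := fun x => gradient η x)
      (fun h => hx (tsupport_gradient_subset η h))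
  have e : (fun x => v x • gradient η x + η x • g x) =
      (tsupport η).indicator (fun x => v x • gradient η x + η x • g x) := by
    ext1 x
    by_cases hx : x ∈ tsupport η
    · simp [hx]
    · simp [hx, hg0 x hx, image_eq_zero_of_notMem_tsupport hx]
  calc eLpNorm (fun x => v x • gradient η x + η x • g x) q (volume.restrict Ω)
      ≤ eLpNorm (fun x => v x • gradient η x + η x • g x) q volume :=
        eLpNorm_mono_measure _ Measure.restrict_le_self
    _ = eLpNorm (fun x => v x • gradient η x + η x • g x) q (volume.restrict (tsupport η)) := by
        conv_lhs => rw [e]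
        exact eLpNorm_indicator_eq_eLpNorm_restrict hK
    _ ≤ eLpNorm (fun x => v x • gradient η x) q (volume.restrict (tsupport η)) +
        eLpNorm (fun x => η x • g x) q (volume.restrict (tsupport η)) :=
        eLpNorm_add_le (hv.smul hη.continuous_grad.aestronglyMeasurable)
          (hη.continuous.aestronglyMeasurable.smul hg) hq
    _ ≤ ENNReal.ofReal C * eLpNorm v q (volume.restrict (tsupport η)) +
        ENNReal.ofReal C * eLpNorm g q (volume.restrict (tsupport η)) := by
        gcongr
        · refine eLpNorm_le_mul_eLpNorm_of_ae_le_mul (Eventually.of_forall fun x => ?_) q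
          rw [norm_smul, mul_comm]
          gcongr
          exact (hC x).2
        · refine eLpNorm_le_mul_eLpNorm_of_ae_le_mul (Eventually.of_forall fun x => ?_) q
          rw [norm_smul]
          gcongr
          exact (hC x).1
    _ = _ := by rw [mul_add]

lemma IsTestFun.memLp_mul {η : Rn n → ℝ} (hη : IsTestFun Ω η) {q : ℝ≥0∞}
    (hv : MemLp v q (volume.restrict (tsupport η))) :
    MemLp (fun x => η x * v x) q (volume.restrict Ω) := by
  obtain ⟨C, -, hC⟩ := hη.exists_bound
  refine memLp_of_support (isClosed_tsupport η).measurableSet hv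
    (hη.continuous.aestronglyMeasurable.mul hv.1) (C := C) (fun x => ?_) (fun x hx => ?_)
  · rw [norm_mul]; gcongr; exact (hC x).1
  · simp [image_eq_zero_of_notMem_tsupport hx]

lemma IsTestFun.memLp_mul_grad {η : Rn n → ℝ} (hη : IsTestFun Ω η) {q : ℝ≥0∞}
    (hv : MemLp v q (volume.restrict (tsupport η)))
    (hg : MemLp g q (volume.restrict (tsupport η))) :
    MemLp (fun x => v x • gradient η x + η x • g x) q (volume.restrict Ω) := by
  obtain ⟨C, -, hC⟩ := hη.exists_bound
  refine MemLp.add ?_ ?_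
  · refine memLp_of_support (isClosed_tsupport η).measurableSet hv
      (hv.1.smul hη.continuous_grad.aestronglyMeasurable) (C := C) (fun x => ?_) (fun x hx => ?_)
    · rw [norm_smul, mul_comm]; gcongr; exact (hC x).2
    · rw [image_eq_zero_of_notMem_tsupport (f := fun x => gradient η x)
        (fun h => hx (tsupport_gradient_subset η h)), smul_zero]
  · refine memLp_of_support (isClosed_tsupport η).measurableSet hg
      (hη.continuous.aestronglyMeasurable.smul hg.1) (C := C) (fun x => ?_) (fun x hx => ?_)
    · rw [norm_smul]; gcongr; exact (hC x).1
    · simp [image_eq_zero_of_notMem_tsupport hx]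

/-- If smooth functions converge in `W^{1,p}` on the support of a test function `η`, then their
products with `η` are test functions which converge in `W^{1,p}(Ω)`. -/
lemma SobolevTendsto.mul_isTestFun {η : Rn n → ℝ} (hη : IsTestFun Ω η) {vk : ℕ → Rn n → ℝ}
    (hp : 1 < p) (hvk : ∀ k, ContDiff ℝ ∞ (vk k))
    (hv : MemLp v (ENNReal.ofReal p) (volume.restrict (tsupport η)))
    (hg : MemLp g (ENNReal.ofReal p) (volume.restrict (tsupport η)))
    (h1 : Tendsto (fun k => eLpNorm (fun x => vk k x - v x) (ENNReal.ofReal p)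
      (volume.restrict (tsupport η))) atTop (𝓝 0))
    (h2 : Tendsto (fun k => eLpNorm (fun x => gradient (vk k) x - g x) (ENNReal.ofReal p)
      (volume.restrict (tsupport η))) atTop (𝓝 0)) :
    SobolevTendsto Ω p (fun k x => η x * vk k x) (fun x => η x * v x)
      (fun x => v x • gradient η x + η x • g x) := by
  have hq := one_le_ofReal hp
  obtain ⟨C, -, hC⟩ := hη.exists_bound
  refine ⟨fun k => hη.mul_left (hvk k), hη.memLp_mul hv, hη.memLp_mul_grad hv hg, ?_, ?_⟩
  · have h0 := ENNReal.Tendsto.const_mul (a := ENNReal.ofReal C) h1 (Or.inr ENNReal.ofReal_ne_top)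
    rw [mul_zero] at h0
    refine tendsto_of_tendsto_of_tendsto_of_le_of_le tendsto_const_nhds h0 (fun _ => zero_le)
      (fun k => ?_)
    simp only [← mul_sub]
    exact hη.eLpNorm_mul_le hC _ _
  · have h0 := ENNReal.Tendsto.const_mul (a := ENNReal.ofReal C) (h1.add h2)
      (Or.inr ENNReal.ofReal_ne_top)
    rw [add_zero, mul_zero] at h0
    refine tendsto_of_tendsto_of_tendsto_of_le_of_le tendsto_const_nhds h0 (fun _ => zero_le)
      (fun k => ?_)
    have e : (fun x => gradient (fun y => η y * vk k y) x - (v x • gradient η x + η x • g x)) =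
        fun x => (vk k x - v x) • gradient η x + η x • (gradient (vk k) x - g x) := by
      ext1 x
      rw [gradient_mul' (hη.differentiable x) ((hvk k).differentiable (by simp) x), sub_smul,
        smul_sub]
      abel
    rw [e]
    refine hη.eLpNorm_mul_grad_le hC hq ((hvk k).continuous.aestronglyMeasurable.sub hv.1) ?_
    exact (continuous_gradient
      ((hvk k).of_le (by exact_mod_cast le_top))).aestronglyMeasurable.sub hg.1

end SobolevPair

/-! ### Mollification -/

section Mollification

variable {n : ℕ} {E : Type*} [NormedAddCommGroup E] [NormedSpace ℝ E]

/-- The bump function of radius `1 / (k + 1)` used for mollification. -/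
noncomputable def mollBump (n k : ℕ) : ContDiffBump (0 : Rn n) where
  rIn := 1 / (2 * (k + 1))
  rOut := 1 / (k + 1)
  rIn_pos := by positivity
  rIn_lt_rOut := by
    apply one_div_lt_one_div_of_lt <;> [positivity; linarith [(k.cast_nonneg : (0 : ℝ) ≤ k)]]

/-- The mollification of `F` at scale `1 / (k + 1)`. -/
noncomputable def moll (k : ℕ) (F : Rn n → E) : Rn n → E :=
  MeasureTheory.convolution ((mollBump n k).normed volume) F (ContinuousLinearMap.lsmul ℝ ℝ) volume

lemma moll_eq (k : ℕ) (F : Rn n → E) (x : Rn n) :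
    moll k F x = ∫ t, (mollBump n k).normed volume (x - t) • F t := by
  rw [moll, convolution_lsmul_swap]

lemma moll_congr (k : ℕ) {F F' : Rn n → E} (h : F =ᵐ[volume] F') : moll k F = moll k F' :=
  convolution_congr _ EventuallyEq.rfl h

lemma tendsto_rOut_mollBump : Tendsto (fun k => (mollBump n k).rOut) atTop (𝓝 0) :=
  tendsto_one_div_add_atTop_nhds_zero_nat

lemma contDiff_moll (k : ℕ) {F : Rn n → E} [CompleteSpace E] (hF : LocallyIntegrable F volume) :
    ContDiff ℝ ∞ (moll k F) :=
  (mollBump n k).hasCompactSupport_normed.contDiff_convolution_left (μ := volume) _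
    (mollBump n k).contDiff_normed hF

lemma ae_tendsto_moll [CompleteSpace E] {F : Rn n → E} (hF : LocallyIntegrable F volume) :
    ∀ᵐ x, Tendsto (fun k => moll k F x) atTop (𝓝 (F x)) := by
  refine ContDiffBump.ae_convolution_tendsto_right_of_locallyIntegrable (μ := volume) (K := 2)
    tendsto_rOut_mollBump (Eventually.of_forall fun k => ?_) hF
  simp only [mollBump]
  apply le_of_eq
  field_simp

lemma integrable_moll (k : ℕ) {F : Rn n → E} (hF : LocallyIntegrable F volume) (x : Rn n) :
    Integrable (fun t => (mollBump n k).normed volume (x - t) • F t) := by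
  have h := ((mollBump n k).hasCompactSupport_normed (μ := volume)).convolutionExists_left
    (μ := volume) (ContinuousLinearMap.lsmul ℝ ℝ) (mollBump n k).continuous_normed hF x
  simpa using h.integrable_swap

lemma normed_sub_eq_zero (k : ℕ) {x t : Rn n} (h : t ∉ Metric.closedBall x (1 / (k + 1))) :
    (mollBump n k).normed volume (x - t) = 0 := by
  by_contra hne
  have : x - t ∈ Function.support ((mollBump n k).normed volume) := hne
  rw [ContDiffBump.support_normed_eq] at this
  apply h
  rw [Metric.mem_closedBall, dist_comm, dist_eq_norm]
  exact (mem_ball_zero_iff.1 this).le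

lemma integral_normed_sub (k : ℕ) (x : Rn n) :
    ∫ t, (mollBump n k).normed volume (x - t) = 1 := by
  rw [integral_sub_left_eq_self (fun t => (mollBump n k).normed volume t) volume x]
  exact (mollBump n k).integral_normed (μ := volume)

lemma le_moll (k : ℕ) {F : Rn n → ℝ} (hF : LocallyIntegrable F volume) {U : Set (Rn n)}
    (hU : MeasurableSet U) {c : ℝ} (h : ∀ᵐ x ∂(volume.restrict U), c ≤ F x) {x : Rn n}
    (hx : Metric.closedBall x (1 / (k + 1)) ⊆ U) : c ≤ moll k F x := by
  rw [moll_eq]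
  calc c = ∫ t, (mollBump n k).normed volume (x - t) • c := by
        rw [integral_smul_const, integral_normed_sub, one_smul]
    _ ≤ _ := by
        refine integral_mono_ae ?_ (integrable_moll k hF x) ?_
        · exact integrable_moll k (locallyIntegrable_const c) x
        · rw [ae_restrict_iff' hU] at h
          filter_upwards [h] with t ht
          by_cases htU : t ∈ Metric.closedBall x (1 / (k + 1))
          · exact mul_le_mul_of_nonneg_left (ht (hx htU)) ((mollBump n k).nonneg_normed _)
          · simp [normed_sub_eq_zero k htU]

/-- Young's inequality for the convolution with a probability density. -/
lemma eLpNorm_moll_le (k : ℕ) {p : ℝ} (hp : 1 < p) {F : Rn n → E}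
    (hF : AEStronglyMeasurable F volume) :
    eLpNorm (moll k F) (ENNReal.ofReal p) volume ≤ eLpNorm F (ENNReal.ofReal p) volume := by
  have hp0 : 0 < p := by linarith
  obtain ⟨F', hF', hFF'⟩ := hF
  rw [moll_congr k hFF', eLpNorm_congr_ae hFF']
  set ρ := (mollBump n k).normed volume with hρ
  have hρc : Continuous ρ := (mollBump n k).continuous_normed
  set ν : Measure (Rn n) := volume.withDensity (fun t => ENNReal.ofReal (ρ t)) with hν
  -- Jensen's inequality for the probability measure with density `ρ`, then Tonelli
  have hprob : IsProbabilityMeasure ν := by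
    constructor
    rw [hν, withDensity_apply _ MeasurableSet.univ, setLIntegral_univ,
      ← ofReal_integral_eq_lintegral_ofReal (mollBump n k).integrable_normed
        (Eventually.of_forall (mollBump n k).nonneg_normed), (mollBump n k).integral_normed]
    simp
  have hpt : ∀ x, ‖moll k F' x‖ₑ ^ p ≤ ∫⁻ t, ‖F' (x - t)‖ₑ ^ p ∂ν := by
    intro x
    have hm : AEStronglyMeasurable (fun t => F' (x - t)) ν :=
      (hF'.comp_measurable (measurable_const.sub measurable_id)).aestronglyMeasurable
    have h1 : ‖moll k F' x‖ₑ ≤ ∫⁻ t, ‖F' (x - t)‖ₑ ∂ν := by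
      have hme : Measurable (fun t => ‖F' (x - t)‖ₑ) :=
        (hF'.comp_measurable (measurable_const.sub measurable_id)).enorm
      rw [moll, convolution_lsmul, hν,
        lintegral_withDensity_eq_lintegral_mul _ hρc.measurable.ennreal_ofReal hme]
      refine (enorm_integral_le_lintegral_enorm _).trans (lintegral_mono fun t => ?_)
      rw [enorm_smul, Pi.mul_apply, Real.enorm_of_nonneg ((mollBump n k).nonneg_normed t)]
    have h2 := eLpNorm'_le_eLpNorm'_of_exponent_le one_pos hp.le ν hm
    simp only [eLpNorm', ENNReal.rpow_one, div_one] at h2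
    calc ‖moll k F' x‖ₑ ^ p ≤ ((∫⁻ t, ‖F' (x - t)‖ₑ ^ p ∂ν) ^ (1 / p)) ^ p := by
          gcongr; exact h1.trans h2
      _ = _ := by rw [← ENNReal.rpow_mul]; simp [hp0.ne']
  have hmeas : Measurable (fun z : Rn n × Rn n => ‖F' (z.1 - z.2)‖ₑ ^ p) :=
    ((hF'.comp_measurable (measurable_fst.sub measurable_snd)).enorm).pow_const p
  have hmain : ∫⁻ x, ‖moll k F' x‖ₑ ^ p ≤ ∫⁻ x, ‖F' x‖ₑ ^ p := by
    calc ∫⁻ x, ‖moll k F' x‖ₑ ^ p ≤ ∫⁻ x, ∫⁻ t, ‖F' (x - t)‖ₑ ^ p ∂ν := lintegral_mono hpt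
      _ = ∫⁻ t, (∫⁻ x, ‖F' (x - t)‖ₑ ^ p) ∂ν := lintegral_lintegral_swap hmeas.aemeasurable
      _ = ∫⁻ _, (∫⁻ x, ‖F' x‖ₑ ^ p) ∂ν := by
          refine lintegral_congr fun t => ?_
          exact lintegral_sub_right_eq_self (fun x => ‖F' x‖ₑ ^ p) t
      _ = _ := by simp
  have hq0 : ENNReal.ofReal p ≠ 0 := by simpa using hp0
  rw [eLpNorm_eq_lintegral_rpow_enorm_toReal hq0 ENNReal.ofReal_ne_top,
    eLpNorm_eq_lintegral_rpow_enorm_toReal hq0 ENNReal.ofReal_ne_top, ENNReal.toReal_ofReal hp0.le]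
  gcongr

/-- Convergence almost everywhere without gain of norm implies convergence in `L^p`. -/
lemma tendsto_eLpNorm_of_ae_of_le {α M : Type*} [MeasurableSpace α] [NormedAddCommGroup M]
    {μ : Measure α} {p : ℝ}
    (hp : 1 < p) {F : α → M} {Fk : ℕ → α → M} (hF : MemLp F (ENNReal.ofReal p) μ)
    (hFk : ∀ k, AEStronglyMeasurable (Fk k) μ)
    (hle : ∀ k, eLpNorm (Fk k) (ENNReal.ofReal p) μ ≤ eLpNorm F (ENNReal.ofReal p) μ)
    (hae : ∀ᵐ x ∂μ, Tendsto (fun k => Fk k x) atTop (𝓝 (F x))) :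
    Tendsto (fun k => eLpNorm (fun x => Fk k x - F x) (ENNReal.ofReal p) μ) atTop (𝓝 0) := by
  have hp0 : 0 < p := by linarith
  have hq0 : ENNReal.ofReal p ≠ 0 := by simpa using hp0
  have hnorm : ∀ H : α → M, eLpNorm H (ENNReal.ofReal p) μ = (∫⁻ x, ‖H x‖ₑ ^ p ∂μ) ^ (1 / p) := by
    intro H
    rw [eLpNorm_eq_lintegral_rpow_enorm_toReal hq0 ENNReal.ofReal_ne_top,
      ENNReal.toReal_ofReal hp0.le]
  set A := ∫⁻ x, ‖F x‖ₑ ^ p ∂μ with hA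
  have hAtop : A ≠ ⊤ := by
    have := hF.2.ne
    rw [hnorm] at this
    intro h
    rw [← hA, h] at this
    simp [hp0] at this
  have hle' : ∀ k, ∫⁻ x, ‖Fk k x‖ₑ ^ p ∂μ ≤ A := by
    intro k
    have := hle k
    rw [hnorm, hnorm, ENNReal.rpow_le_rpow_iff (by positivity)] at this
    exact this
  set C : ℝ≥0∞ := 2 ^ (p - 1) with hC
  have hCtop : C ≠ ⊤ := ENNReal.rpow_ne_top_of_nonneg (by linarith) (by simp)
  set I : ℕ → ℝ≥0∞ := fun k => ∫⁻ x, ‖Fk k x - F x‖ₑ ^ p ∂μ with hI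
  set h : ℕ → α → ℝ≥0∞ := fun k x =>
    C * (‖Fk k x‖ₑ ^ p + ‖F x‖ₑ ^ p) - ‖Fk k x - F x‖ₑ ^ p with hh
  have hpt : ∀ k x, ‖Fk k x - F x‖ₑ ^ p ≤ C * (‖Fk k x‖ₑ ^ p + ‖F x‖ₑ ^ p) := fun k x =>
    (ENNReal.rpow_le_rpow (enorm_sub_le) hp0.le).trans
      (ENNReal.rpow_add_le_mul_rpow_add_rpow _ _ hp.le)
  have hm1 : ∀ k, AEMeasurable (fun x => ‖Fk k x - F x‖ₑ ^ p) μ := fun k =>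
    ((hFk k).sub hF.1).enorm.pow_const p
  have hm2 : ∀ k, AEMeasurable (fun x => C * (‖Fk k x‖ₑ ^ p + ‖F x‖ₑ ^ p)) μ := fun k =>
    (((hFk k).enorm.pow_const p).add (hF.1.enorm.pow_const p)).const_mul C
  -- Fatou's lemma for `h k ≥ 0`, whose limit is `2 C ‖F‖ ^ p`, forces `I k` to vanish
  have hsum : ∀ k, ∫⁻ x, h k x ∂μ + I k ≤ C * (A + A) := by
    intro k
    rw [hI, ← lintegral_add_right' _ (hm1 k)]
    calc ∫⁻ x, (h k x + ‖Fk k x - F x‖ₑ ^ p) ∂μ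
        = ∫⁻ x, C * (‖Fk k x‖ₑ ^ p + ‖F x‖ₑ ^ p) ∂μ :=
          lintegral_congr fun x => tsub_add_cancel_of_le (hpt k x)
      _ = C * (∫⁻ x, ‖Fk k x‖ₑ ^ p ∂μ + A) := by
          rw [lintegral_const_mul' _ _ hCtop, lintegral_add_right' _ (hF.1.enorm.pow_const p)]
      _ ≤ _ := by gcongr; exact hle' k
  have hfatou : C * (A + A) ≤ liminf (fun k => ∫⁻ x, h k x ∂μ) atTop := by
    calc C * (A + A) = ∫⁻ x, liminf (fun k => h k x) atTop ∂μ := by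
          rw [hA, ← lintegral_add_right' _ (hF.1.enorm.pow_const p),
            ← lintegral_const_mul' _ _ hCtop]
          refine lintegral_congr_ae ?_
          filter_upwards [hae] with x hx
          refine (Tendsto.liminf_eq ?_).symm
          have t1 : Tendsto (fun k => ‖Fk k x‖ₑ ^ p) atTop (𝓝 (‖F x‖ₑ ^ p)) :=
            (ENNReal.continuous_rpow_const.tendsto _).comp hx.enorm
          have t2 : Tendsto (fun k => ‖Fk k x - F x‖ₑ ^ p) atTop (𝓝 0) := by
            have : Tendsto (fun k => Fk k x - F x) atTop (𝓝 0) := by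
              simpa using hx.sub_const (F x)
            have := (ENNReal.continuous_rpow_const (y := p)).tendsto _ |>.comp this.enorm
            simpa [hp0, Function.comp_def] using this
          have t3 : Tendsto (fun k => C * (‖Fk k x‖ₑ ^ p + ‖F x‖ₑ ^ p)) atTop
              (𝓝 (C * (‖F x‖ₑ ^ p + ‖F x‖ₑ ^ p))) :=
            ENNReal.Tendsto.const_mul (t1.add tendsto_const_nhds) (Or.inr hCtop)
          have := ENNReal.Tendsto.sub t3 t2 (Or.inr ENNReal.zero_ne_top)
          rwa [tsub_zero] at this
      _ ≤ _ := lintegral_liminf_le' fun k => (hm2 k).sub (hm1 k)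
  have hBtop : C * (A + A) ≠ ⊤ := ENNReal.mul_ne_top hCtop (ENNReal.add_ne_top.2 ⟨hAtop, hAtop⟩)
  have hIlim : Tendsto I atTop (𝓝 0) := by
    rw [ENNReal.tendsto_nhds_zero]
    intro ε hε
    rcases eq_or_ne (C * (A + A)) 0 with h0 | h0
    · refine Eventually.of_forall fun k => ?_
      have := hsum k
      rw [h0] at this
      exact (le_add_self.trans this).trans zero_le
    · have hlt : C * (A + A) - ε < liminf (fun k => ∫⁻ x, h k x ∂μ) atTop :=
        (ENNReal.sub_lt_self hBtop h0 hε.ne').trans_le hfatou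
      filter_upwards [eventually_lt_of_lt_liminf hlt] with k hk
      have h1 := hsum k
      have hhtop : ∫⁻ x, h k x ∂μ ≠ ⊤ := ne_top_of_le_ne_top hBtop (le_self_add.trans h1)
      have h2 : C * (A + A) ≤ ∫⁻ x, h k x ∂μ + ε := tsub_le_iff_right.1 hk.le
      exact (ENNReal.add_le_add_iff_left hhtop).1 (h1.trans h2)
  have : Tendsto (fun k => I k ^ (1 / p)) atTop (𝓝 (0 ^ (1 / p))) :=
    (ENNReal.continuous_rpow_const.tendsto _).comp hIlim
  rw [ENNReal.zero_rpow_of_pos (by positivity)] at this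
  exact this.congr fun k => (hnorm _).symm

lemma tendsto_eLpNorm_moll [CompleteSpace E] {p : ℝ} (hp : 1 < p) {F : Rn n → E}
    (hF : MemLp F (ENNReal.ofReal p) volume) :
    Tendsto (fun k => eLpNorm (fun x => moll k F x - F x) (ENNReal.ofReal p) volume)
      atTop (𝓝 0) := by
  have hloc : LocallyIntegrable F volume := hF.locallyIntegrable (one_le_ofReal hp)
  exact tendsto_eLpNorm_of_ae_of_le hp hF
    (fun k => (contDiff_moll k hloc).continuous.aestronglyMeasurable)
    (fun k => eLpNorm_moll_le k hp hF.1) (ae_tendsto_moll hloc)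

/-- Mollification commutes with weak differentiation away from the boundary. -/
lemma gradient_moll (k : ℕ) {Ω : Set (Rn n)} (hΩ : IsOpen Ω) {v : Rn n → ℝ}
    {g : Rn n → Rn n}
    (hv : HasWeakGradient Ω v g) (hV : LocallyIntegrable (Ω.indicator v) volume)
    {x : Rn n}
    (hx : Metric.closedBall x (1 / (k + 1)) ⊆ Ω) :
    gradient (moll k (Ω.indicator v)) x = moll k (Ω.indicator g) x := by
  set ρ := (mollBump n k).normed volume with hρ
  have hρs : ContDiff ℝ ∞ ρ := (mollBump n k).contDiff_normed
  have hρc : HasCompactSupport ρ := (mollBump n k).hasCompactSupport_normed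
  have hρ1 : ContDiff ℝ 1 ρ := (mollBump n k).contDiff_normed (n := 1)
  -- the reflected kernel is a test function on `Ω`, so the weak gradient can be tested with it
  have hφ : IsTestFun Ω (fun t => ρ (x - t)) := by
    have hz : ∀ t, t ∉ Metric.closedBall x (1 / (k + 1)) → ρ (x - t) = 0 :=
      fun t ht => normed_sub_eq_zero k ht
    have hs : Function.support (fun t => ρ (x - t)) ⊆ Metric.closedBall x (1 / (k + 1)) := by
      intro t ht
      by_contra h
      exact ht (hz t h)
    refine ⟨hρs.comp (contDiff_const.sub contDiff_id),
      HasCompactSupport.of_support_subset_isCompact (isCompact_closedBall _ _) hs,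
      (closure_minimal hs Metric.isClosed_closedBall).trans hx⟩
  have hgrad : ∀ t, gradient (fun t => ρ (x - t)) t = - gradient ρ (x - t) := by
    intro t
    have h1 : HasFDerivAt (fun t => ρ (x - t)) (-(fderiv ℝ ρ (x - t))) t := by
      have := ((hρs.differentiable (by simp) (x - t)).hasFDerivAt).comp t
        ((hasFDerivAt_id t).const_sub x)
      simpa [Function.comp_def] using this
    simp only [gradient]
    rw [h1.fderiv, map_neg]
  have hparts := hv.parts _ hφ
  have hD := hρc.hasFDerivAt_convolution_left (μ := volume) (ContinuousLinearMap.lsmul ℝ ℝ) hρ1 hV x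
  have hint := (((hρc.fderiv ℝ).convolutionExists_left (μ := volume)
    ((ContinuousLinearMap.lsmul ℝ ℝ (E := ℝ)).precompL (Rn n)) (hρ1.continuous_fderiv one_ne_zero) hV
      x)).integrable_swap
  refine ext_inner_right ℝ fun y => ?_
  have lhs : inner ℝ (gradient (moll k (Ω.indicator v)) x) y =
      ∫ t, fderiv ℝ ρ (x - t) y * Ω.indicator v t := by
    rw [inner_gradient_left, moll, hD.fderiv, convolution_eq_swap, ContinuousLinearMap.integral_apply hint]
    rfl
  have hinner : ∀ t, inner ℝ (v t • gradient (fun t => ρ (x - t)) t) y =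
      -(fderiv ℝ ρ (x - t) y * v t) := fun t => by
    rw [hgrad, inner_smul_left, inner_neg_left, inner_gradient_left]
    simp [mul_comm]
  have e1 : ∫ t, fderiv ℝ ρ (x - t) y * Ω.indicator v t =
      - inner ℝ (∫ t in Ω, v t • gradient (fun t => ρ (x - t)) t) y := by
    rw [real_inner_comm, ← integral_inner (HasWeakGradient.integrable_left hΩ hv.locInt hφ),
      ← integral_neg, ← integral_indicator hΩ.measurableSet]
    refine integral_congr_ae (Eventually.of_forall fun t => ?_)
    by_cases ht : t ∈ Ω
    · simp only [indicator_of_mem ht]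
      rw [real_inner_comm, hinner, neg_neg]
    · simp [ht]
  have e2 : moll k (Ω.indicator g) x = ∫ t in Ω, ρ (x - t) • g t := by
    rw [moll_eq, ← integral_indicator hΩ.measurableSet]
    refine integral_congr_ae (Eventually.of_forall fun t => ?_)
    by_cases ht : t ∈ Ω <;> simp [ht, hρ]
  rw [lhs, e1, e2, hparts, inner_neg_left, neg_neg]

lemma eventually_forall_closedBall_subset {K Ω : Set (Rn n)} (hK : IsCompact K) (hΩ : IsOpen Ω)
    (h : K ⊆ Ω) : ∀ᶠ k : ℕ in atTop, ∀ x ∈ K, Metric.closedBall x (1 / ((k : ℝ) + 1)) ⊆ Ω := by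
  obtain ⟨δ, hδ, hsub⟩ := hK.exists_cthickening_subset_open hΩ h
  have ht : Tendsto (fun k : ℕ => 1 / ((k : ℝ) + 1)) atTop (𝓝 0) :=
    tendsto_one_div_add_atTop_nhds_zero_nat
  filter_upwards [ht.eventually_lt_const hδ] with k hk x hx
  exact ((Metric.closedBall_subset_closedBall hk.le).trans
    (Metric.closedBall_subset_cthickening hx δ)).trans hsub

end Mollification

/-! ### Local approximation of Sobolev functions by test functions -/

section LocalApproximation

variable {n : ℕ} {Ω : Set (Rn n)} {p : ℝ} {v : Rn n → ℝ} {g : Rn n → Rn n}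

namespace IsSobolevPair

lemma memLp_indicator (hΩ : IsOpen Ω) (hv : IsSobolevPair Ω p v g) :
    MemLp (Ω.indicator v) (ENNReal.ofReal p) volume :=
  (memLp_indicator_iff_restrict hΩ.measurableSet).2 hv.memLp

lemma memLp_indicator_grad (hΩ : IsOpen Ω) (hv : IsSobolevPair Ω p v g) :
    MemLp (Ω.indicator g) (ENNReal.ofReal p) volume :=
  (memLp_indicator_iff_restrict hΩ.measurableSet).2 hv.memLp_grad

lemma locallyIntegrable_indicator (hΩ : IsOpen Ω) (hp : 1 < p) (hv : IsSobolevPair Ω p v g) :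
    LocallyIntegrable (Ω.indicator v) volume :=
  (hv.memLp_indicator hΩ).locallyIntegrable (one_le_ofReal hp)

lemma contDiff_moll (hΩ : IsOpen Ω) (hp : 1 < p) (hv : IsSobolevPair Ω p v g) (k : ℕ) :
    ContDiff ℝ ∞ (moll k (Ω.indicator v)) :=
  _root_.contDiff_moll k (hv.locallyIntegrable_indicator hΩ hp)

lemma tendsto_moll (hΩ : IsOpen Ω) (hp : 1 < p) (hv : IsSobolevPair Ω p v g) {K : Set (Rn n)}
    (hK : IsCompact K) (hKΩ : K ⊆ Ω) :
    Tendsto (fun k => eLpNorm (fun x => moll k (Ω.indicator v) x - v x) (ENNReal.ofReal p)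
      (volume.restrict K)) atTop (𝓝 0) := by
  refine tendsto_of_tendsto_of_tendsto_of_le_of_le tendsto_const_nhds
    (tendsto_eLpNorm_moll hp (hv.memLp_indicator hΩ)) (fun _ => zero_le) (fun k => ?_)
  refine le_trans (le_of_eq (eLpNorm_congr_ae ?_)) (eLpNorm_mono_measure _ Measure.restrict_le_self)
  filter_upwards [ae_restrict_mem hK.measurableSet] with x hx
  rw [indicator_of_mem (hKΩ hx)]

lemma tendsto_gradient_moll (hΩ : IsOpen Ω) (hp : 1 < p) (hv : IsSobolevPair Ω p v g)
    {K : Set (Rn n)} (hK : IsCompact K) (hKΩ : K ⊆ Ω) :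
    Tendsto (fun k => eLpNorm (fun x => gradient (moll k (Ω.indicator v)) x - g x)
      (ENNReal.ofReal p) (volume.restrict K)) atTop (𝓝 0) := by
  refine tendsto_of_tendsto_of_tendsto_of_le_of_le' tendsto_const_nhds
    (tendsto_eLpNorm_moll hp (hv.memLp_indicator_grad hΩ)) (Eventually.of_forall fun _ => zero_le) ?_
  filter_upwards [eventually_forall_closedBall_subset hK hΩ hKΩ] with k hk
  refine le_trans (le_of_eq (eLpNorm_congr_ae ?_)) (eLpNorm_mono_measure _ Measure.restrict_le_self)
  filter_upwards [ae_restrict_mem hK.measurableSet] with x hx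
  rw [gradient_moll k hΩ hv.weak (hv.locallyIntegrable_indicator hΩ hp) (hk x hx),
    indicator_of_mem (hKΩ hx)]

/-- Cutting off a Sobolev function and mollifying approximates by test functions. -/
lemma sobolevTendsto_mul (hΩ : IsOpen Ω) (hp : 1 < p) (hv : IsSobolevPair Ω p v g)
    {η : Rn n → ℝ} (hη : IsTestFun Ω η) :
    SobolevTendsto Ω p (fun k x => η x * moll k (Ω.indicator v) x) (fun x => η x * v x)
      (fun x => v x • gradient η x + η x • g x) := by
  have hm : volume.restrict (tsupport η) ≤ volume.restrict Ω :=
    Measure.restrict_mono hη.subset le_rfl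
  exact SobolevTendsto.mul_isTestFun hη hp (hv.contDiff_moll hΩ hp) (hv.memLp.mono_measure hm)
    (hv.memLp_grad.mono_measure hm) (hv.tendsto_moll hΩ hp hη.compact hη.subset)
    (hv.tendsto_gradient_moll hΩ hp hη.compact hη.subset)

end IsSobolevPair

end LocalApproximation

/-! ### Chain rule -/

section ChainRule

variable {n : ℕ} {Ω : Set (Rn n)} {p : ℝ} {v w : Rn n → ℝ} {g : Rn n → Rn n}
  {φ : ℕ → Rn n → ℝ} {h : ℝ → ℝ} {C : ℝ}

lemma abs_le_of_deriv_le (hh : ContDiff ℝ ∞ h) (h' : ∀ t, |deriv h t| ≤ C)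
    (s t : ℝ) : |h s - h t| ≤ C * |s - t| := by
  have := (convex_univ (𝕜 := ℝ) (E := ℝ)).norm_image_sub_le_of_norm_deriv_le (f := h) (C := C)
    (fun x _ => hh.differentiable (by simp) x) (fun x _ => h' x) (mem_univ t) (mem_univ s)
  simpa using this

lemma SobolevTendsto.exists_subseq_ae (hp : 1 < p) (hv : SobolevTendsto Ω p φ v g) :
    ∃ ns : ℕ → ℕ, StrictMono ns ∧
      ∀ᵐ x ∂(volume.restrict Ω), Tendsto (fun k => φ (ns k) x) atTop (𝓝 (v x)) := by
  have h0 : ENNReal.ofReal p ≠ 0 := (zero_lt_one.trans_le (one_le_ofReal hp)).ne'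
  exact (tendstoInMeasure_of_tendsto_eLpNorm h0
    (fun k => (hv.test k).continuous.aestronglyMeasurable) hv.memLp.1
    hv.tendsto).exists_seq_tendsto_ae

lemma SobolevTendsto.subseq (hv : SobolevTendsto Ω p φ v g) {ns : ℕ → ℕ} (hns : StrictMono ns) :
    SobolevTendsto Ω p (fun k => φ (ns k)) v g :=
  ⟨fun _ => hv.test _, hv.memLp, hv.memLp_grad, hv.tendsto.comp hns.tendsto_atTop,
    hv.tendsto_grad.comp hns.tendsto_atTop⟩

lemma IsTestFun.gradient_comp (hh : ContDiff ℝ ∞ h) {χ : Rn n → ℝ} (hχ : IsTestFun Ω χ)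
    (x : Rn n) : gradient (fun y => h (χ y)) x = deriv h (χ x) • gradient χ x :=
  gradient_comp' (hh.differentiable (by simp) _) (hχ.differentiable x)

lemma SobolevTendsto.hasWeakGradient_comp (hΩ : IsOpen Ω) (hp : 1 < p)
    (hv : SobolevTendsto Ω p φ v g) (hh : ContDiff ℝ ∞ h) (h0 : h 0 = 0)
    (h' : ∀ t, |deriv h t| ≤ C) :
    HasWeakGradient Ω (fun x => h (v x)) (fun x => deriv h (v x) • g x) := by
  have hq := one_le_ofReal hp
  obtain ⟨ns, hns, hae⟩ := hv.exists_subseq_ae hp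
  have hv' := hv.subseq hns
  set χ : ℕ → Rn n → ℝ := fun k => φ (ns k) with hχ
  have hC : 0 ≤ C := (abs_nonneg _).trans (h' 0)
  have hdc : Continuous (deriv h) := hh.continuous_deriv (by simp)
  have hlip := abs_le_of_deriv_le hh h'
  have hm1 : MemLp (fun x => h (v x)) (ENNReal.ofReal p) (volume.restrict Ω) := by
    refine hv.memLp.of_le_mul (c := C) (hh.continuous.comp_aestronglyMeasurable hv.memLp.1)
      (Eventually.of_forall fun x => ?_)
    simpa [h0] using hlip (v x) 0
  have hm2 : MemLp (fun x => deriv h (v x) • g x) (ENNReal.ofReal p) (volume.restrict Ω) := by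
    refine hv.memLp_grad.of_le_mul (c := C)
      ((hdc.comp_aestronglyMeasurable hv.memLp.1).smul hv.memLp_grad.1)
      (Eventually.of_forall fun x => ?_)
    rw [norm_smul]
    gcongr
    exact h' _
  have hres : ∀ {K : Set (Rn n)}, K ⊆ Ω → volume.restrict K ≤ volume.restrict Ω := fun hK =>
    Measure.restrict_mono hK le_rfl
  refine HasWeakGradient.of_tendsto hΩ (vk := fun k x => h (χ k x))
    (gk := fun k x => gradient (fun y => h (χ k y)) x)
    (fun k => HasWeakGradient.of_isTestFun (((hv'.test k).comp hh h0).mono (subset_univ _)))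
    (locallyIntegrableOn_of_memLp hq hm1) (locallyIntegrableOn_of_memLp hq hm2) ?_ ?_
  · intro K hK hKΩ
    refine tendsto_lintegral_of_eLpNorm hq hK (hm1.1.mono_measure (hres hKΩ))
      (fun k => (((hv'.test k).comp hh h0).continuous.aestronglyMeasurable)) ?_
    have l0 := ENNReal.Tendsto.const_mul (a := ENNReal.ofReal C) hv'.tendsto
      (Or.inr ENNReal.ofReal_ne_top)
    rw [mul_zero] at l0
    refine tendsto_of_tendsto_of_tendsto_of_le_of_le tendsto_const_nhds l0 (fun _ => zero_le)
      (fun k => (eLpNorm_mono_measure _ (hres hKΩ)).trans ?_)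
    exact eLpNorm_le_mul_eLpNorm_of_ae_le_mul (Eventually.of_forall fun x => hlip _ _) _
  -- `h'(χ) Dχ - h'(v) g = h'(χ) (Dχ - g) + (h'(χ) - h'(v)) g`: the first term tends to zero because
  -- `h'` is bounded, the second by dominated convergence
  · intro K hK hKΩ
    have hgK : Integrable g (volume.restrict K) :=
      (locallyIntegrableOn_of_memLp hq hv.memLp_grad).integrableOn_compact_subset hKΩ hK
    have hvK := hv.memLp.1.mono_measure (hres hKΩ)
    have l1 : Tendsto (fun k => ∫⁻ x in K, ‖gradient (χ k) x - g x‖ₑ) atTop (𝓝 0) := by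
      refine tendsto_lintegral_of_eLpNorm hq hK hgK.1
        (fun k => (hv'.test k).continuous_grad.aestronglyMeasurable) ?_
      exact tendsto_of_tendsto_of_tendsto_of_le_of_le tendsto_const_nhds hv'.tendsto_grad
        (fun _ => zero_le) (fun k => eLpNorm_mono_measure _ (hres hKΩ))
    have l2 : Tendsto (fun k => ∫⁻ x in K, ‖deriv h (χ k x) - deriv h (v x)‖ₑ * ‖g x‖ₑ) atTop
        (𝓝 (∫⁻ x in K, 0)) := by
      refine tendsto_lintegral_of_dominated_convergence' (fun x => ENNReal.ofReal (2 * C) * ‖g x‖ₑ)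
        (fun k => ?_) (fun k => Eventually.of_forall fun x => ?_) ?_ ?_
      · exact ((hdc.comp (hv'.test k).continuous).aestronglyMeasurable.sub
          (hdc.comp_aestronglyMeasurable hvK)).enorm.mul hgK.1.enorm
      · refine mul_le_mul' ?_ le_rfl
        rw [← ofReal_norm]
        apply ENNReal.ofReal_le_ofReal
        refine (norm_sub_le _ _).trans ?_
        have a := h' (χ k x)
        have b := h' (v x)
        simp only [Real.norm_eq_abs]
        linarith
      · rw [lintegral_const_mul' _ _ ENNReal.ofReal_ne_top]
        exact ENNReal.mul_ne_top ENNReal.ofReal_ne_top hgK.2.ne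
      · filter_upwards [ae_mono (hres hKΩ) hae] with x hx
        have t1 : Tendsto (fun k => ‖deriv h (χ k x) - deriv h (v x)‖ₑ) atTop (𝓝 0) := by
          have : Tendsto (fun k => deriv h (χ k x) - deriv h (v x)) atTop (𝓝 0) := by
            simpa using ((hdc.tendsto _).comp hx).sub_const (deriv h (v x))
          simpa using this.enorm
        have := ENNReal.Tendsto.mul_const (b := ‖g x‖ₑ) t1 (Or.inr enorm_ne_top)
        rwa [zero_mul] at this
    rw [lintegral_zero] at l2
    have l3 := (ENNReal.Tendsto.const_mul (a := ENNReal.ofReal C) l1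
      (Or.inr ENNReal.ofReal_ne_top)).add l2
    rw [mul_zero, add_zero] at l3
    refine tendsto_of_tendsto_of_tendsto_of_le_of_le tendsto_const_nhds l3 (fun _ => zero_le)
      (fun k => ?_)
    simp only
    rw [← lintegral_const_mul' _ _ ENNReal.ofReal_ne_top, ← lintegral_add_left']
    · refine lintegral_mono fun x => ?_
      rw [(hv'.test k).gradient_comp hh, ← enorm_smul]
      have e : deriv h (χ k x) • gradient (χ k) x - deriv h (v x) • g x =
        deriv h (χ k x) • (gradient (χ k) x - g x) + (deriv h (χ k x) - deriv h (v x)) • g x := by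
        rw [smul_sub, sub_smul]; abel
      rw [e]
      refine (enorm_add_le _ _).trans ?_
      gcongr
      rw [enorm_smul]
      gcongr
      rw [← ofReal_norm]
      exact ENNReal.ofReal_le_ofReal (h' _)
    · exact (((hv'.test k).continuous_grad.aestronglyMeasurable.sub hgK.1).enorm).const_mul _

/-- The chain rule in `W^{1,p}`. -/
lemma IsSobolevPair.comp (hΩ : IsOpen Ω) (hp : 1 < p)
    (hv : IsSobolevPair Ω p v g) (hh : ContDiff ℝ ∞ h) (h0 : h 0 = 0)
    (h' : ∀ t, |deriv h t| ≤ C) :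
    IsSobolevPair Ω p (fun x => h (v x)) (fun x => deriv h (v x) • g x) := by
  have hq := one_le_ofReal hp
  have hC : 0 ≤ C := (abs_nonneg _).trans (h' 0)
  have hdc : Continuous (deriv h) := hh.continuous_deriv (by simp)
  have hm1 : MemLp (fun x => h (v x)) (ENNReal.ofReal p) (volume.restrict Ω) := by
    refine hv.memLp.of_le_mul (c := C) (hh.continuous.comp_aestronglyMeasurable hv.memLp.1)
      (Eventually.of_forall fun x => ?_)
    simpa [h0] using abs_le_of_deriv_le hh h' (v x) 0
  have hm2 : MemLp (fun x => deriv h (v x) • g x) (ENNReal.ofReal p) (volume.restrict Ω) := by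
    refine hv.memLp_grad.of_le_mul (c := C)
      ((hdc.comp_aestronglyMeasurable hv.memLp.1).smul hv.memLp_grad.1)
      (Eventually.of_forall fun x => ?_)
    rw [norm_smul]
    gcongr
    exact h' _
  refine ⟨⟨locallyIntegrableOn_of_memLp hq hm1, locallyIntegrableOn_of_memLp hq hm2,
    fun φ hφ => ?_⟩, hm1, hm2⟩
  -- the identity only sees a neighbourhood of the support of `φ`, where a cutoff is harmless
  obtain ⟨η, hη, -, O, hO, hKO, hOΩ, hη1⟩ := exists_isTestFun_cutoff hΩ hφ.compact hφ.subset
  have key := ((hv.sobolevTendsto_mul hΩ hp hη).hasWeakGradient_comp hΩ hp hh h0 h').parts φ hφ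
  have hg0 : ∀ x ∈ O, gradient η x = 0 := fun x hx => by
    have : η =ᶠ[𝓝 x] fun _ => 1 := by
      filter_upwards [hO.mem_nhds hx] with y hy using hη1 y hy
    rw [this.gradient_eq, gradient_fun_const]
  convert key using 2
  · ext1 x
    by_cases hx : x ∈ tsupport φ
    · rw [hη1 x (hKO hx), one_mul]
    · rw [image_eq_zero_of_notMem_tsupport (f := fun x => gradient φ x)
        (fun h => hx (tsupport_gradient_subset φ h)), smul_zero, smul_zero]
  · refine integral_congr_ae (Eventually.of_forall fun x => ?_)
    by_cases hx : x ∈ tsupport φ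
    · simp only [hη1 x (hKO hx), hg0 x (hKO hx), one_mul, smul_zero, zero_add, one_smul]
    · simp [image_eq_zero_of_notMem_tsupport hx]

end ChainRule

/-! ### Smooth approximations of the modulus -/

section SmoothModulus

/-- A smooth approximation of the modulus from below. -/
noncomputable def smoothAbs (ε t : ℝ) : ℝ := √(t ^ 2 + ε ^ 2) - ε

lemma contDiff_smoothAbs {ε : ℝ} (hε : 0 < ε) : ContDiff ℝ ∞ (smoothAbs ε) := by
  refine ContDiff.sub (ContDiff.sqrt ((contDiff_id.pow 2).add contDiff_const) fun t => ?_)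
    contDiff_const
  have := sq_nonneg t
  positivity

lemma smoothAbs_zero {ε : ℝ} (hε : 0 < ε) : smoothAbs ε 0 = 0 := by
  simp [smoothAbs, Real.sqrt_sq hε.le]

lemma smoothAbs_nonneg (ε t : ℝ) : 0 ≤ smoothAbs ε t := by
  have : ε ≤ √(t ^ 2 + ε ^ 2) := Real.le_sqrt_of_sq_le (by nlinarith [sq_nonneg t])
  simpa [smoothAbs] using this

lemma abs_deriv_smoothAbs_le {ε : ℝ} (hε : 0 < ε) (t : ℝ) : |deriv (smoothAbs ε) t| ≤ 1 := by
  have hpos : 0 < t ^ 2 + ε ^ 2 := by have := sq_nonneg t; positivity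
  have h : HasDerivAt (smoothAbs ε) ((2 * t) / (2 * √(t ^ 2 + ε ^ 2))) t := by
    have h1 : HasDerivAt (fun t : ℝ => t ^ 2 + ε ^ 2) (2 * t) t := by
      simpa using (hasDerivAt_pow 2 t).add_const (ε ^ 2)
    exact (h1.sqrt hpos.ne').sub_const ε
  rw [h.deriv, mul_div_mul_left _ _ two_ne_zero, abs_div, abs_of_pos (Real.sqrt_pos.2 hpos),
    div_le_one (Real.sqrt_pos.2 hpos)]
  exact Real.le_sqrt_of_sq_le (by rw [sq_abs]; nlinarith [sq_nonneg ε])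

/-- A smooth function vanishing at `0`, non-negative, `3`-Lipschitz and at least `1` outside
`(-1, 1)`: it turns Sobolev functions into admissible functions for the capacity. -/
noncomputable def capFun (t : ℝ) : ℝ := 3 * smoothAbs 1 t

lemma contDiff_capFun : ContDiff ℝ ∞ capFun := contDiff_const.mul (contDiff_smoothAbs one_pos)

lemma capFun_zero : capFun 0 = 0 := by simp [capFun, smoothAbs_zero]

lemma capFun_nonneg (t : ℝ) : 0 ≤ capFun t :=
  mul_nonneg (by norm_num) (smoothAbs_nonneg 1 t)

lemma one_le_capFun {t : ℝ} (ht : 1 ≤ |t|) : 1 ≤ capFun t := by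
  have h1 : 1 ≤ |t| ^ 2 := one_le_pow₀ ht
  rw [sq_abs] at h1
  have h2 : (4 / 3 : ℝ) ≤ √(t ^ 2 + 1 ^ 2) := Real.le_sqrt_of_sq_le (by norm_num; linarith)
  have h3 : capFun t = 3 * (√(t ^ 2 + 1 ^ 2) - 1) := rfl
  generalize √(t ^ 2 + 1 ^ 2) = s at h2 h3
  rw [h3]
  linarith

lemma abs_deriv_capFun_le (t : ℝ) : |deriv capFun t| ≤ 3 := by
  have h : HasDerivAt capFun (3 * deriv (smoothAbs 1) t) t :=
    ((contDiff_smoothAbs one_pos).differentiable (by simp) t).hasDerivAt.const_mul 3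
  rw [h.deriv, abs_mul]
  have := abs_deriv_smoothAbs_le one_pos t
  rw [abs_of_pos (by norm_num : (0 : ℝ) < 3)]
  linarith

lemma capFun_le (t : ℝ) : |capFun t| ≤ 3 * |t| := by
  simpa [capFun_zero] using abs_le_of_deriv_le contDiff_capFun abs_deriv_capFun_le t 0

end SmoothModulus

/-! ### Completeness of `L^q` -/

section Completeness

variable {α E : Type*} [MeasurableSpace α] {μ : Measure α} [NormedAddCommGroup E] [CompleteSpace E]

lemma exists_tendsto_eLpNorm_of_cauchy {q : ℝ≥0∞} (hq : 1 ≤ q) {f : ℕ → α → E}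
    (hf : ∀ k, MemLp (f k) q μ)
    (hc : ∀ ε : ℝ≥0∞, 0 < ε → ∃ N, ∀ m ≥ N, ∀ k ≥ N, eLpNorm (fun x => f m x - f k x) q μ < ε) :
    ∃ g, MemLp g q μ ∧ Tendsto (fun k => eLpNorm (fun x => f k x - g x) q μ) atTop (𝓝 0) := by
  have : Fact (1 ≤ q) := ⟨hq⟩
  have hcs : CauchySeq (fun k => (hf k).toLp (f k)) := by
    rw [EMetric.cauchySeq_iff]
    intro ε hε
    obtain ⟨N, hN⟩ := hc ε hε
    refine ⟨N, fun m hm k hk => ?_⟩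
    rw [Lp.edist_toLp_toLp]
    exact hN m hm k hk
  obtain ⟨g, hg⟩ := cauchySeq_tendsto_of_complete hcs
  refine ⟨g, Lp.memLp g, ?_⟩
  rw [Lp.tendsto_Lp_iff_tendsto_eLpNorm'] at hg
  refine hg.congr fun k => eLpNorm_congr_ae ?_
  filter_upwards [(hf k).coeFn_toLp] with x hx
  simp [hx]

lemma exists_tendsto_eLpNorm_of_le {q : ℝ≥0∞} (hq : 1 ≤ q) {f : ℕ → α → E}
    (hf : ∀ k, MemLp (f k) q μ) {a : ℕ → ℝ≥0∞} (ha : Tendsto a atTop (𝓝 0))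
    (hc : ∀ m k, eLpNorm (fun x => f m x - f k x) q μ ≤ a m + a k) :
    ∃ g, MemLp g q μ ∧ Tendsto (fun k => eLpNorm (fun x => f k x - g x) q μ) atTop (𝓝 0) := by
  refine exists_tendsto_eLpNorm_of_cauchy hq hf fun ε hε => ?_
  have h2 : 0 < ε / 2 := ENNReal.div_pos hε.ne' (by simp)
  obtain ⟨N, hN⟩ := eventually_atTop.1 (ha.eventually_lt_const h2)
  refine ⟨N, fun m hm k hk => (hc m k).trans_lt ?_⟩
  calc a m + a k < ε / 2 + ε / 2 := ENNReal.add_lt_add (hN m hm) (hN k hk)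
    _ = ε := ENNReal.add_halves ε

lemma ENNReal.tendsto_zero_of_le_add {a b : ℕ → ℝ≥0∞} {c : ℝ≥0∞ → ℝ≥0∞}
    (hb : Tendsto b atTop (𝓝 0)) (hc : Tendsto c (𝓝 0) (𝓝 0))
    (h : ∀ t, 0 < t → ∀ k, a k ≤ b k + c t) : Tendsto a atTop (𝓝 0) := by
  rw [ENNReal.tendsto_nhds_zero]
  intro ε hε
  have h2 : 0 < ε / 2 := ENNReal.div_pos hε.ne' (by simp)
  have hc' : ∀ᶠ t in 𝓝[>] (0 : ℝ≥0∞), c t < ε / 2 :=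
    (hc.mono_left nhdsWithin_le_nhds).eventually_lt_const h2
  obtain ⟨t, ht, htpos⟩ := (hc'.and self_mem_nhdsWithin).exists
  filter_upwards [hb.eventually_lt_const h2] with k hk
  calc a k ≤ b k + c t := h t htpos k
    _ ≤ ε / 2 + ε / 2 := add_le_add hk.le ht.le
    _ = ε := ENNReal.add_halves ε

end Completeness

/-! ### Estimates for the measure `-div σ` -/

section Pairing

variable {n : ℕ} {Ω : Set (Rn n)} {p : ℝ} {σ : Rn n → Rn n} {μ : Measure (Rn n)}

/-- Hölder's inequality for the pairing of a field in `L^{p'}` with a field in `L^p`. -/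
lemma lintegral_inner_le (hp : 1 < p) {σ g : Rn n → Rn n} {ν : Measure (Rn n)}
    (hσ : AEStronglyMeasurable σ ν) (hg : AEStronglyMeasurable g ν) :
    ∫⁻ x, ‖(inner ℝ (σ x) (g x) : ℝ)‖ₑ ∂ν ≤
      eLpNorm σ (ENNReal.ofReal p.conjExponent) ν * eLpNorm g (ENNReal.ofReal p) ν := by
  have := (Real.HolderConjugate.conjExponent hp).symm.ennrealOfReal
  have := eLpNorm_le_eLpNorm_mul_eLpNorm'_of_norm (r := 1) (p := ENNReal.ofReal p.conjExponent)
    (q := ENNReal.ofReal p) hσ hg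
    (fun a b => (inner ℝ a b : ℝ)) 1 (Eventually.of_forall fun x => by
      simpa using abs_real_inner_le_norm (σ x) (g x))
  simpa [eLpNorm_one_eq_lintegral_enorm] using this

lemma integrable_inner_of_memLp (hp : 1 < p) {σ g : Rn n → Rn n} {ν : Measure (Rn n)}
    (hσ : MemLp σ (ENNReal.ofReal p.conjExponent) ν) (hg : MemLp g (ENNReal.ofReal p) ν) :
    Integrable (fun x => (inner ℝ (σ x) (g x) : ℝ)) ν :=
  ⟨hσ.1.inner hg.1, (lintegral_inner_le hp hσ.1 hg.1).trans_lt (ENNReal.mul_lt_top hσ.2 hg.2)⟩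

lemma tendsto_integral_inner (hp : 1 < p) {σ g : Rn n → Rn n} {gk : ℕ → Rn n → Rn n}
    {ν : Measure (Rn n)}
    (hσ : MemLp σ (ENNReal.ofReal p.conjExponent) ν) (hg : MemLp g (ENNReal.ofReal p) ν)
    (hgk : ∀ k, MemLp (gk k) (ENNReal.ofReal p) ν)
    (h : Tendsto (fun k => eLpNorm (fun x => gk k x - g x) (ENNReal.ofReal p) ν) atTop (𝓝 0)) :
    Tendsto (fun k => ∫ x, (inner ℝ (σ x) (gk k x) : ℝ) ∂ν) atTop
      (𝓝 (∫ x, (inner ℝ (σ x) (g x) : ℝ) ∂ν)) := by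
  refine tendsto_integral_of_L1 _ (integrable_inner_of_memLp hp hσ hg).1
    (Eventually.of_forall fun k => integrable_inner_of_memLp hp hσ (hgk k)) ?_
  have h0 := ENNReal.Tendsto.const_mul (a := eLpNorm σ (ENNReal.ofReal p.conjExponent) ν) h
    (Or.inr hσ.2.ne)
  rw [mul_zero] at h0
  refine tendsto_of_tendsto_of_tendsto_of_le_of_le tendsto_const_nhds h0 (fun _ => zero_le)
    (fun k => ?_)
  simp only [← inner_sub_right]
  exact lintegral_inner_le hp hσ.1 ((hgk k).sub hg).1

namespace IsNegDivMeasure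

lemma integrable (hμ : IsNegDivMeasure Ω σ μ) {φ : Rn n → ℝ} (hφ : IsTestFun Ω φ) :
    Integrable φ μ := by
  have h : IntegrableOn φ (tsupport φ) μ :=
    hφ.continuous.continuousOn.integrableOn_of_subset_isCompact hφ.compact
      (isClosed_tsupport φ).measurableSet Subset.rfl (hμ.finite _ hφ.compact hφ.subset).ne
  rw [← integrableOn_univ]
  exact h.of_forall_sdiff_eq_zero MeasurableSet.univ
    fun x hx => image_eq_zero_of_notMem_tsupport hx.2

/-- The basic estimate `∫ |φ| dμ ≤ ‖σ‖_{p'} ‖∇φ‖_p`, obtained by testing with smooth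
approximations of `|φ|`. -/
lemma lintegral_enorm_le (hp : 1 < p) (hσ : σ ∈ fieldClass Ω p) (hμ : IsNegDivMeasure Ω σ μ)
    {φ : Rn n → ℝ} (hφ : IsTestFun Ω φ) :
    ∫⁻ x, ‖φ x‖ₑ ∂μ ≤ eLpNorm σ (ENNReal.ofReal p.conjExponent) (volume.restrict Ω) *
      eLpNorm (fun x => gradient φ x) (ENNReal.ofReal p) (volume.restrict Ω) := by
  set B := eLpNorm σ (ENNReal.ofReal p.conjExponent) (volume.restrict Ω) *
      eLpNorm (fun x => gradient φ x) (ENNReal.ofReal p) (volume.restrict Ω) with hB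
  have hstep : ∀ ε : ℝ, 0 < ε → ∫⁻ x, ENNReal.ofReal (smoothAbs ε (φ x)) ∂μ ≤ B := by
    intro ε hε
    have ht : IsTestFun Ω (fun x => smoothAbs ε (φ x)) :=
      hφ.comp (contDiff_smoothAbs hε) (smoothAbs_zero hε)
    rw [← ofReal_integral_eq_lintegral_ofReal (hμ.integrable ht)
      (Eventually.of_forall fun x => smoothAbs_nonneg ε _), hμ.integral_eq _ ht]
    calc ENNReal.ofReal (∫ x in Ω, inner ℝ (σ x) (gradient (fun x => smoothAbs ε (φ x)) x))
        ≤ ‖∫ x in Ω, (inner ℝ (σ x) (gradient (fun x => smoothAbs ε (φ x)) x) : ℝ)‖ₑ :=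
          Real.ofReal_le_enorm _
      _ ≤ ∫⁻ x in Ω, ‖(inner ℝ (σ x) (gradient (fun x => smoothAbs ε (φ x)) x) : ℝ)‖ₑ :=
          enorm_integral_le_lintegral_enorm _
      _ ≤ eLpNorm σ (ENNReal.ofReal p.conjExponent) (volume.restrict Ω) *
          eLpNorm (fun x => gradient (fun x => smoothAbs ε (φ x)) x) (ENNReal.ofReal p)
            (volume.restrict Ω) :=
          lintegral_inner_le hp hσ.1.1 ht.continuous_grad.aestronglyMeasurable
      _ ≤ B := by
          rw [hB]
          refine mul_le_mul' le_rfl (eLpNorm_mono fun x => ?_)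
          rw [hφ.gradient_comp (contDiff_smoothAbs hε), norm_smul]
          exact mul_le_of_le_one_left (norm_nonneg _) (abs_deriv_smoothAbs_le hε _)
  have hlim : ∀ x, Tendsto (fun k : ℕ => ENNReal.ofReal (smoothAbs (1 / ((k : ℝ) + 1)) (φ x)))
      atTop (𝓝 ‖φ x‖ₑ) := by
    intro x
    have hs : Tendsto (fun k : ℕ => 1 / ((k : ℝ) + 1)) atTop (𝓝 0) :=
      tendsto_one_div_add_atTop_nhds_zero_nat
    have hc : Continuous (fun ε : ℝ => smoothAbs ε (φ x)) := by
      unfold smoothAbs; fun_prop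
    have := (hc.tendsto 0).comp hs
    have h0 : smoothAbs 0 (φ x) = ‖φ x‖ := by
      simp [smoothAbs, Real.sqrt_sq_eq_abs]
    rw [h0] at this
    have := (ENNReal.continuous_ofReal.tendsto _).comp this
    rwa [ofReal_norm] at this
  calc ∫⁻ x, ‖φ x‖ₑ ∂μ
      = ∫⁻ x, liminf (fun k : ℕ => ENNReal.ofReal (smoothAbs (1 / ((k : ℝ) + 1)) (φ x))) atTop ∂μ :=
        lintegral_congr fun x => (hlim x).liminf_eq.symm
    _ ≤ liminf (fun k : ℕ => ∫⁻ x, ENNReal.ofReal (smoothAbs (1 / ((k : ℝ) + 1)) (φ x)) ∂μ) atTop :=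
        lintegral_liminf_le fun k => (((contDiff_smoothAbs (by positivity)).continuous.comp
          hφ.continuous).measurable).ennreal_ofReal
    _ ≤ B := by
        refine (liminf_le_liminf (v := fun _ => B)
          (Eventually.of_forall fun k => hstep _ (by positivity))).trans ?_
        simp

/-- Test functions converging in `W^{1,p}` converge in `L¹(μ)`. -/
lemma exists_limit (hp : 1 < p) (hσ : σ ∈ fieldClass Ω p) (hμ : IsNegDivMeasure Ω σ μ)
    {φ : ℕ → Rn n → ℝ} {w : Rn n → ℝ} {g : Rn n → Rn n} (hw : SobolevTendsto Ω p φ w g) :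
    ∃ w' : Rn n → ℝ, MemLp w' 1 μ ∧
      Tendsto (fun k => eLpNorm (fun x => φ k x - w' x) 1 μ) atTop (𝓝 0) := by
  set S := eLpNorm σ (ENNReal.ofReal p.conjExponent) (volume.restrict Ω) with hS
  refine exists_tendsto_eLpNorm_of_le le_rfl
    (fun k => memLp_one_iff_integrable.2 (hμ.integrable (hw.test k)))
    (a := fun k => S * eLpNorm (fun x => gradient (φ k) x - g x) (ENNReal.ofReal p)
      (volume.restrict Ω)) ?_ (fun m k => ?_)
  · have := ENNReal.Tendsto.const_mul (a := S) hw.tendsto_grad (Or.inr hσ.1.2.ne)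
    rwa [mul_zero] at this
  · rw [eLpNorm_one_eq_lintegral_enorm, ← mul_add]
    refine (hμ.lintegral_enorm_le hp hσ ((hw.test m).sub (hw.test k))).trans ?_
    refine mul_le_mul' le_rfl ?_
    have e : (fun x => gradient (fun y => φ m y - φ k y) x) =
        (fun x => gradient (φ m) x - g x) - (fun x => gradient (φ k) x - g x) := by
      ext1 x
      rw [gradient_sub' ((hw.test m).differentiable x) ((hw.test k).differentiable x)]
      simp
    rw [e]
    exact eLpNorm_sub_le (((hw.test m).memLp_grad (ENNReal.ofReal p) _).sub hw.memLp_grad).1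
      (((hw.test k).memLp_grad (ENNReal.ofReal p) _).sub hw.memLp_grad).1 (one_le_ofReal hp)

/-- Chebyshev's inequality for `μ` in terms of the Sobolev norm: the `μ`-measure of an open set where
`s ≥ 1` almost everywhere is bounded, locally, by the norm of `s`. -/
lemma measure_le_of_one_le (hΩ : IsOpen Ω) (hp : 1 < p) (hσ : σ ∈ fieldClass Ω p)
    (hμ : IsNegDivMeasure Ω σ μ)
    {s : Rn n → ℝ} {g : Rn n → Rn n} (hs : IsSobolevPair Ω p s g) {W O : Set (Rn n)}
    (hW : IsOpen W) (hWΩ : W ⊆ Ω) (h1 : ∀ᵐ x ∂(volume.restrict W), 1 ≤ s x) {χ : Rn n → ℝ}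
    (hχ : IsTestFun Ω χ) (hO : IsOpen O) (hχ1 : ∀ x ∈ O, χ x = 1) :
    μ (W ∩ O) ≤ eLpNorm σ (ENNReal.ofReal p.conjExponent) (volume.restrict Ω) *
      eLpNorm (fun x => s x • gradient χ x + χ x • g x) (ENNReal.ofReal p) (volume.restrict Ω) := by
  set S := eLpNorm σ (ENNReal.ofReal p.conjExponent) (volume.restrict Ω) with hS
  have hcomp : ∀ K, IsCompact K → K ⊆ W ∩ O → μ K ≤ S *
      eLpNorm (fun x => s x • gradient χ x + χ x • g x) (ENNReal.ofReal p)
        (volume.restrict Ω) := by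
    intro K hK hKW
    -- on `K`, mollifications of `s` are eventually at least `1`, like `s` itself near `K`
    have hconv := hs.sobolevTendsto_mul hΩ hp hχ
    set θ : ℕ → Rn n → ℝ := fun k x => χ x * moll k (Ω.indicator s) x with hθ
    have hlim : Tendsto (fun k => S * (eLpNorm (fun x => gradient (θ k) x -
        (s x • gradient χ x + χ x • g x)) (ENNReal.ofReal p) (volume.restrict Ω) +
        eLpNorm (fun x => s x • gradient χ x + χ x • g x) (ENNReal.ofReal p)
        (volume.restrict Ω))) atTop (𝓝 (S * (0 +
        eLpNorm (fun x => s x • gradient χ x + χ x • g x) (ENNReal.ofReal p)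
        (volume.restrict Ω)))) :=
      ENNReal.Tendsto.const_mul (hconv.tendsto_grad.add tendsto_const_nhds) (Or.inr hσ.1.2.ne)
    rw [zero_add] at hlim
    refine ge_of_tendsto hlim ?_
    have hKW' : K ⊆ W := hKW.trans inter_subset_left
    filter_upwards [eventually_forall_closedBall_subset hK hW hKW'] with k hk
    have hge : ∀ x ∈ K, 1 ≤ θ k x := by
      intro x hx
      simp only [hθ]
      rw [hχ1 x (hKW hx).2, one_mul]
      refine le_moll k (hs.locallyIntegrable_indicator hΩ hp) hW.measurableSet ?_ (hk x hx)
      filter_upwards [h1, ae_restrict_mem hW.measurableSet] with y hy hyW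
      rwa [indicator_of_mem (hWΩ hyW)]
    calc μ K = ∫⁻ _ in K, 1 ∂μ := by simp
      _ ≤ ∫⁻ x in K, ‖θ k x‖ₑ ∂μ := by
          refine setLIntegral_mono' hK.measurableSet fun x hx => ?_
          rw [← ofReal_norm, ← ENNReal.ofReal_one]
          exact ENNReal.ofReal_le_ofReal ((hge x hx).trans (le_abs_self _))
      _ ≤ ∫⁻ x, ‖θ k x‖ₑ ∂μ := setLIntegral_le_lintegral _ _
      _ ≤ S * eLpNorm (fun x => gradient (θ k) x) (ENNReal.ofReal p) (volume.restrict Ω) :=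
          hμ.lintegral_enorm_le hp hσ (hconv.test k)
      _ ≤ _ := by
          refine mul_le_mul' le_rfl ?_
          have e : (fun x => gradient (θ k) x) = (fun x => gradient (θ k) x -
              (s x • gradient χ x + χ x • g x)) + (fun x => s x • gradient χ x + χ x • g x) := by
            ext1 x; simp
          conv_lhs => rw [e]
          exact eLpNorm_add_le (((hconv.test k).memLp_grad (ENNReal.ofReal p) _).sub
            hconv.memLp_grad).1 hconv.memLp_grad.1 (one_le_ofReal hp)
  obtain ⟨F, hFc, hFsub, hFU, hFm⟩ := (hW.inter hO).exists_iUnion_isClosed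
  have hU : W ∩ O = ⋃ k : ℕ, F k ∩ Metric.closedBall 0 k := by
    apply Subset.antisymm
    · intro x hx
      rw [← hFU] at hx
      obtain ⟨i, hi⟩ := mem_iUnion.1 hx
      obtain ⟨j, hj⟩ := exists_nat_ge ‖x‖
      refine mem_iUnion.2 ⟨max i j, hFm (le_max_left i j) hi, ?_⟩
      rw [mem_closedBall_zero_iff]
      exact hj.trans (by exact_mod_cast le_max_right i j)
    · exact iUnion_subset fun k => inter_subset_left.trans (hFsub k)
  have hmono : Monotone (fun k : ℕ => F k ∩ Metric.closedBall (0 : Rn n) k) := fun i j hij =>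
    inter_subset_inter (hFm hij) (Metric.closedBall_subset_closedBall (by exact_mod_cast hij))
  rw [hU, hmono.measure_iUnion]
  refine iSup_le fun k => hcomp _ ((isCompact_closedBall _ _).inter_left (hFc k)) ?_
  exact inter_subset_left.trans (hFsub k)

end IsNegDivMeasure

end Pairing

/-! ### Quasicontinuous representatives and the measure `-div σ` -/

section Capacity

variable {n : ℕ} {Ω : Set (Rn n)} {p : ℝ} {σ : Rn n → Rn n} {μ : Measure (Rn n)}

lemma exists_of_sobolevCap_lt (hp : 1 < p) {V : Set (Rn n)} {ε : ℝ≥0∞} (h : sobolevCap p V < ε) :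
    ∃ (u : Rn n → ℝ) (g : Rn n → Rn n) (V' : Set (Rn n)), IsSobolevPair univ p u g ∧ IsOpen V' ∧
      V ⊆ V' ∧ (∀ᵐ x ∂(volume.restrict V'), 1 ≤ u x) ∧
      eLpNorm u (ENNReal.ofReal p) volume ≤ ε ^ (1 / p) ∧
      eLpNorm g (ENNReal.ofReal p) volume ≤ ε ^ (1 / p) := by
  have hp0 : 0 < p := by linarith
  simp only [sobolevCap, iInf_lt_iff] at h
  obtain ⟨u, ⟨hu, V', hV', hVV', h1⟩, hlt⟩ := h
  have hq0 : ENNReal.ofReal p ≠ 0 := by simpa using hp0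
  have hpair := IsSobolevPair.of_memW1p hu
  have hm : AEMeasurable (fun x => ‖u x‖ₑ ^ p) volume := by
    have := hpair.memLp.1
    rw [Measure.restrict_univ] at this
    exact this.enorm.pow_const p
  rw [lintegral_add_left' hm] at hlt
  refine ⟨u, weakGradient univ u, V', hpair, hV', hVV', h1, ?_, ?_⟩
  · rw [eLpNorm_eq_lintegral_rpow_enorm_toReal hq0 ENNReal.ofReal_ne_top,
      ENNReal.toReal_ofReal hp0.le]
    gcongr
    exact le_self_add.trans hlt.le
  · rw [eLpNorm_eq_lintegral_rpow_enorm_toReal hq0 ENNReal.ofReal_ne_top,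
      ENNReal.toReal_ofReal hp0.le]
    gcongr
    exact le_add_self.trans hlt.le

lemma eLpNorm_capFun_comp_le {q : ℝ≥0∞} (v : Rn n → ℝ) (ν : Measure (Rn n)) :
    eLpNorm (fun x => capFun (v x)) q ν ≤ ENNReal.ofReal 3 * eLpNorm v q ν :=
  eLpNorm_le_mul_eLpNorm_of_ae_le_mul (Eventually.of_forall fun _ => capFun_le _) q

lemma eLpNorm_deriv_capFun_smul_le {q : ℝ≥0∞} (v : Rn n → ℝ) (g : Rn n → Rn n)
    (ν : Measure (Rn n)) :
    eLpNorm (fun x => deriv capFun (v x) • g x) q ν ≤ ENNReal.ofReal 3 * eLpNorm g q ν := by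
  refine eLpNorm_le_mul_eLpNorm_of_ae_le_mul (Eventually.of_forall fun x => ?_) q
  rw [norm_smul]
  gcongr
  exact abs_deriv_capFun_le _

/-- Test functions approximating `w` in `W^{1,p}(Ω)` converge, locally in `μ`-measure, to every
quasicontinuous representative of `w`. Outside an open set of small capacity the deviation set is
open, and on the union of the two the Sobolev function
`capFun (c (φ k - w)) + capFun u` is at least `1`, `u` being admissible for the capacity. -/
lemma IsNegDivMeasure.tendstoInMeasure (hΩ : IsOpen Ω) (hp : 1 < p) (hσ : σ ∈ fieldClass Ω p)
    (hμ : IsNegDivMeasure Ω σ μ) {φ : ℕ → Rn n → ℝ} {w w' : Rn n → ℝ} {g : Rn n → Rn n}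
    (hw : SobolevTendsto Ω p φ w g) (hw' : IsQuasicontRep Ω p w w') {χ : Rn n → ℝ}
    {O : Set (Rn n)} (hχ : IsTestFun Ω χ) (hO : IsOpen O) (hOΩ : O ⊆ Ω)
    (hχ1 : ∀ x ∈ O, χ x = 1) :
    TendstoInMeasure (μ.restrict O) φ atTop w' := by
  rw [tendstoInMeasure_iff_norm]
  intro δ hδ
  have hq := one_le_ofReal hp
  set q := ENNReal.ofReal p with hqdef
  set S := eLpNorm σ (ENNReal.ofReal p.conjExponent) (volume.restrict Ω) with hS
  obtain ⟨C, hC0, hC⟩ := hχ.exists_bound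
  have hcap : Continuous (deriv capFun) := contDiff_capFun.continuous_deriv (by simp)
  set a : ℕ → ℝ≥0∞ := fun k => eLpNorm (fun x => φ k x - w x) q (volume.restrict Ω) with ha
  set b : ℕ → ℝ≥0∞ := fun k => eLpNorm (fun x => gradient (φ k) x - g x) q (volume.restrict Ω)
    with hb
  have hD : ‖(2 / δ : ℝ)‖ₑ ≠ ⊤ := enorm_ne_top
  refine ENNReal.tendsto_zero_of_le_add
    (b := fun k => S * (ENNReal.ofReal C * (ENNReal.ofReal 3 * (‖(2 / δ : ℝ)‖ₑ * a k) +
      ENNReal.ofReal 3 * (‖(2 / δ : ℝ)‖ₑ * b k))))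
    (c := fun t => S * (ENNReal.ofReal C * (ENNReal.ofReal 3 * t ^ (1 / p) +
      ENNReal.ofReal 3 * t ^ (1 / p)))) ?_ ?_ ?_
  · have := ENNReal.Tendsto.const_mul (a := S) (ENNReal.Tendsto.const_mul (a := ENNReal.ofReal C)
      ((ENNReal.Tendsto.const_mul (a := ENNReal.ofReal 3)
        (ENNReal.Tendsto.const_mul (a := ‖(2 / δ : ℝ)‖ₑ) hw.tendsto (Or.inr hD))
          (Or.inr ENNReal.ofReal_ne_top)).add
      (ENNReal.Tendsto.const_mul (a := ENNReal.ofReal 3)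
        (ENNReal.Tendsto.const_mul (a := ‖(2 / δ : ℝ)‖ₑ) hw.tendsto_grad (Or.inr hD))
          (Or.inr ENNReal.ofReal_ne_top))) (Or.inr ENNReal.ofReal_ne_top)) (Or.inr hσ.1.2.ne)
    simpa using this
  · have ht : Tendsto (fun t : ℝ≥0∞ => t ^ (1 / p)) (𝓝 0) (𝓝 0) := by
      have := (ENNReal.continuous_rpow_const (y := 1 / p)).tendsto 0
      rwa [ENNReal.zero_rpow_of_pos (by positivity)] at this
    have h3 := ENNReal.Tendsto.const_mul (a := ENNReal.ofReal 3) ht (Or.inr ENNReal.ofReal_ne_top)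
    have := ENNReal.Tendsto.const_mul (a := S) (ENNReal.Tendsto.const_mul (a := ENNReal.ofReal C)
      (h3.add h3) (Or.inr ENNReal.ofReal_ne_top)) (Or.inr hσ.1.2.ne)
    simpa using this
  · intro t ht k
    obtain ⟨V, hV, hVcap, hVc⟩ := hw'.2 t ht
    obtain ⟨u, gu, V', hu, hV', hVV', hu1, hun, hgn⟩ := exists_of_sobolevCap_lt hp hVcap
    -- off `V`, the set where `φ k` deviates from the representative is relatively open
    have hcont : ContinuousOn (fun x => ‖φ k x - w' x‖) (Ω \ V) :=
      ((hw.test k).continuous.continuousOn.sub hVc).norm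
    obtain ⟨U, hU, hUeq⟩ := continuousOn_iff'.1 hcont (Ioi (δ / 2)) isOpen_Ioi
    set W := (U ∪ V') ∩ Ω with hWdef
    have hWo : IsOpen W := (hU.union hV').inter hΩ
    have hpair1 : IsSobolevPair Ω p (fun x => capFun ((2 / δ) * (φ k x - w x)))
        (fun x => deriv capFun ((2 / δ) * (φ k x - w x)) • ((2 / δ) • (gradient (φ k) x - g x))) :=
      (((IsSobolevPair.of_isTestFun ((hw.test k).mono (subset_univ _))).sub hΩ
        (hw.isSobolevPair hΩ hp)).const_mul (2 / δ)).comp hΩ hp contDiff_capFun capFun_zero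
        abs_deriv_capFun_le
    have hpair2 := ((hu.mono (subset_univ Ω)).comp hΩ hp contDiff_capFun capFun_zero
        abs_deriv_capFun_le)
    have hs := hpair1.add hΩ hpair2
    have hs1 : ∀ᵐ x ∂(volume.restrict W),
        1 ≤ capFun ((2 / δ) * (φ k x - w x)) + capFun (u x) := by
      have h1 : ∀ᵐ x ∂(volume.restrict W), w' x = w x :=
        ae_mono (Measure.restrict_mono inter_subset_right le_rfl) hw'.1
      have h2 : ∀ᵐ x ∂(volume.restrict W), x ∈ V' → 1 ≤ u x := by
        rw [ae_restrict_iff' hV'.measurableSet] at hu1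
        exact ae_restrict_of_ae hu1
      filter_upwards [h1, h2, ae_restrict_mem hWo.measurableSet] with x e1 e2 hxW
      by_cases hxV : x ∈ V'
      · have := one_le_capFun ((e2 hxV).trans (le_abs_self _))
        linarith [capFun_nonneg ((2 / δ) * (φ k x - w x))]
      · have hxU : x ∈ U := hxW.1.resolve_right hxV
        have hx : x ∈ U ∩ (Ω \ V) := ⟨hxU, hxW.2, fun h => hxV (hVV' h)⟩
        rw [← hUeq] at hx
        have hgt : δ / 2 < |φ k x - w x| := by
          have := hx.1
          simp only [mem_preimage, mem_Ioi, e1, Real.norm_eq_abs] at this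
          exact this
        have : 1 ≤ |(2 / δ) * (φ k x - w x)| := by
          rw [abs_mul, abs_of_pos (by positivity : 0 < 2 / δ)]
          calc (1 : ℝ) = (2 / δ) * (δ / 2) := by field_simp
            _ ≤ _ := by gcongr
        linarith [one_le_capFun this, capFun_nonneg (u x)]
    have hmain := hμ.measure_le_of_one_le hΩ hp hσ hs hWo inter_subset_right hs1 hχ hO hχ1
    have hsub : {x | δ ≤ ‖φ k x - w' x‖} ∩ O ⊆ W ∩ O := by
      rintro x ⟨hx, hxO⟩
      refine ⟨⟨?_, hOΩ hxO⟩, hxO⟩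
      by_cases hxV : x ∈ V
      · exact Or.inr (hVV' hxV)
      · left
        have : x ∈ (fun x => ‖φ k x - w' x‖) ⁻¹' Ioi (δ / 2) ∩ (Ω \ V) := by
          refine ⟨?_, hOΩ hxO, hxV⟩
          simp only [mem_preimage, mem_Ioi]
          have : δ ≤ ‖φ k x - w' x‖ := hx
          linarith
        rw [hUeq] at this
        exact this.1
    have hres : volume.restrict (tsupport χ) ≤ volume.restrict Ω :=
      Measure.restrict_mono hχ.subset le_rfl
    rw [Measure.restrict_apply' hO.measurableSet]
    refine (measure_mono hsub).trans (hmain.trans ?_)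
    rw [← mul_add, ← mul_add]
    refine mul_le_mul' le_rfl ?_
    refine (hχ.eLpNorm_mul_grad_le hC hq (hs.memLp.1.mono_measure hres)
      (hs.memLp_grad.1.mono_measure hres)).trans ?_
    refine mul_le_mul' le_rfl ?_
    have n1 : eLpNorm (fun x => capFun ((2 / δ) * (φ k x - w x)) + capFun (u x)) q
        (volume.restrict (tsupport χ)) ≤
        ENNReal.ofReal 3 * (‖(2 / δ : ℝ)‖ₑ * a k) + ENNReal.ofReal 3 * t ^ (1 / p) := by
      refine (eLpNorm_mono_measure _ hres).trans
        ((eLpNorm_add_le hpair1.memLp.1 hpair2.memLp.1 hq).trans (add_le_add ?_ ?_))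
      · refine (eLpNorm_capFun_comp_le _ _).trans (mul_le_mul' le_rfl (le_of_eq ?_))
        exact eLpNorm_const_smul (2 / δ : ℝ) (fun x => φ k x - w x) q _
      · refine (eLpNorm_capFun_comp_le _ _).trans (mul_le_mul' le_rfl ?_)
        exact (eLpNorm_mono_measure _ Measure.restrict_le_self).trans hun
    have n2 : eLpNorm (fun x => deriv capFun ((2 / δ) * (φ k x - w x)) •
        ((2 / δ) • (gradient (φ k) x - g x)) + deriv capFun (u x) • gu x) q
        (volume.restrict (tsupport χ)) ≤
        ENNReal.ofReal 3 * (‖(2 / δ : ℝ)‖ₑ * b k) + ENNReal.ofReal 3 * t ^ (1 / p) := by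
      refine (eLpNorm_mono_measure _ hres).trans
        ((eLpNorm_add_le hpair1.memLp_grad.1 hpair2.memLp_grad.1 hq).trans (add_le_add ?_ ?_))
      · refine (eLpNorm_deriv_capFun_smul_le _ _ _).trans (mul_le_mul' le_rfl (le_of_eq ?_))
        exact eLpNorm_const_smul (2 / δ : ℝ) (fun x => gradient (φ k) x - g x) q _
      · refine (eLpNorm_deriv_capFun_smul_le _ _ _).trans (mul_le_mul' le_rfl ?_)
        exact (eLpNorm_mono_measure _ Measure.restrict_le_self).trans hgn
    refine (add_le_add n1 n2).trans (le_of_eq ?_)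
    abel

/-- A sequence of cutoff functions exhausting an open set: near every point, all but finitely many of
them are equal to `1`. -/
lemma exists_cutoff_seq (hΩ : IsOpen Ω) :
    ∃ (η : ℕ → Rn n → ℝ) (O : ℕ → Set (Rn n)), (∀ j, IsTestFun Ω (η j)) ∧
      (∀ j x, 0 ≤ η j x ∧ η j x ≤ 1) ∧ (∀ j, IsOpen (O j)) ∧ (∀ j, O j ⊆ Ω) ∧
      (∀ j, ∀ x ∈ O j, η j x = 1) ∧ (∀ x ∈ Ω, ∃ j, ∀ᶠ y in 𝓝 x, ∀ i ≥ j, y ∈ O i) := by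
  have : LocallyCompactSpace Ω := hΩ.locallyCompactSpace
  let K : CompactExhaustion Ω := default
  have hcut : ∀ j : ℕ, ∃ η : Rn n → ℝ, IsTestFun Ω η ∧ (∀ x, 0 ≤ η x ∧ η x ≤ 1) ∧
      ∃ O, IsOpen O ∧ Subtype.val '' K j ⊆ O ∧ O ⊆ Ω ∧ ∀ x ∈ O, η x = 1 := fun j =>
    exists_isTestFun_cutoff hΩ ((K.isCompact j).image continuous_subtype_val) (by simp)
  choose η hη h01 O hO hsub hOΩ h1 using hcut
  refine ⟨η, O, hη, h01, hO, hOΩ, h1, fun x hx => ?_⟩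
  obtain ⟨j, hj⟩ := K.exists_mem_nhds ⟨x, hx⟩
  have hj' : Subtype.val '' K j ∈ 𝓝 x := hΩ.isOpenMap_subtype_val.image_mem_nhds hj
  refine ⟨j, ?_⟩
  filter_upwards [hj'] with y hy i hi
  exact hsub i (image_mono (K.subset hi) hy)

lemma IsNegDivMeasure.ae_mem (hμ : IsNegDivMeasure Ω σ μ) : ∀ᵐ x ∂μ, x ∈ Ω := by
  rw [ae_iff]
  exact hμ.compl

/-- Every quasicontinuous representative of a limit of test functions in `W^{1,p}` is the limit of
these functions in `L¹(μ)`. -/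
lemma IsNegDivMeasure.memLp_one_and_tendsto (hΩ : IsOpen Ω) (hp : 1 < p) (hσ : σ ∈ fieldClass Ω p)
    (hμ : IsNegDivMeasure Ω σ μ) {φ : ℕ → Rn n → ℝ} {w w' : Rn n → ℝ} {g : Rn n → Rn n}
    (hw : SobolevTendsto Ω p φ w g) (hw' : IsQuasicontRep Ω p w w') :
    MemLp w' 1 μ ∧ Tendsto (fun k => eLpNorm (fun x => φ k x - w' x) 1 μ) atTop (𝓝 0) := by
  obtain ⟨z, hz, hlim⟩ := hμ.exists_limit hp hσ hw
  obtain ⟨η, O, hη, -, hO, hOΩ, h1, hex⟩ := exists_cutoff_seq hΩ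
  have hae : ∀ j, ∀ᵐ x ∂μ, x ∈ O j → z x = w' x := by
    intro j
    rw [← ae_restrict_iff' (hO j).measurableSet]
    have c1 := hμ.tendstoInMeasure hΩ hp hσ hw hw' (hη j) (hO j) (hOΩ j) (h1 j)
    have c2 : TendstoInMeasure (μ.restrict (O j)) φ atTop z := by
      refine tendstoInMeasure_of_tendsto_eLpNorm one_ne_zero
        (fun k => (hw.test k).continuous.aestronglyMeasurable)
        (hz.1.mono_measure Measure.restrict_le_self) ?_
      exact tendsto_of_tendsto_of_tendsto_of_le_of_le tendsto_const_nhds hlim (fun _ => zero_le)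
        (fun k => eLpNorm_mono_measure _ Measure.restrict_le_self)
    exact tendstoInMeasure_ae_unique c2 c1
  have heq : z =ᵐ[μ] w' := by
    filter_upwards [ae_all_iff.2 hae, hμ.ae_mem] with x hx hxΩ
    obtain ⟨j, hj⟩ := hex x hxΩ
    exact hx j (hj.self_of_nhds j le_rfl)
  refine ⟨(memLp_congr_ae heq).1 hz, hlim.congr fun k => eLpNorm_congr_ae ?_⟩
  filter_upwards [heq] with x hx
  rw [hx]

/-- The measure `-div σ` tested with a `W^{1,p}_0` function. -/
lemma IsNegDivMeasure.integral_quasicontRep (hΩ : IsOpen Ω) (hp : 1 < p)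
    (hσ : σ ∈ fieldClass Ω p)
    (hμ : IsNegDivMeasure Ω σ μ) {φ : ℕ → Rn n → ℝ} {w w' : Rn n → ℝ} {g : Rn n → Rn n}
    (hw : SobolevTendsto Ω p φ w g) (hw' : IsQuasicontRep Ω p w w') :
    Integrable w' μ ∧ ∫ x, w' x ∂μ = ∫ x in Ω, inner ℝ (σ x) (g x) := by
  obtain ⟨h1, h2⟩ := hμ.memLp_one_and_tendsto hΩ hp hσ hw hw'
  have hi := memLp_one_iff_integrable.1 h1
  refine ⟨hi, tendsto_nhds_unique (f := fun k => ∫ x, φ k x ∂μ) (l := atTop) ?_ ?_⟩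
  · refine tendsto_integral_of_L1 _ hi.1
      (Eventually.of_forall fun k => hμ.integrable (hw.test k)) ?_
    simpa only [eLpNorm_one_eq_lintegral_enorm] using h2
  · simp only [fun k => hμ.integral_eq _ (hw.test k)]
    exact tendsto_integral_inner hp hσ.1 hw.memLp_grad (fun k => (hw.test k).memLp_grad _ _)
      hw.tendsto_grad

lemma IsQuasicontRep.mul {f f' η : Rn n → ℝ} (hf : IsQuasicontRep Ω p f f') (hη : Continuous η) :
    IsQuasicontRep Ω p (fun x => η x * f x) (fun x => η x * f' x) := by
  refine ⟨?_, fun ε hε => ?_⟩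
  · filter_upwards [hf.1] with x hx
    rw [hx]
  · obtain ⟨V, hV, hc, hV'⟩ := hf.2 ε hε
    exact ⟨V, hV, hc, hη.continuousOn.mul hV'⟩

/-- The measure `-div σ` tested with `η f`, for a quasicontinuous Sobolev function `f`. -/
lemma IsNegDivMeasure.integral_mul_quasicontRep (hΩ : IsOpen Ω) (hp : 1 < p)
    (hσ : σ ∈ fieldClass Ω p) (hμ : IsNegDivMeasure Ω σ μ) {f f' : Rn n → ℝ} {g : Rn n → Rn n}
    (hf : IsSobolevPair Ω p f g) (hf' : IsQuasicontRep Ω p f f') {η : Rn n → ℝ}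
    (hη : IsTestFun Ω η) :
    Integrable (fun x => η x * f' x) μ ∧
      ∫ x, η x * f' x ∂μ = ∫ x in Ω, inner ℝ (σ x) (f x • gradient η x + η x • g x) :=
  hμ.integral_quasicontRep hΩ hp hσ (hf.sobolevTendsto_mul hΩ hp hη) (hf'.mul hη.continuous)

end Capacity

/-! ### Existence of quasicontinuous representatives -/

section QuasicontinuousRepresentative

variable {n : ℕ} {Ω : Set (Rn n)} {p : ℝ}

lemma eLpNorm_sum_le' {α E ι : Type*} [MeasurableSpace α] {μ : Measure α} [NormedAddCommGroup E]
    {q : ℝ≥0∞} (hq : 1 ≤ q) (s : Finset ι) {f : ι → α → E} (hf : ∀ i, AEStronglyMeasurable (f i) μ) :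
    eLpNorm (fun x => ∑ i ∈ s, f i x) q μ ≤ ∑ i ∈ s, eLpNorm (f i) q μ := by
  have := eLpNorm_sum_le (s := s) (fun i _ => hf i) hq
  convert this using 2
  ext1 x
  simp

lemma gradient_sum {ι : Type*} (s : Finset ι) {φ : ι → Rn n → ℝ} (h : ∀ i, IsTestFun Ω (φ i))
    (x : Rn n) : gradient (fun y => ∑ i ∈ s, φ i y) x = ∑ i ∈ s, gradient (φ i) x := by
  classical
  induction s using Finset.induction_on with
  | empty => simp
  | insert a s ha ih =>
    simp only [Finset.sum_insert ha]
    rw [gradient_add' ((h a).differentiable x) ((IsTestFun.sum s h).differentiable x), ih]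

lemma ENNReal.sum_Ico_le_tsum_add (b : ℕ → ℝ≥0∞) (N M : ℕ) :
    ∑ i ∈ Finset.Ico N M, b i ≤ ∑' i, b (i + N) := by
  rw [Finset.sum_Ico_eq_sum_range]
  simp only [add_comm N]
  exact ENNReal.sum_le_tsum _

/-- Partial sums with summable norms form a Cauchy sequence in `L^q`. -/
lemma eLpNorm_partialSum_sub_le {α E : Type*} [MeasurableSpace α] {μ : Measure α}
    [NormedAddCommGroup E] {q : ℝ≥0∞} (hq : 1 ≤ q) {f : ℕ → α → E}
    (hf : ∀ i, AEStronglyMeasurable (f i) μ) {b : ℕ → ℝ≥0∞} (hb : ∀ i, eLpNorm (f i) q μ ≤ b i)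
    (m k : ℕ) :
    eLpNorm (fun x => ∑ i ∈ Finset.range m, f i x - ∑ i ∈ Finset.range k, f i x) q μ ≤
      ∑' i, b (i + m) + ∑' i, b (i + k) := by
  have key : ∀ m k : ℕ, m ≤ k → eLpNorm (fun x => ∑ i ∈ Finset.range k, f i x -
      ∑ i ∈ Finset.range m, f i x) q μ ≤ ∑' i, b (i + m) := by
    intro m k hmk
    have e : (fun x => ∑ i ∈ Finset.range k, f i x - ∑ i ∈ Finset.range m, f i x) =
        fun x => ∑ i ∈ Finset.Ico m k, f i x := by
      ext1 x
      rw [Finset.sum_Ico_eq_sub _ hmk]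
    rw [e]
    exact (eLpNorm_sum_le' hq _ hf).trans ((Finset.sum_le_sum fun i _ => hb i).trans
      (ENNReal.sum_Ico_le_tsum_add b m k))
  rcases le_total m k with h | h
  · have := key m k h
    have e : (fun x => ∑ i ∈ Finset.range m, f i x - ∑ i ∈ Finset.range k, f i x) =
        -(fun x => ∑ i ∈ Finset.range k, f i x - ∑ i ∈ Finset.range m, f i x) := by
      ext1 x; simp
    rw [e, eLpNorm_neg]
    exact this.trans le_self_add
  · exact (key k m h).trans le_add_self

lemma eLpNorm_le_of_tendsto_of_le {α E : Type*} [MeasurableSpace α] {μ : Measure α}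
    [NormedAddCommGroup E] {q : ℝ≥0∞} (hq : 1 ≤ q) {f : ℕ → α → E} {g : α → E}
    (hf : ∀ i, AEStronglyMeasurable (f i) μ) (hg : AEStronglyMeasurable g μ)
    (h : Tendsto (fun k => eLpNorm (fun x => f k x - g x) q μ) atTop (𝓝 0)) {B : ℝ≥0∞}
    (hB : ∀ k, eLpNorm (f k) q μ ≤ B) : eLpNorm g q μ ≤ B := by
  have h' := h.const_add B
  rw [add_zero] at h'
  refine ge_of_tendsto' h' fun k => ?_
  have e : g = f k - (fun x => f k x - g x) := by ext1 x; simp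
  calc eLpNorm g q μ = eLpNorm (f k - (fun x => f k x - g x)) q μ := by rw [← e]
    _ ≤ eLpNorm (f k) q μ + eLpNorm (fun x => f k x - g x) q μ :=
      eLpNorm_sub_le (hf k) ((hf k).sub hg) hq
    _ ≤ _ := by gcongr; exact hB k

/-- A weak form of the countable subadditivity of the capacity, for superlevel sets of test
functions: the series `∑ capFun (θ j)` is admissible for the union. -/
lemma sobolevCap_iUnion_le (hp : 1 < p) {θ : ℕ → Rn n → ℝ} (hθ : ∀ j, IsTestFun univ (θ j))
    {b : ℕ → ℝ≥0∞} (hb : ∑' j, b j ≠ ⊤)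
    (h1 : ∀ j, eLpNorm (θ j) (ENNReal.ofReal p) volume ≤ b j)
    (h2 : ∀ j, eLpNorm (fun x => gradient (θ j) x) (ENNReal.ofReal p) volume ≤ b j) :
    sobolevCap p (⋃ j, {x | 1 < |θ j x|}) ≤
      2 * (∑' j, ENNReal.ofReal 3 * b j) ^ p := by
  have hp0 : 0 < p := by linarith
  have hq := one_le_ofReal hp
  have hq0 : ENNReal.ofReal p ≠ 0 := by simpa using hp0
  set q := ENNReal.ofReal p with hqd
  set c : ℕ → ℝ≥0∞ := fun j => ENNReal.ofReal 3 * b j with hc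
  have hcsum : ∑' j, c j ≠ ⊤ := by
    rw [hc, ENNReal.tsum_mul_left]
    exact ENNReal.mul_ne_top ENNReal.ofReal_ne_top hb
  set u : ℕ → Rn n → ℝ := fun j x => capFun (θ j x) with hu
  have hut : ∀ j, IsTestFun univ (u j) := fun j => (hθ j).comp contDiff_capFun capFun_zero
  have hun : ∀ j, eLpNorm (u j) q volume ≤ c j := fun j =>
    (eLpNorm_capFun_comp_le _ _).trans (mul_le_mul' le_rfl (h1 j))
  have hugrad : ∀ j x, gradient (u j) x = deriv capFun (θ j x) • gradient (θ j) x :=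
    fun j x => (hθ j).gradient_comp contDiff_capFun x
  have hgn : ∀ j, eLpNorm (fun x => gradient (u j) x) q volume ≤ c j := fun j => by
    simp only [hugrad]
    exact (eLpNorm_deriv_capFun_smul_le _ _ _).trans (mul_le_mul' le_rfl (h2 j))
  set s : ℕ → Rn n → ℝ := fun N x => ∑ j ∈ Finset.range N, u j x with hs
  have hst : ∀ N, IsTestFun univ (s N) := fun N => IsTestFun.sum _ hut
  have hsg : ∀ N, (fun x => gradient (s N) x) =
      fun x => ∑ j ∈ Finset.range N, gradient (u j) x := fun N => by
    ext1 x
    exact gradient_sum _ hut x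
  have hum : ∀ j, AEStronglyMeasurable (u j) volume := fun j =>
    (hut j).continuous.aestronglyMeasurable
  have hgm : ∀ j, AEStronglyMeasurable (fun x => gradient (u j) x) volume := fun j =>
    (hut j).continuous_grad.aestronglyMeasurable
  have htail : Tendsto (fun N => ∑' i, c (i + N)) atTop (𝓝 0) := ENNReal.tendsto_sum_nat_add c hcsum
  obtain ⟨U, hU, hUlim⟩ := exists_tendsto_eLpNorm_of_le hq (fun N => (hst N).memLp q volume) htail
    (fun m k => eLpNorm_partialSum_sub_le hq hum hun m k)
  obtain ⟨DU, hDU, hDUlim⟩ := exists_tendsto_eLpNorm_of_le hq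
    (fun N => (hst N).memLp_grad q volume) htail (fun m k => by
      have := eLpNorm_partialSum_sub_le hq hgm hgn m k
      have e : (fun x => gradient (s m) x - gradient (s k) x) =
          fun x => ∑ j ∈ Finset.range m, gradient (u j) x -
            ∑ j ∈ Finset.range k, gradient (u j) x := by
        ext1 x
        rw [congrFun (hsg m) x, congrFun (hsg k) x]
      rwa [e])
  have hconv : SobolevTendsto univ p s U DU :=
    ⟨hst, by rwa [Measure.restrict_univ], by rwa [Measure.restrict_univ],
      by rwa [Measure.restrict_univ], by rwa [Measure.restrict_univ]⟩
  have hpair := hconv.isSobolevPair isOpen_univ hp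
  have hUn : eLpNorm U q volume ≤ ∑' j, c j :=
    eLpNorm_le_of_tendsto_of_le hq (fun N => (hst N).continuous.aestronglyMeasurable) hU.1 hUlim
      (fun N => (eLpNorm_sum_le' hq _ hum).trans ((Finset.sum_le_sum fun i _ => hun i).trans
        (ENNReal.sum_le_tsum _)))
  have hDUn : eLpNorm DU q volume ≤ ∑' j, c j := by
    refine eLpNorm_le_of_tendsto_of_le hq
      (fun N => (hst N).continuous_grad.aestronglyMeasurable) hDU.1 hDUlim (fun N => ?_)
    rw [hsg N]
    exact (eLpNorm_sum_le' hq _ hgm).trans ((Finset.sum_le_sum fun i _ => hgn i).trans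
        (ENNReal.sum_le_tsum _))
  have hVo : IsOpen (⋃ j, {x | 1 < |θ j x|}) := isOpen_iUnion fun j =>
    isOpen_lt continuous_const (hθ j).continuous.abs
  have hge : ∀ᵐ x ∂(volume.restrict (⋃ j, {x | 1 < |θ j x|})), 1 ≤ U x := by
    obtain ⟨ns, hns, hae⟩ := hconv.exists_subseq_ae hp
    rw [Measure.restrict_univ] at hae
    rw [ae_restrict_iff' hVo.measurableSet]
    filter_upwards [hae] with x hx hxV
    obtain ⟨j, hj⟩ := mem_iUnion.1 hxV
    refine ge_of_tendsto hx ?_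
    filter_upwards [hns.tendsto_atTop.eventually_gt_atTop j] with k hk
    calc (1 : ℝ) ≤ u j x := one_le_capFun (le_of_lt hj)
      _ ≤ s (ns k) x := Finset.single_le_sum (f := fun j => u j x)
          (fun i _ => capFun_nonneg _) (Finset.mem_range.2 hk)
  have hpow : ∀ {E : Type} [NormedAddCommGroup E] (f : Rn n → E), eLpNorm f q volume ≤ ∑' j, c j →
      ∫⁻ x, ‖f x‖ₑ ^ p ≤ (∑' j, c j) ^ p := by
    intro E _ f hf
    rw [eLpNorm_eq_lintegral_rpow_enorm_toReal hq0 ENNReal.ofReal_ne_top,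
      ENNReal.toReal_ofReal hp0.le] at hf
    calc ∫⁻ x, ‖f x‖ₑ ^ p = ((∫⁻ x, ‖f x‖ₑ ^ p) ^ (1 / p)) ^ p := by
          rw [← ENNReal.rpow_mul]; simp [hp0.ne']
      _ ≤ _ := by gcongr
  have hW := hpair.weak.weakGradient_ae_eq isOpen_univ
  rw [Measure.restrict_univ] at hW
  calc sobolevCap p (⋃ j, {x | 1 < |θ j x|})
      ≤ ∫⁻ x, (‖U x‖ₑ ^ p + ‖weakGradient univ U x‖ₑ ^ p) :=
        iInf₂_le U ⟨hpair.memW1p isOpen_univ, _, hVo, Subset.rfl, hge⟩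
    _ = (∫⁻ x, ‖U x‖ₑ ^ p) + ∫⁻ x, ‖DU x‖ₑ ^ p := by
        rw [lintegral_add_left' (hU.1.enorm.pow_const p)]
        congr 1
        refine lintegral_congr_ae ?_
        filter_upwards [hW] with x hx
        rw [hx]
    _ ≤ (∑' j, c j) ^ p + (∑' j, c j) ^ p := add_le_add (hpow U hUn) (hpow DU hDUn)
    _ = _ := by rw [two_mul]

lemma IsTestFun.eLpNorm_eq_restrict {φ : Rn n → ℝ} (hφ : IsTestFun Ω φ) (hΩ : IsOpen Ω)
    (q : ℝ≥0∞) : eLpNorm φ q volume = eLpNorm φ q (volume.restrict Ω) := by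
  rw [← eLpNorm_indicator_eq_eLpNorm_restrict hΩ.measurableSet]
  congr 1
  ext1 x
  by_cases hx : x ∈ Ω
  · simp [hx]
  · simp [hx, hφ.zero_of_notMem hx]

lemma IsTestFun.eLpNorm_grad_eq_restrict {φ : Rn n → ℝ} (hφ : IsTestFun Ω φ) (hΩ : IsOpen Ω)
    (q : ℝ≥0∞) : eLpNorm (fun x => gradient φ x) q volume =
      eLpNorm (fun x => gradient φ x) q (volume.restrict Ω) := by
  rw [← eLpNorm_indicator_eq_eLpNorm_restrict hΩ.measurableSet]
  congr 1
  ext1 x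
  by_cases hx : x ∈ Ω
  · simp [hx]
  · simp [hx, hφ.grad_zero_of_notMem hx]

/-- Fast mollification: an approximating sequence of smooth functions, together with the cutoff
differences, which are small in `W^{1,p}`. -/
lemma IsSobolevPair.exists_fast_approx (hΩ : IsOpen Ω) (hp : 1 < p) {f : Rn n → ℝ}
    {g : Rn n → Rn n} (hf : IsSobolevPair Ω p f g) {η : ℕ → Rn n → ℝ}
    (hη : ∀ j, IsTestFun Ω (η j)) {e : ℕ → ℝ≥0∞} (he : ∀ j, 0 < e j) (hanti : Antitone e) :
    ∃ κ : ℕ → ℕ, (∀ j, j ≤ κ j) ∧ ∀ j,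
      eLpNorm (fun x => η j x * (moll (κ (j + 1)) (Ω.indicator f) x -
        moll (κ j) (Ω.indicator f) x)) (ENNReal.ofReal p) volume ≤ 2 * e j ∧
      eLpNorm (fun x => gradient (fun y => η j y * (moll (κ (j + 1)) (Ω.indicator f) y -
        moll (κ j) (Ω.indicator f) y)) x) (ENNReal.ofReal p) volume ≤ 2 * e j := by
  have hq := one_le_ofReal hp
  -- one index `k` serves the finitely many cutoffs `η i`, `i ≤ j`
  have hev : ∀ j : ℕ, ∃ k, j ≤ k ∧ ∀ i ≤ j,
      eLpNorm (fun x => η i x * moll k (Ω.indicator f) x - η i x * f x) (ENNReal.ofReal p)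
        (volume.restrict Ω) ≤ e j ∧
      eLpNorm (fun x => gradient (fun y => η i y * moll k (Ω.indicator f) y) x -
        (f x • gradient (η i) x + η i x • g x)) (ENNReal.ofReal p) (volume.restrict Ω) ≤ e j := by
    intro j
    have h1 : ∀ᶠ k in atTop, ∀ i ∈ Finset.range (j + 1),
        eLpNorm (fun x => η i x * moll k (Ω.indicator f) x - η i x * f x) (ENNReal.ofReal p)
          (volume.restrict Ω) ≤ e j ∧
        eLpNorm (fun x => gradient (fun y => η i y * moll k (Ω.indicator f) y) x -
          (f x • gradient (η i) x + η i x • g x)) (ENNReal.ofReal p) (volume.restrict Ω) ≤ e j := by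
      rw [Finset.eventually_all]
      intro i _
      have hc := hf.sobolevTendsto_mul hΩ hp (hη i)
      filter_upwards [hc.tendsto.eventually_le_const (he j),
        hc.tendsto_grad.eventually_le_const (he j)] with k h1 h2 using ⟨h1, h2⟩
    obtain ⟨k, hk, hjk⟩ := (h1.and (eventually_ge_atTop j)).exists
    exact ⟨k, hjk, fun i hi => hk i (Finset.mem_range.2 (Nat.lt_succ_of_le hi))⟩
  choose κ hκ hκe using hev
  refine ⟨κ, hκ, fun j => ?_⟩
  have hm := hf.contDiff_moll hΩ hp
  have ha := hκe (j + 1) j (Nat.le_succ j)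
  have hb := hκe j j le_rfl
  have hle : e (j + 1) ≤ e j := hanti (Nat.le_succ j)
  have hθ : IsTestFun Ω (fun x => η j x * (moll (κ (j + 1)) (Ω.indicator f) x -
      moll (κ j) (Ω.indicator f) x)) := (hη j).mul_left ((hm _).sub (hm _))
  have hc := hf.sobolevTendsto_mul hΩ hp (hη j)
  constructor
  · rw [hθ.eLpNorm_eq_restrict hΩ]
    have e1 : (fun x => η j x * (moll (κ (j + 1)) (Ω.indicator f) x -
        moll (κ j) (Ω.indicator f) x)) =
        (fun x => η j x * moll (κ (j + 1)) (Ω.indicator f) x - η j x * f x) -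
        (fun x => η j x * moll (κ j) (Ω.indicator f) x - η j x * f x) := by
      ext1 x; simp only [Pi.sub_apply]; ring
    rw [e1, two_mul]
    refine (eLpNorm_sub_le (((hc.test _).memLp (ENNReal.ofReal p) _).sub hc.memLp).1
      (((hc.test _).memLp (ENNReal.ofReal p) _).sub hc.memLp).1 hq).trans ?_
    exact add_le_add (ha.1.trans hle) hb.1
  · rw [hθ.eLpNorm_grad_eq_restrict hΩ]
    have e1 : (fun x => gradient (fun y => η j y * (moll (κ (j + 1)) (Ω.indicator f) y -
        moll (κ j) (Ω.indicator f) y)) x) =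
        (fun x => gradient (fun y => η j y * moll (κ (j + 1)) (Ω.indicator f) y) x -
          (f x • gradient (η j) x + η j x • g x)) -
        (fun x => gradient (fun y => η j y * moll (κ j) (Ω.indicator f) y) x -
          (f x • gradient (η j) x + η j x • g x)) := by
      ext1 x
      simp only [Pi.sub_apply, mul_sub]
      rw [gradient_sub' ((hc.test _).differentiable x) ((hc.test _).differentiable x)]
      abel
    rw [e1, two_mul]
    refine (eLpNorm_sub_le (((hc.test _).memLp_grad (ENNReal.ofReal p) _).sub hc.memLp_grad).1
      (((hc.test _).memLp_grad (ENNReal.ofReal p) _).sub hc.memLp_grad).1 hq).trans ?_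
    exact add_le_add (ha.2.trans hle) hb.2

/-- Sobolev functions have quasicontinuous representatives: the pointwise limit of a fast
mollification is locally uniform off open sets of small capacity. -/
theorem IsSobolevPair.exists_isQuasicontRep (hΩ : IsOpen Ω) (hp : 1 < p) {f : Rn n → ℝ}
    {g : Rn n → Rn n} (hf : IsSobolevPair Ω p f g) : ∃ w, IsQuasicontRep Ω p f w := by
  have hp0 : 0 < p := by linarith
  obtain ⟨η, O, hη, -, hO, hOΩ, h1, hex⟩ := exists_cutoff_seq hΩ
  -- with errors `4⁻ʲ`, the differences scaled by `2 ^ j` still have summable norms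
  set e : ℕ → ℝ≥0∞ := fun j => 4⁻¹ ^ j with he
  have hepos : ∀ j, 0 < e j := fun j => ENNReal.pow_pos (by simp) j
  have hanti : Antitone e := fun i j hij => pow_le_pow_right_of_le_one' (by simp) hij
  obtain ⟨κ, hκ, hκn⟩ := hf.exists_fast_approx hΩ hp hη hepos hanti
  set ψ : ℕ → Rn n → ℝ := fun j => moll (κ j) (Ω.indicator f) with hψ
  have hψs : ∀ j, ContDiff ℝ ∞ (ψ j) := fun j => hf.contDiff_moll hΩ hp _
  set θ : ℕ → Rn n → ℝ := fun j x => 2 ^ j * (η j x * (ψ (j + 1) x - ψ j x)) with hθ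
  have hθ0 : ∀ j, IsTestFun univ (fun x => η j x * (ψ (j + 1) x - ψ j x)) := fun j =>
    ((hη j).mul_left ((hψs _).sub (hψs _))).mono (subset_univ _)
  have hθt : ∀ j, IsTestFun univ (θ j) := fun j => (hθ0 j).const_mul _
  set b : ℕ → ℝ≥0∞ := fun j => 2 * 2⁻¹ ^ j with hb
  have hscale : ∀ j, ‖(2 ^ j : ℝ)‖ₑ * (2 * e j) = b j := by
    intro j
    have h24 : (4⁻¹ : ℝ≥0∞) = 2⁻¹ * 2⁻¹ := by
      rw [← ENNReal.mul_inv (by simp) (by simp)]; norm_num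
    have h2 : ‖(2 ^ j : ℝ)‖ₑ = 2 ^ j := by
      rw [enorm_pow]
      congr 1
      rw [← ofReal_norm]; simp
    rw [h2, he, hb]
    simp only [h24, mul_pow]
    have h22 : (2 : ℝ≥0∞) ^ j * 2⁻¹ ^ j = 1 := by
      rw [← mul_pow, ENNReal.mul_inv_cancel (by simp) (by simp), one_pow]
    calc (2 : ℝ≥0∞) ^ j * (2 * (2⁻¹ ^ j * 2⁻¹ ^ j)) = (2 ^ j * 2⁻¹ ^ j) * (2 * 2⁻¹ ^ j) := by ring
      _ = _ := by rw [h22, one_mul]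
  have hbn : ∀ j, eLpNorm (θ j) (ENNReal.ofReal p) volume ≤ b j := fun j => by
    rw [← hscale j]
    calc eLpNorm (θ j) (ENNReal.ofReal p) volume = ‖(2 ^ j : ℝ)‖ₑ *
        eLpNorm (fun x => η j x * (ψ (j + 1) x - ψ j x)) (ENNReal.ofReal p) volume :=
          eLpNorm_const_smul (2 ^ j : ℝ) (fun x => η j x * (ψ (j + 1) x - ψ j x)) _ _
      _ ≤ _ := mul_le_mul' le_rfl (hκn j).1
  have hbg : ∀ j, eLpNorm (fun x => gradient (θ j) x) (ENNReal.ofReal p) volume ≤ b j := fun j => by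
    rw [← hscale j]
    have e1 : (fun x => gradient (θ j) x) =
        (2 ^ j : ℝ) • fun x => gradient (fun x => η j x * (ψ (j + 1) x - ψ j x)) x := by
      ext1 x
      exact gradient_const_mul' _ ((hθ0 j).differentiable x)
    rw [e1, eLpNorm_const_smul]
    exact mul_le_mul' le_rfl (hκn j).2
  have hbsum : ∑' j, b j ≠ ⊤ := by
    rw [hb, ENNReal.tsum_mul_left, ENNReal.tsum_geometric]
    refine ENNReal.mul_ne_top (by simp) (ENNReal.inv_ne_top.2 ?_)
    rw [ENNReal.one_sub_inv_two]
    simp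
  set V : ℕ → Set (Rn n) := fun m => ⋃ j, {x | 1 < |θ (j + m) x|} with hV
  have hVo : ∀ m, IsOpen (V m) := fun m => isOpen_iUnion fun j =>
    isOpen_lt continuous_const (hθt _).continuous.abs
  have htail : Tendsto (fun m => ∑' j, b (j + m)) atTop (𝓝 0) := ENNReal.tendsto_sum_nat_add b hbsum
  have hVcap : Tendsto (fun m => sobolevCap p (V m)) atTop (𝓝 0) := by
    have hle : ∀ m, sobolevCap p (V m) ≤ 2 * (ENNReal.ofReal 3 * ∑' j, b (j + m)) ^ p := by
      intro m
      rw [← ENNReal.tsum_mul_left]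
      refine sobolevCap_iUnion_le hp (fun j => hθt (j + m)) ?_ (fun j => hbn _) (fun j => hbg _)
      exact ne_top_of_le_ne_top hbsum (ENNReal.tsum_comp_le_tsum_of_injective
        (add_left_injective m) b)
    have l1 := ENNReal.Tendsto.const_mul (a := ENNReal.ofReal 3) htail
      (Or.inr ENNReal.ofReal_ne_top)
    rw [mul_zero] at l1
    have l2 := ((ENNReal.continuous_rpow_const (y := p)).tendsto 0).comp l1
    have l3 := ENNReal.Tendsto.const_mul (a := 2) l2 (Or.inr (by simp))
    rw [ENNReal.zero_rpow_of_pos hp0, mul_zero] at l3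
    exact tendsto_of_tendsto_of_tendsto_of_le_of_le tendsto_const_nhds l3 (fun _ => zero_le) hle
  -- where the sequence diverges `w` has a junk value; such points of `Ω` lie in every `V m`
  set w : Rn n → ℝ := fun x => limUnder atTop (fun j => ψ j x) with hw
  refine ⟨w, ?_, fun ε hε => ?_⟩
  · have hae := ae_tendsto_moll (hf.locallyIntegrable_indicator hΩ hp)
    filter_upwards [ae_restrict_of_ae hae, ae_restrict_mem hΩ.measurableSet] with x hx hxΩ
    rw [indicator_of_mem hxΩ] at hx
    exact (hx.comp (tendsto_atTop_mono hκ tendsto_id)).limUnder_eq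
  · obtain ⟨m, hm⟩ := (hVcap.eventually_lt_const hε).exists
    refine ⟨V m, hVo m, hm, fun x hx => ?_⟩
    obtain ⟨j₀, hj₀⟩ := hex x hx.1
    -- near `x` and off `V m`, consecutive members of the sequence differ by at most `2⁻ʲ`
    have hstep : ∀ y ∉ V m, (∀ i ≥ j₀, y ∈ O i) → ∀ j, j₀ ≤ j → m ≤ j →
        |ψ (j + 1) y - ψ j y| ≤ (2 ^ j)⁻¹ := by
      intro y hy hyO j hj hmj
      have : ¬ 1 < |θ j y| := fun h => hy (mem_iUnion.2 ⟨j - m, by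
        simpa [Nat.sub_add_cancel hmj] using h⟩)
      rw [not_lt] at this
      simp only [hθ, h1 j y (hyO j hj), one_mul, abs_mul, abs_pow, abs_two] at this
      rw [← one_div, le_div_iff₀ (by positivity), mul_comm]
      exact this
    have hbound : ∀ y ∉ V m, (∀ i ≥ j₀, y ∈ O i) → ∀ J, j₀ ≤ J → m ≤ J →
        dist (ψ J y) (w y) ≤ 2 * (2 ^ J)⁻¹ := by
      intro y hy hyO J hJ hmJ
      have hd : ∀ k, dist (ψ (J + k) y) (ψ (J + (k + 1)) y) ≤ 2 * (2 ^ J)⁻¹ / 2 / 2 ^ k := by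
        intro k
        rw [dist_comm, Real.dist_eq]
        refine (hstep y hy hyO (J + k) (by omega) (by omega)).trans (le_of_eq ?_)
        rw [pow_add]
        field_simp
      have hcs := cauchySeq_of_le_geometric_two hd
      obtain ⟨a, ha⟩ := cauchySeq_tendsto_of_complete hcs
      have ha' : Tendsto (fun j => ψ j y) atTop (𝓝 a) := by
        rw [← tendsto_add_atTop_iff_nat J]
        simpa only [add_comm] using ha
      have hwa : w y = a := ha'.limUnder_eq
      have := dist_le_of_le_geometric_two_of_tendsto₀ hd ha
      rw [hwa]
      simpa using this
    refine continuousWithinAt_of_locally_uniform_approx_of_continuousWithinAt hx fun u hu => ?_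
    obtain ⟨ε', hε', hε'u⟩ := Metric.mem_uniformity_dist.1 hu
    have hlim : Tendsto (fun J : ℕ => 2 * ((2 : ℝ) ^ J)⁻¹) atTop (𝓝 0) := by
      have := (tendsto_pow_atTop_nhds_zero_of_lt_one (r := (2 : ℝ)⁻¹) (by norm_num)
        (by norm_num)).const_mul 2
      simpa only [inv_pow, mul_zero] using this
    obtain ⟨J, hJlt, hJ⟩ := ((hlim.eventually_lt_const hε').and
      (eventually_ge_atTop (max j₀ m))).exists
    refine ⟨{y | ∀ i ≥ j₀, y ∈ O i} ∩ (Ω \ V m),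
      inter_mem (mem_nhdsWithin_of_mem_nhds hj₀) self_mem_nhdsWithin, ψ J,
      (hψs J).continuous.continuousWithinAt, fun y hy => hε'u ?_⟩
    rw [dist_comm]
    exact (hbound y hy.2.2 hy.1 J ((le_max_left _ _).trans hJ)
      ((le_max_right _ _).trans hJ)).trans_lt hJlt

lemma IsSobolevPair.isQuasicontRep (hΩ : IsOpen Ω) (hp : 1 < p) {f : Rn n → ℝ}
    {g : Rn n → Rn n} (hf : IsSobolevPair Ω p f g) :
    IsQuasicontRep Ω p f (quasicontRep Ω p f) := by
  have h := hf.exists_isQuasicontRep hΩ hp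
  rw [quasicontRep, dif_pos h]
  exact h.choose_spec

end QuasicontinuousRepresentative

/-! ### Existence of the measure `-div σ` -/

section Riesz

variable {n : ℕ} {Ω : Set (Rn n)} {p : ℝ} {σ : Rn n → Rn n}

open scoped CompactlySupported

/-- Extension by zero of a function on `Ω`. -/
noncomputable def zeroExt (f : Ω → ℝ) : Rn n → ℝ := Function.extend Subtype.val f 0

lemma zeroExt_coe (f : Ω → ℝ) (x : Ω) : zeroExt f x = f x :=
  Subtype.val_injective.extend_apply f 0 x

lemma zeroExt_of_notMem (f : Ω → ℝ) {x : Rn n} (hx : x ∉ Ω) : zeroExt f x = 0 :=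
  Function.extend_apply' f (0 : Rn n → ℝ) x (by rintro ⟨a, rfl⟩; exact hx a.2)

lemma zeroExt_restrict {φ : Rn n → ℝ} (hφ : IsTestFun Ω φ) : zeroExt (fun x : Ω => φ x) = φ := by
  ext1 x
  by_cases hx : x ∈ Ω
  · exact zeroExt_coe _ ⟨x, hx⟩
  · rw [zeroExt_of_notMem _ hx, hφ.zero_of_notMem hx]

lemma zeroExt_add (f g : Ω → ℝ) : zeroExt (f + g) = fun x => zeroExt f x + zeroExt g x := by
  ext1 x
  by_cases hx : x ∈ Ω
  · rw [show x = ((⟨x, hx⟩ : Ω) : Rn n) from rfl, zeroExt_coe, zeroExt_coe, zeroExt_coe]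
    rfl
  · simp [zeroExt_of_notMem _ hx]

lemma zeroExt_smul (c : ℝ) (f : Ω → ℝ) : zeroExt (c • f) = fun x => c * zeroExt f x := by
  ext1 x
  by_cases hx : x ∈ Ω
  · rw [show x = ((⟨x, hx⟩ : Ω) : Rn n) from rfl, zeroExt_coe, zeroExt_coe]; simp
  · simp [zeroExt_of_notMem _ hx]

/-- A test function on `Ω` as a compactly supported continuous function on the subtype `Ω`. -/
noncomputable def IsTestFun.toCc {φ : Rn n → ℝ} (hφ : IsTestFun Ω φ) : C_c(Ω, ℝ) where
  toFun := fun x => φ x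
  continuous_toFun := hφ.continuous.comp continuous_subtype_val
  hasCompactSupport' := by
    have hc : IsCompact (Subtype.val ⁻¹' tsupport φ : Set Ω) :=
      (Topology.IsInducing.subtypeVal.isCompact_preimage_iff (by simpa using hφ.subset)).2 hφ.compact
    exact HasCompactSupport.of_support_subset_isCompact hc fun x hx => subset_tsupport φ hx

/-- The functional `-div σ` on the smooth functions in `C_c(Ω)`. -/
noncomputable def negDivFunctional (hp : 1 < p) (hσ : σ ∈ fieldClass Ω p) :
    C_c(Ω, ℝ) →ₗ.[ℝ] ℝ where
  domain :=
    { carrier := {f | IsTestFun Ω (zeroExt f)}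
      add_mem' := fun {a b} ha hb => by
        simp only [mem_ofPred_eq, CompactlySupportedContinuousMap.coe_add, zeroExt_add]
        exact IsTestFun.add ha hb
      zero_mem' := by
        have : zeroExt (⇑(0 : C_c(Ω, ℝ))) = fun _ => 0 := by
          ext1 x
          by_cases hx : x ∈ Ω
          · exact (zeroExt_coe _ ⟨x, hx⟩).trans rfl
          · exact zeroExt_of_notMem _ hx
        simp only [mem_ofPred_eq, this]
        exact IsTestFun.zero
      smul_mem' := fun c f hf => by
        simp only [mem_ofPred_eq, CompactlySupportedContinuousMap.coe_smul, zeroExt_smul]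
        exact IsTestFun.const_mul hf c }
  toFun :=
    { toFun := fun f => ∫ x in Ω, inner ℝ (σ x) (gradient (zeroExt f.1) x)
      map_add' := fun f g => by
        have hf : IsTestFun Ω (zeroExt f.1) := f.2
        have hg : IsTestFun Ω (zeroExt g.1) := g.2
        rw [← integral_add (integrable_inner_of_memLp hp hσ.1 (hf.memLp_grad _ _))
          (integrable_inner_of_memLp hp hσ.1 (hg.memLp_grad _ _))]
        refine integral_congr_ae (Eventually.of_forall fun x => ?_)
        simp only [Submodule.coe_add, CompactlySupportedContinuousMap.coe_add, zeroExt_add]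
        rw [gradient_add' (hf.differentiable x) (hg.differentiable x), inner_add_right]
      map_smul' := fun c f => by
        have hf : IsTestFun Ω (zeroExt f.1) := f.2
        rw [RingHom.id_apply, smul_eq_mul, ← integral_const_mul]
        refine integral_congr_ae (Eventually.of_forall fun x => ?_)
        simp only [Submodule.coe_smul, CompactlySupportedContinuousMap.coe_smul, zeroExt_smul]
        rw [gradient_const_mul' _ (hf.differentiable x), inner_smul_right] }

/-- The cone of non-negative functions in `C_c(X)`. -/
def nonnegCone (X : Type*) [TopologicalSpace X] : PointedCone ℝ C_c(X, ℝ) where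
  carrier := {f | ∀ x, 0 ≤ f x}
  add_mem' := fun ha hb x => add_nonneg (ha x) (hb x)
  zero_mem' := fun _ => le_rfl
  smul_mem' := fun c _ hf x => mul_nonneg c.2 (hf x)

/-- A field with non-positive divergence has a measure as its negative divergence: the functional is
extended from smooth to continuous functions by the extension theorem of M. Riesz and represented
by the theorem of Riesz, Markov and Kakutani. -/
theorem exists_isNegDivMeasure (hΩ : IsOpen Ω) (hp : 1 < p) (hσ : σ ∈ fieldClass Ω p) :
    ∃ μ, IsNegDivMeasure Ω σ μ := by
  have : LocallyCompactSpace Ω := hΩ.locallyCompactSpace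
  have hext : ∃ Λ : C_c(Ω, ℝ) →ₗ[ℝ] ℝ, (∀ f : (negDivFunctional hp hσ).domain,
      Λ f = negDivFunctional hp hσ f) ∧ ∀ f ∈ nonnegCone Ω, 0 ≤ Λ f := by
    refine riesz_extension (nonnegCone Ω) (negDivFunctional hp hσ) ?_ ?_
    · intro f hf
      refine hσ.2 _ f.2 fun x => ?_
      by_cases hx : x ∈ Ω
      · exact (hf ⟨x, hx⟩).trans_eq (zeroExt_coe _ ⟨x, hx⟩).symm
      · rw [zeroExt_of_notMem _ hx]
    -- every `y` is dominated by a multiple of a smooth cutoff function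
    · intro y
      obtain ⟨M, hM⟩ := y.hasCompactSupport.exists_bound_of_continuous y.continuous
      obtain ⟨η, hη, h01, O, -, hKO, -, h1⟩ := exists_isTestFun_cutoff hΩ
        (y.hasCompactSupport.isCompact.image continuous_subtype_val)
        (by simp : Subtype.val '' tsupport y ⊆ Ω)
      have ht := hη.const_mul M
      have h2 : IsTestFun Ω (zeroExt (⇑ht.toCc)) := by
        have : zeroExt (⇑ht.toCc) = fun x => M * η x := zeroExt_restrict ht
        rwa [this]
      refine ⟨⟨ht.toCc, h2⟩, fun x => ?_⟩
      have hval : ((ht.toCc : C_c(Ω, ℝ)) + y) x = M * η x + y x := rfl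
      rw [hval]
      by_cases hx : x ∈ tsupport y
      · rw [h1 x (hKO ⟨x, hx, rfl⟩), mul_one]
        linarith [neg_le_of_abs_le (hM x)]
      · rw [image_eq_zero_of_notMem_tsupport hx, add_zero]
        exact mul_nonneg ((norm_nonneg _).trans (hM x)) (h01 x).1
  obtain ⟨Λ, hΛ, hΛ0⟩ := hext
  let T : C_c(Ω, ℝ) →ₚ[ℝ] ℝ := PositiveLinearMap.mk₀ Λ fun f hf => hΛ0 f fun x => hf x
  set μ₀ := RealRMK.rieszMeasure T with hμ₀
  have hemb : MeasurableEmbedding (Subtype.val : Ω → Rn n) :=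
    MeasurableEmbedding.subtype_coe hΩ.measurableSet
  refine ⟨μ₀.map Subtype.val, ?_, fun K hK hKΩ => ?_, fun φ hφ => ?_⟩
  · rw [hemb.map_apply]
    simp
  · rw [hemb.map_apply]
    have hc : IsCompact (Subtype.val ⁻¹' K : Set Ω) :=
      (Topology.IsInducing.subtypeVal.isCompact_preimage_iff (by simpa using hKΩ)).2 hK
    exact hc.measure_lt_top
  · rw [hemb.integral_map]
    have h1 := RealRMK.integral_rieszMeasure T hφ.toCc
    have h2 : IsTestFun Ω (zeroExt (⇑hφ.toCc)) := by
      have : zeroExt (⇑hφ.toCc) = φ := zeroExt_restrict hφ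
      rwa [this]
    have h3 := hΛ ⟨hφ.toCc, h2⟩
    calc ∫ x, φ x ∂μ₀ = T hφ.toCc := h1
      _ = Λ hφ.toCc := rfl
      _ = ∫ x in Ω, inner ℝ (σ x) (gradient (zeroExt (⇑hφ.toCc)) x) := h3
      _ = _ := by
        have : zeroExt (⇑hφ.toCc) = φ := zeroExt_restrict hφ
        rw [this]

lemma isNegDivMeasure_negDiv (hΩ : IsOpen Ω) (hp : 1 < p) (hσ : σ ∈ fieldClass Ω p) :
    IsNegDivMeasure Ω σ (negDiv Ω σ) := by
  have h := exists_isNegDivMeasure hΩ hp hσ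
  rw [negDiv, dif_pos h]
  exact h.choose_spec

end Riesz

/-! ### Order relations and the contact set -/

section Ordering

variable {n : ℕ} {Ω : Set (Rn n)} {p : ℝ} {σ : Rn n → Rn n} {μ : Measure (Rn n)}

/-- A function with non-negative integrals against non-negative test functions is non-negative
almost everywhere. -/
lemma ae_nonneg_of_forall_isTestFun {O : Set (Rn n)} (hO : IsOpen O) {ν : Measure (Rn n)}
    [IsFiniteMeasure ν] {D : Rn n → ℝ} (hD : Integrable D ν)
    (h : ∀ ζ : Rn n → ℝ, IsTestFun O ζ → (∀ x, 0 ≤ ζ x) → 0 ≤ ∫ x, ζ x * D x ∂ν) :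
    ∀ᵐ x ∂ν, x ∈ O → 0 ≤ D x := by
  obtain ⟨D', hD', hDD'⟩ := hD.1
  have hDi' : Integrable D' ν := hD.congr hDD'
  -- the integral over a compact set is the limit of integrals against smooth cutoffs
  have hcomp : ∀ K, IsCompact K → K ⊆ O → 0 ≤ ∫ x in K, D' x ∂ν := by
    intro K hK hKO
    have hcut : ∀ i : ℕ, ∃ ζ : Rn n → ℝ, IsTestFun (Metric.thickening (1 / ((i : ℝ) + 1)) K ∩ O) ζ ∧
        (∀ x, 0 ≤ ζ x ∧ ζ x ≤ 1) ∧ ∃ U, IsOpen U ∧ K ⊆ U ∧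
          U ⊆ (Metric.thickening (1 / ((i : ℝ) + 1)) K ∩ O) ∧ ∀ x ∈ U, ζ x = 1 := fun i =>
      exists_isTestFun_cutoff (Metric.isOpen_thickening.inter hO) hK
        (subset_inter (Metric.self_subset_thickening (by positivity) K) hKO)
    choose ζ hζ h01 U hU hKU hUs h1 using hcut
    have hlim : Tendsto (fun i => ∫ x, ζ i x * D' x ∂ν) atTop (𝓝 (∫ x, K.indicator D' x ∂ν)) := by
      refine tendsto_integral_of_dominated_convergence (fun x => ‖D' x‖)
        (fun i => (hζ i).continuous.aestronglyMeasurable.mul hDi'.1) hDi'.norm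
        (fun i => Eventually.of_forall fun x => ?_) (Eventually.of_forall fun x => ?_)
      · rw [norm_mul]
        refine mul_le_of_le_one_left (norm_nonneg _) ?_
        rw [Real.norm_eq_abs, abs_of_nonneg (h01 i x).1]
        exact (h01 i x).2
      · by_cases hx : x ∈ K
        · rw [indicator_of_mem hx]
          refine tendsto_const_nhds.congr fun i => ?_
          rw [h1 i x (hKU i hx), one_mul]
        · rw [indicator_of_notMem hx]
          refine tendsto_const_nhds.congr' ?_
          have hpos : 0 < Metric.infEDist x K := by
            rw [pos_iff_ne_zero, Ne, ← Metric.mem_closure_iff_infEDist_zero,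
              hK.isClosed.closure_eq]
            exact hx
          have ht : Tendsto (fun i : ℕ => ENNReal.ofReal (1 / ((i : ℝ) + 1))) atTop (𝓝 0) := by
            have := (ENNReal.continuous_ofReal.tendsto 0).comp
              (tendsto_one_div_add_atTop_nhds_zero_nat (𝕜 := ℝ))
            simpa [Function.comp_def] using this
          filter_upwards [ht.eventually_lt_const hpos] with i hi
          have hn : x ∉ Metric.thickening (1 / ((i : ℝ) + 1)) K ∩ O := by
            rintro ⟨hx1, -⟩
            rw [Metric.mem_thickening_iff_infEDist_lt] at hx1
            exact lt_asymm hi hx1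
          rw [(hζ i).zero_of_notMem hn, zero_mul]
    rw [integral_indicator hK.measurableSet] at hlim
    refine ge_of_tendsto' hlim fun i => ?_
    have := h (ζ i) ((hζ i).mono inter_subset_right) (fun x => (h01 i x).1)
    refine this.trans_eq (integral_congr_ae ?_)
    filter_upwards [hDD'] with x hx
    rw [hx]
  have hA : MeasurableSet ({x | D' x < 0} ∩ O) :=
    (measurableSet_lt hD'.measurable measurable_const).inter hO.measurableSet
  have hzero : ν ({x | D' x < 0} ∩ O) = 0 := by
    by_contra hne
    obtain ⟨K, hKA, hK, hKpos⟩ := hA.exists_lt_isCompact (pos_iff_ne_zero.2 hne)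
    have h0 := hcomp K hK (hKA.trans inter_subset_right)
    have hneg : 0 < ∫ x in K, -D' x ∂ν := by
      rw [setIntegral_pos_iff_support_of_nonneg_ae]
      · have : Function.support (fun x => -D' x) ∩ K = K := by
          apply inter_eq_right.2
          intro x hx
          have : D' x < 0 := (hKA hx).1
          simp [this.ne]
        rwa [this]
      · filter_upwards [ae_restrict_mem hK.measurableSet] with x hx
        have : D' x < 0 := (hKA hx).1
        simp only [Pi.zero_apply]
        linarith
      · exact hDi'.neg.integrableOn
    rw [integral_neg] at hneg
    linarith
  filter_upwards [hDD', measure_eq_zero_iff_ae_notMem.1 hzero] with x hx hxn hxO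
  rw [hx]
  by_contra hlt
  exact hxn ⟨not_le.1 hlt, hxO⟩

namespace IsNegDivMeasure

/-- `∫ ⟨σ, D(η f)⟩ ≥ 0` for non-negative Sobolev functions `f` and test functions `η`. -/
lemma integral_inner_nonneg (hΩ : IsOpen Ω) (hp : 1 < p) (hσ : σ ∈ fieldClass Ω p)
    {f : Rn n → ℝ} {g : Rn n → Rn n} (hf : IsSobolevPair Ω p f g)
    (h0 : ∀ᵐ x ∂(volume.restrict Ω), 0 ≤ f x) {η : Rn n → ℝ} (hη : IsTestFun Ω η)
    (hη0 : ∀ x, 0 ≤ η x) :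
    0 ≤ ∫ x in Ω, inner ℝ (σ x) (f x • gradient η x + η x • g x) := by
  have hc := hf.sobolevTendsto_mul hΩ hp hη
  refine ge_of_tendsto' (tendsto_integral_inner hp hσ.1 hc.memLp_grad
    (fun k => (hc.test k).memLp_grad _ _) hc.tendsto_grad) fun k => hσ.2 _ (hc.test k) fun x => ?_
  refine mul_nonneg (hη0 x) (le_moll k (hf.locallyIntegrable_indicator hΩ hp) MeasurableSet.univ
    ?_ (subset_univ _))
  rw [Measure.restrict_univ]
  rw [ae_restrict_iff' hΩ.measurableSet] at h0
  filter_upwards [h0] with y hy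
  by_cases hyΩ : y ∈ Ω
  · rw [indicator_of_mem hyΩ]; exact hy hyΩ
  · rw [indicator_of_notMem hyΩ]

/-- The order of Sobolev functions passes to their quasicontinuous representatives, almost
everywhere with respect to `-div σ`. -/
lemma ae_le (hΩ : IsOpen Ω) (hp : 1 < p) (hσ : σ ∈ fieldClass Ω p) (hμ : IsNegDivMeasure Ω σ μ)
    {f f' w w' : Rn n → ℝ} {g h : Rn n → Rn n} (hf : IsSobolevPair Ω p f g)
    (hf' : IsQuasicontRep Ω p f f') (hw : IsSobolevPair Ω p w h) (hw' : IsQuasicontRep Ω p w w')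
    (hle : ∀ᵐ x ∂(volume.restrict Ω), f x ≤ w x) : ∀ᵐ x ∂μ, f' x ≤ w' x := by
  obtain ⟨η, O, hη, h01, hO, hOΩ, h1, hex⟩ := exists_cutoff_seq hΩ
  have hj : ∀ j, ∀ᵐ x ∂μ, x ∈ O j → f' x ≤ w' x := by
    intro j
    have hOs : O j ⊆ tsupport (η j) := fun x hx =>
      subset_tsupport _ (by simp [h1 j x hx])
    have hfin : IsFiniteMeasure (μ.restrict (O j)) := ⟨by
      rw [Measure.restrict_apply_univ]
      exact (measure_mono hOs).trans_lt (hμ.finite _ (hη j).compact (hη j).subset)⟩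
    have hDi : Integrable (fun x => η j x * w' x - η j x * f' x) (μ.restrict (O j)) :=
      ((hμ.integral_mul_quasicontRep hΩ hp hσ hw hw' (hη j)).1.sub
        (hμ.integral_mul_quasicontRep hΩ hp hσ hf hf' (hη j)).1).mono_measure
        Measure.restrict_le_self
    have key := ae_nonneg_of_forall_isTestFun (hO j) hDi fun ζ hζ hζ0 => by
      have hζΩ := hζ.mono (hOΩ j)
      have iw := hμ.integral_mul_quasicontRep hΩ hp hσ hw hw' hζΩ
      have if' := hμ.integral_mul_quasicontRep hΩ hp hσ hf hf' hζΩ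
      have e1 : ∫ x in O j, ζ x * (η j x * w' x - η j x * f' x) ∂μ =
          ∫ x, (ζ x * w' x - ζ x * f' x) ∂μ := by
        have e2 : ∫ x in O j, (ζ x * w' x - ζ x * f' x) ∂μ = ∫ x, (ζ x * w' x - ζ x * f' x) ∂μ :=
          setIntegral_eq_integral_of_forall_compl_eq_zero fun x hx => by
            simp [hζ.zero_of_notMem hx]
        rw [← e2]
        refine setIntegral_congr_fun (hO j).measurableSet fun x hx => ?_
        simp only [h1 j x hx]
        ring
      rw [e1, integral_sub iw.1 if'.1, iw.2, if'.2, ← integral_sub]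
      · have := integral_inner_nonneg hΩ hp hσ (hw.sub hΩ hf)
          (by filter_upwards [hle] with x hx; linarith) hζΩ hζ0
        refine this.trans_eq (integral_congr_ae (Eventually.of_forall fun x => ?_))
        simp only
        rw [← inner_sub_right, sub_smul, smul_sub]
        congr 1
        abel
      · exact integrable_inner_of_memLp hp hσ.1 (hw.sobolevTendsto_mul hΩ hp hζΩ).memLp_grad
      · exact integrable_inner_of_memLp hp hσ.1 (hf.sobolevTendsto_mul hΩ hp hζΩ).memLp_grad
    rw [ae_restrict_iff' (hO j).measurableSet] at key
    filter_upwards [key] with x hx hxO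
    have := hx hxO hxO
    rw [h1 j x hxO, one_mul, one_mul] at this
    linarith
  filter_upwards [ae_all_iff.2 hj, hμ.ae_mem] with x hx hxΩ
  obtain ⟨j, hj⟩ := hex x hxΩ
  exact hx j (hj.self_of_nhds j le_rfl)

/-- If moving `w` towards `f ≤ w` does not decrease the pairing with `σ`, then `f` and `w` coincide
almost everywhere with respect to `-div σ`. -/
lemma ae_eq_of_forall_le (hΩ : IsOpen Ω) (hp : 1 < p) (hσ : σ ∈ fieldClass Ω p)
    (hμ : IsNegDivMeasure Ω σ μ)
    {f f' w w' : Rn n → ℝ} {g h : Rn n → Rn n} (hf : IsSobolevPair Ω p f g)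
    (hf' : IsQuasicontRep Ω p f f') (hw : IsSobolevPair Ω p w h) (hw' : IsQuasicontRep Ω p w w')
    (hle : ∀ᵐ x ∂(volume.restrict Ω), f x ≤ w x)
    (hvar : ∀ η, IsTestFun Ω η → (∀ x, 0 ≤ η x ∧ η x ≤ 1) →
      ∫ x in Ω, inner ℝ (σ x) ((w x - f x) • gradient η x + η x • (h x - g x)) ≤ 0) :
    f' =ᵐ[μ] w' := by
  obtain ⟨η, O, hη, h01, hO, hOΩ, h1, hex⟩ := exists_cutoff_seq hΩ
  have hae := hμ.ae_le hΩ hp hσ hf hf' hw hw' hle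
  have hj : ∀ j, ∀ᵐ x ∂μ, η j x * w' x - η j x * f' x = 0 := by
    intro j
    have iw := hμ.integral_mul_quasicontRep hΩ hp hσ hw hw' (hη j)
    have if' := hμ.integral_mul_quasicontRep hΩ hp hσ hf hf' (hη j)
    have h0 : 0 ≤ᵐ[μ] fun x => η j x * w' x - η j x * f' x := by
      filter_upwards [hae] with x hx
      have := mul_le_mul_of_nonneg_left hx (h01 j x).1
      simp only [Pi.zero_apply]
      linarith
    have hint : ∫ x, (η j x * w' x - η j x * f' x) ∂μ = 0 := by
      refine le_antisymm ?_ (integral_nonneg_of_ae h0)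
      rw [integral_sub iw.1 if'.1, iw.2, if'.2, ← integral_sub]
      · refine le_trans (le_of_eq (integral_congr_ae (Eventually.of_forall fun x => ?_)))
          (hvar (η j) (hη j) (h01 j))
        simp only
        rw [← inner_sub_right, sub_smul, smul_sub]
        congr 1
        abel
      · exact integrable_inner_of_memLp hp hσ.1 (hw.sobolevTendsto_mul hΩ hp (hη j)).memLp_grad
      · exact integrable_inner_of_memLp hp hσ.1 (hf.sobolevTendsto_mul hΩ hp (hη j)).memLp_grad
    exact (integral_eq_zero_iff_of_nonneg_ae h0 (iw.1.sub if'.1)).1 hint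
  filter_upwards [ae_all_iff.2 hj, hμ.ae_mem] with x hx hxΩ
  obtain ⟨j, hj⟩ := hex x hxΩ
  have := hx j
  rw [h1 j x (hj.self_of_nhds j le_rfl)] at this
  linarith

end IsNegDivMeasure

end Ordering

/-! ### Extended integrals -/

section ExtIntegral

variable {n : ℕ} {μ : Measure (Rn n)} {v w : Rn n → ℝ}

lemma extIntegral_mono (h : ∀ᵐ x ∂μ, v x ≤ w x) : extIntegral μ v ≤ extIntegral μ w := by
  refine EReal.sub_le_sub ?_ ?_
  · exact EReal.coe_ennreal_le_coe_ennreal_iff.2 (lintegral_mono_ae (by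
      filter_upwards [h] with x hx using ENNReal.ofReal_le_ofReal hx))
  · exact EReal.coe_ennreal_le_coe_ennreal_iff.2 (lintegral_mono_ae (by
      filter_upwards [h] with x hx using ENNReal.ofReal_le_ofReal (neg_le_neg hx)))

lemma extIntegral_eq_integral (h : Integrable w μ) :
    extIntegral μ w = ((∫ x, w x ∂μ : ℝ) : EReal) := by
  have hfin : ∀ v : Rn n → ℝ, Integrable v μ → ∫⁻ x, ENNReal.ofReal (v x) ∂μ ≠ ⊤ := fun v hv =>
    ne_top_of_le_ne_top hv.2.ne (lintegral_mono fun x => Real.ofReal_le_enorm _)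
  rw [integral_eq_lintegral_pos_part_sub_lintegral_neg_part h, extIntegral, EReal.coe_sub]
  congr 1
  · exact (EReal.coe_ennreal_toReal (hfin w h)).symm
  · exact (EReal.coe_ennreal_toReal (hfin _ h.neg)).symm

end ExtIntegral

/-! ### The Poincaré inequality -/

section Poincare

variable {n : ℕ} {Ω : Set (Rn n)} {p : ℝ}

/-- The Poincaré inequality for test functions: the Gagliardo–Nirenberg–Sobolev inequality for
exponent `1`, applied to `|φ|^p`, followed by Hölder's inequality. -/
lemma exists_poincare_isTestFun (hn : 2 ≤ n) (hΩb : Bornology.IsBounded Ω) (hp : 1 < p) :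
    ∃ C : ℝ≥0∞, C ≠ ⊤ ∧ ∀ φ : Rn n → ℝ, IsTestFun Ω φ →
      eLpNorm φ (ENNReal.ofReal p) (volume.restrict Ω) ≤
        C * eLpNorm (fun x => gradient φ x) (ENNReal.ofReal p) (volume.restrict Ω) := by
  set K : ℝ≥0∞ := ↑(eLpNormLESNormFDerivOfLeConst ℝ (volume : Measure (Rn n)) Ω 1 1) with hK
  refine ⟨K * ENNReal.ofReal p, ENNReal.mul_ne_top ENNReal.coe_ne_top ENNReal.ofReal_ne_top,
    fun φ hφ => ?_⟩
  have hp0 : 0 < p := zero_lt_one.trans hp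
  have hsup : Function.support φ ⊆ Ω := (subset_tsupport φ).trans hφ.subset
  have hsupg : Function.support (fun x => gradient φ x) ⊆ Ω := fun x hx => by
    by_contra h
    exact hx (hφ.grad_zero_of_notMem h)
  rw [eLpNorm_restrict_eq_of_support_subset hsup, eLpNorm_restrict_eq_of_support_subset hsupg]
  have hq0 : ENNReal.ofReal p ≠ 0 := by simpa using hp0
  have hqt : ENNReal.ofReal p ≠ ⊤ := ENNReal.ofReal_ne_top
  have hqr : (ENNReal.ofReal p).toReal = p := ENNReal.toReal_ofReal hp0.le
  have hdiff : Differentiable ℝ φ := hφ.differentiable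
  have hfg : ∀ x, ‖fderiv ℝ φ x‖ = ‖gradient φ x‖ := fun x => (norm_gradient φ x).symm
  -- the exponent-one inequality for `|φ|^p`
  have h1 := eLpNorm_le_eLpNorm_fderiv (F := ℝ) (volume : Measure (Rn n))
    (u := fun x => ‖φ x‖ ^ p) (s := Ω) (p := 1)
    ((contDiff_norm_rpow hp).comp hφ.contDiff_one)
    (fun x hx => by
      by_contra h
      exact hx (by simp [hφ.zero_of_notMem h, Real.zero_rpow hp0.ne']))
    le_rfl (by simp; omega) hΩb
  simp only [ENNReal.coe_one, eLpNorm_one_eq_lintegral_enorm] at h1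
  have e1 : ∀ x, ‖‖φ x‖ ^ p‖ₑ = ‖φ x‖ₑ ^ p := fun x => by
    rw [← ofReal_norm (φ x), ENNReal.ofReal_rpow_of_nonneg (norm_nonneg _) hp0.le,
      Real.enorm_of_nonneg (by positivity)]
  have e2 : ∀ x, ‖fderiv ℝ (fun x => ‖φ x‖ ^ p) x‖ₑ ≤
      ENNReal.ofReal p * (‖gradient φ x‖ₑ * ‖φ x‖ₑ ^ (p - 1)) := fun x => by
    have := norm_fderiv_norm_rpow_le hdiff (x := x) hp
    rw [hfg] at this
    rw [← ofReal_norm (φ x), ← ofReal_norm (gradient φ x),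
      ENNReal.ofReal_rpow_of_nonneg (norm_nonneg _) (by linarith), ← ofReal_norm,
      ← ENNReal.ofReal_mul (norm_nonneg _), ← ENNReal.ofReal_mul hp0.le]
    refine ENNReal.ofReal_le_ofReal (this.trans_eq (by ring))
  simp only [e1] at h1
  set N := eLpNorm φ (ENNReal.ofReal p) volume with hN
  set D := eLpNorm (fun x => gradient φ x) (ENNReal.ofReal p) volume with hD
  have hNp : ∫⁻ x, ‖φ x‖ₑ ^ p = N ^ p := by
    rw [hN, eLpNorm_eq_lintegral_rpow_enorm_toReal hq0 hqt, hqr, ← ENNReal.rpow_mul,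
      one_div_mul_cancel hp0.ne', ENNReal.rpow_one]
  have hDp : (∫⁻ x, ‖gradient φ x‖ₑ ^ p) ^ (1 / p) = D := by
    rw [hD, eLpNorm_eq_lintegral_rpow_enorm_toReal hq0 hqt, hqr]
  have hconj := Real.HolderConjugate.conjExponent hp
  have hH := ENNReal.lintegral_mul_le_Lp_mul_Lq (volume : Measure (Rn n)) hconj
    (f := fun x => ‖gradient φ x‖ₑ) (g := fun x => ‖φ x‖ₑ ^ (p - 1))
    hφ.continuous_grad.aestronglyMeasurable.enorm
    (hφ.continuous.aestronglyMeasurable.enorm.pow_const _)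
  have e3 : ∀ x, (‖φ x‖ₑ ^ (p - 1)) ^ p.conjExponent = ‖φ x‖ₑ ^ p := fun x => by
    rw [← ENNReal.rpow_mul, hconj.sub_one_mul_conj]
  simp only [Pi.mul_apply, e3, hNp, hDp] at hH
  have e4 : (N ^ p) ^ (1 / p.conjExponent) = N ^ (p - 1) := by
    rw [← ENNReal.rpow_mul]
    congr 1
    rw [Real.conjExponent]
    have : p - 1 ≠ 0 := by linarith
    field_simp
  rw [e4] at hH
  have key : N ^ p ≤ K * ENNReal.ofReal p * D * N ^ (p - 1) := by
    calc N ^ p = ∫⁻ x, ‖φ x‖ₑ ^ p := hNp.symm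
      _ ≤ K * ∫⁻ x, ‖fderiv ℝ (fun x => ‖φ x‖ ^ p) x‖ₑ := h1
      _ ≤ K * ∫⁻ x, ENNReal.ofReal p * (‖gradient φ x‖ₑ * ‖φ x‖ₑ ^ (p - 1)) := by
          gcongr with x; exact e2 x
      _ = K * (ENNReal.ofReal p * ∫⁻ x, ‖gradient φ x‖ₑ * ‖φ x‖ₑ ^ (p - 1)) := by
          rw [lintegral_const_mul' _ _ hqt]
      _ ≤ K * (ENNReal.ofReal p * (D * N ^ (p - 1))) := by gcongr
      _ = _ := by ring
  have hNt : N ≠ ⊤ := (hφ.memLp (ENNReal.ofReal p) volume).2.ne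
  rcases eq_or_ne N 0 with h0 | h0
  · rw [h0]; exact zero_le
  have hN1 : N ^ (p - 1) ≠ 0 := by simp [ENNReal.rpow_eq_zero_iff, h0, hNt]
  have hN2 : N ^ (p - 1) ≠ ⊤ := ENNReal.rpow_ne_top_of_nonneg (by linarith) hNt
  refine (ENNReal.mul_le_mul_iff_left hN1 hN2).1 ?_
  calc N * N ^ (p - 1) = N ^ (1 + (p - 1)) := by
        rw [ENNReal.rpow_add _ _ h0 hNt, ENNReal.rpow_one]
    _ = N ^ p := by congr 1; ring
    _ ≤ _ := key

/-- The Poincaré inequality in `W^{1,p}_0`. -/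
lemma exists_poincare (hn : 2 ≤ n) (hΩb : Bornology.IsBounded Ω) (hp : 1 < p) :
    ∃ C : ℝ≥0∞, C ≠ ⊤ ∧ ∀ (φ : ℕ → Rn n → ℝ) (v : Rn n → ℝ) (g : Rn n → Rn n),
      SobolevTendsto Ω p φ v g → eLpNorm v (ENNReal.ofReal p) (volume.restrict Ω) ≤
        C * eLpNorm g (ENNReal.ofReal p) (volume.restrict Ω) := by
  obtain ⟨C, hC, h⟩ := exists_poincare_isTestFun hn hΩb hp
  refine ⟨C, hC, fun φ v g hv => ?_⟩
  have hq := one_le_ofReal hp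
  have hlim : Tendsto (fun k => eLpNorm (fun x => φ k x - v x) (ENNReal.ofReal p)
      (volume.restrict Ω) + C * (eLpNorm (fun x => gradient (φ k) x - g x) (ENNReal.ofReal p)
      (volume.restrict Ω) + eLpNorm g (ENNReal.ofReal p) (volume.restrict Ω))) atTop
      (𝓝 (0 + C * (0 + eLpNorm g (ENNReal.ofReal p) (volume.restrict Ω)))) :=
    hv.tendsto.add (ENNReal.Tendsto.const_mul (hv.tendsto_grad.add tendsto_const_nhds)
      (Or.inr hC))
  rw [zero_add, zero_add] at hlim
  refine ge_of_tendsto' hlim fun k => ?_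
  have hk := h _ (hv.test k)
  have m1 := (hv.test k).memLp (ENNReal.ofReal p) (volume.restrict Ω)
  have m2 := (hv.test k).memLp_grad (ENNReal.ofReal p) (volume.restrict Ω)
  calc eLpNorm v (ENNReal.ofReal p) (volume.restrict Ω)
      = eLpNorm (φ k - fun x => φ k x - v x) (ENNReal.ofReal p) (volume.restrict Ω) := by
        congr 1; ext x; simp
    _ ≤ eLpNorm (φ k) (ENNReal.ofReal p) (volume.restrict Ω) +
        eLpNorm (fun x => φ k x - v x) (ENNReal.ofReal p) (volume.restrict Ω) :=
        eLpNorm_sub_le m1.1 (m1.sub hv.memLp).1 hq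
    _ ≤ C * eLpNorm ((fun x => gradient (φ k) x - g x) + g) (ENNReal.ofReal p)
        (volume.restrict Ω) +
        eLpNorm (fun x => φ k x - v x) (ENNReal.ofReal p) (volume.restrict Ω) := by
        refine add_le_add (hk.trans_eq ?_) le_rfl
        congr 2; ext1 x; simp
    _ ≤ C * (eLpNorm (fun x => gradient (φ k) x - g x) (ENNReal.ofReal p) (volume.restrict Ω) +
        eLpNorm g (ENNReal.ofReal p) (volume.restrict Ω)) +
        eLpNorm (fun x => φ k x - v x) (ENNReal.ofReal p) (volume.restrict Ω) := by
        gcongr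
        exact eLpNorm_add_le (m2.sub hv.memLp_grad).1 hv.memLp_grad.1 hq
    _ = _ := add_comm _ _

end Poincare

/-! ### Uniform convexity of powers of the norm -/

section UniformConvexity

variable {E : Type*} [NormedAddCommGroup E] [NormedSpace ℝ E] {p : ℝ}

lemma two_mul_norm_half_add_rpow_le (hp : 1 < p) (a b : E) :
    2 * ‖(1 / 2 : ℝ) • (a + b)‖ ^ p ≤ ‖a‖ ^ p + ‖b‖ ^ p := by
  have hc := (strictConvexOn_rpow hp).convexOn.2 (mem_Ici.2 (norm_nonneg a))
    (mem_Ici.2 (norm_nonneg b)) (show (0 : ℝ) ≤ 1 / 2 by norm_num)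
    (show (0 : ℝ) ≤ 1 / 2 by norm_num) (by norm_num)
  have hn : ‖(1 / 2 : ℝ) • (a + b)‖ ≤ (1 / 2 : ℝ) • ‖a‖ + (1 / 2 : ℝ) • ‖b‖ := by
    rw [norm_smul, ← smul_add, smul_eq_mul]
    norm_num
    exact norm_add_le a b
  have := (Real.rpow_le_rpow (norm_nonneg _) hn (by linarith : 0 ≤ p)).trans hc
  simp only [smul_eq_mul] at this
  linarith

lemma two_mul_norm_half_add_rpow_lt [StrictConvexSpace ℝ E] (hp : 1 < p) {a b : E} (hab : a ≠ b) :
    2 * ‖(1 / 2 : ℝ) • (a + b)‖ ^ p < ‖a‖ ^ p + ‖b‖ ^ p := by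
  rcases eq_or_ne ‖a‖ ‖b‖ with h | h
  · have := Real.rpow_lt_rpow (norm_nonneg _) ((norm_midpoint_lt_iff h).2 hab)
      (by linarith : 0 < p)
    rw [← h]
    linarith
  · have hc := (strictConvexOn_rpow hp).2 (mem_Ici.2 (norm_nonneg a))
      (mem_Ici.2 (norm_nonneg b)) h (show (0 : ℝ) < 1 / 2 by norm_num)
      (show (0 : ℝ) < 1 / 2 by norm_num) (by norm_num)
    have hn : ‖(1 / 2 : ℝ) • (a + b)‖ ≤ (1 / 2 : ℝ) • ‖a‖ + (1 / 2 : ℝ) • ‖b‖ := by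
      rw [norm_smul, ← smul_add, smul_eq_mul]
      norm_num
      exact norm_add_le a b
    have := (Real.rpow_le_rpow (norm_nonneg _) hn (by linarith : 0 ≤ p)).trans_lt hc
    simp only [smul_eq_mul] at this
    linarith

/-- A quantitative form of the strict convexity of `‖·‖^p`, by compactness of the unit sphere of
`E × E` and homogeneity. -/
lemma exists_norm_sub_rpow_le [StrictConvexSpace ℝ E] [FiniteDimensional ℝ E] (hp : 1 < p) {ε : ℝ}
    (hε : 0 < ε) :
    ∃ C : ℝ, 0 ≤ C ∧ ∀ a b : E, ‖a - b‖ ^ p ≤ ε * (‖a‖ ^ p + ‖b‖ ^ p) +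
      C * (‖a‖ ^ p + ‖b‖ ^ p - 2 * ‖(1 / 2 : ℝ) • (a + b)‖ ^ p) := by
  have hp0 : 0 < p := zero_lt_one.trans hp
  set d : E × E → ℝ := fun z => ‖z.1 - z.2‖ ^ p with hd
  set s : E × E → ℝ := fun z => ‖z.1‖ ^ p + ‖z.2‖ ^ p with hs
  set h : E × E → ℝ := fun z =>
    ‖z.1‖ ^ p + ‖z.2‖ ^ p - 2 * ‖(1 / 2 : ℝ) • (z.1 + z.2)‖ ^ p with hh
  have hdc : Continuous d := (continuous_fst.sub continuous_snd).norm.rpow_const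
    fun _ => Or.inr hp0.le
  have hhc : Continuous h :=
    ((continuous_fst.norm.rpow_const fun _ => Or.inr hp0.le).add
      (continuous_snd.norm.rpow_const fun _ => Or.inr hp0.le)).sub
      (continuous_const.mul (((continuous_fst.add continuous_snd).const_smul _).norm.rpow_const
        fun _ => Or.inr hp0.le))
  have hh0 : ∀ z, 0 ≤ h z := fun z => sub_nonneg.2 (two_mul_norm_half_add_rpow_le hp _ _)
  set S : Set (E × E) := Metric.sphere 0 1 ∩ {z | ε ≤ d z} with hS
  have : ProperSpace E := FiniteDimensional.proper ℝ E
  have hSc : IsCompact S := (isCompact_sphere 0 1).inter_right (isClosed_le continuous_const hdc)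
  have hpos : ∀ z ∈ S, 0 < h z := fun z hz => by
    refine sub_pos.2 (two_mul_norm_half_add_rpow_lt hp fun hab => ?_)
    have : ε ≤ d z := hz.2
    simp [hd, hab, Real.zero_rpow hp0.ne'] at this
    linarith
  have hcont : ContinuousOn (fun z => d z / h z) S :=
    hdc.continuousOn.div hhc.continuousOn fun z hz => (hpos z hz).ne'
  obtain ⟨C, hC⟩ := (hSc.image_of_continuousOn hcont).bddAbove
  -- where `‖a - b‖ ^ p < ε` the first term suffices, as `‖a‖ ^ p + ‖b‖ ^ p ≥ 1` on the sphere
  have hsph : ∀ z ∈ Metric.sphere (0 : E × E) 1, d z ≤ ε * s z + max C 0 * h z := by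
    intro z hz
    have hs1 : 1 ≤ s z := by
      have hz1 : ‖z‖ = 1 := by simpa using hz
      rw [Prod.norm_def] at hz1
      rcases max_choice ‖z.1‖ ‖z.2‖ with hm | hm
      · rw [hm] at hz1
        have : 0 ≤ ‖z.2‖ ^ p := by positivity
        simp only [hs, hz1, Real.one_rpow]; linarith
      · rw [hm] at hz1
        have : 0 ≤ ‖z.1‖ ^ p := by positivity
        simp only [hs, hz1, Real.one_rpow]; linarith
    by_cases hzd : ε ≤ d z
    · have hzS : z ∈ S := ⟨hz, hzd⟩
      have h1 : d z / h z ≤ C := hC (mem_image_of_mem _ hzS)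
      rw [div_le_iff₀ (hpos z hzS)] at h1
      have h2 : C * h z ≤ max C 0 * h z := mul_le_mul_of_nonneg_right (le_max_left _ _) (hh0 z)
      have h3 : 0 ≤ ε * s z := by positivity
      linarith
    · have h2 : 0 ≤ max C 0 * h z := mul_nonneg (le_max_right _ _) (hh0 z)
      have h3 : ε * 1 ≤ ε * s z := by gcongr
      push Not at hzd
      linarith
  refine ⟨max C 0, le_max_right _ _, fun a b => ?_⟩
  rcases eq_or_ne ((a, b) : E × E) 0 with h0 | h0
  · obtain ⟨rfl, rfl⟩ := Prod.mk_eq_zero.1 h0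
    simp [Real.zero_rpow hp0.ne']
  have ht : 0 < ‖((a, b) : E × E)‖ := norm_pos_iff.2 h0
  set t := ‖((a, b) : E × E)‖ with htd
  have hz := hsph (t⁻¹ • (a, b)) (by
    rw [mem_sphere_zero_iff_norm, norm_smul, norm_inv, norm_norm, ← htd, inv_mul_cancel₀ ht.ne'])
  have hti : 0 < t⁻¹ := inv_pos.2 ht
  have e0 : ∀ x : E, ‖t⁻¹ • x‖ ^ p = t⁻¹ ^ p * ‖x‖ ^ p := fun x => by
    rw [norm_smul, Real.norm_of_nonneg hti.le, Real.mul_rpow hti.le (norm_nonneg _)]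
  simp only [hd, hs, hh, Prod.smul_mk, ← smul_sub, ← smul_add, smul_comm (1 / 2 : ℝ) t⁻¹, e0] at hz
  have htp : 0 < t⁻¹ ^ p := Real.rpow_pos_of_pos hti p
  refine le_of_mul_le_mul_left (hz.trans_eq ?_) htp
  ring

end UniformConvexity

/-! ### Closedness of `W^{1,p}_0` -/

section Closedness

variable {n : ℕ} {Ω : Set (Rn n)} {p : ℝ}

/-- The space `W^{1,p}_0` is closed under convergence in `L^p` of functions and gradients. -/
lemma SobolevTendsto.exists_of_tendsto (hp : 1 < p) {φ : ℕ → ℕ → Rn n → ℝ} {v : ℕ → Rn n → ℝ}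
    {g : ℕ → Rn n → Rn n} {w : Rn n → ℝ} {h : Rn n → Rn n}
    (hv : ∀ k, SobolevTendsto Ω p (φ k) (v k) (g k))
    (hw : MemLp w (ENNReal.ofReal p) (volume.restrict Ω))
    (hh : MemLp h (ENNReal.ofReal p) (volume.restrict Ω))
    (hvw : Tendsto (fun k => eLpNorm (fun x => v k x - w x) (ENNReal.ofReal p)
      (volume.restrict Ω)) atTop (𝓝 0))
    (hgh : Tendsto (fun k => eLpNorm (fun x => g k x - h x) (ENNReal.ofReal p)
      (volume.restrict Ω)) atTop (𝓝 0)) :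
    ∃ χ, SobolevTendsto Ω p χ w h := by
  have hq := one_le_ofReal hp
  have ha : Tendsto (fun k : ℕ => ((k : ℝ≥0∞) + 1)⁻¹) atTop (𝓝 0) := by
    have := ENNReal.tendsto_inv_nat_nhds_zero.comp (tendsto_add_atTop_nat 1)
    simpa [Function.comp_def] using this
  have hex : ∀ k : ℕ, ∃ j, eLpNorm (fun x => φ k j x - v k x) (ENNReal.ofReal p)
      (volume.restrict Ω) < ((k : ℝ≥0∞) + 1)⁻¹ ∧
      eLpNorm (fun x => gradient (φ k j) x - g k x) (ENNReal.ofReal p)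
      (volume.restrict Ω) < ((k : ℝ≥0∞) + 1)⁻¹ := fun k => by
    have hpos : (0 : ℝ≥0∞) < ((k : ℝ≥0∞) + 1)⁻¹ := ENNReal.inv_pos.2 (by simp)
    exact (((hv k).tendsto.eventually_lt_const hpos).and
      ((hv k).tendsto_grad.eventually_lt_const hpos)).exists
  choose j hj1 hj2 using hex
  refine ⟨fun k => φ k (j k), fun k => (hv k).test _, hw, hh, ?_, ?_⟩
  · have hs := ha.add hvw
    rw [add_zero] at hs
    refine tendsto_of_tendsto_of_tendsto_of_le_of_le tendsto_const_nhds hs (fun _ => zero_le)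
      fun k => ?_
    calc eLpNorm (fun x => φ k (j k) x - w x) (ENNReal.ofReal p) (volume.restrict Ω)
        = eLpNorm ((fun x => φ k (j k) x - v k x) + fun x => v k x - w x) (ENNReal.ofReal p)
          (volume.restrict Ω) := by congr 1; ext x; simp
      _ ≤ _ := eLpNorm_add_le ((((hv k).test _).memLp (ENNReal.ofReal p) _).sub (hv k).memLp).1
          ((hv k).memLp.sub hw).1 hq
      _ ≤ _ := add_le_add (hj1 k).le le_rfl
  · have hs := ha.add hgh
    rw [add_zero] at hs
    refine tendsto_of_tendsto_of_tendsto_of_le_of_le tendsto_const_nhds hs (fun _ => zero_le)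
      fun k => ?_
    calc eLpNorm (fun x => gradient (φ k (j k)) x - h x) (ENNReal.ofReal p) (volume.restrict Ω)
        = eLpNorm ((fun x => gradient (φ k (j k)) x - g k x) + fun x => g k x - h x)
          (ENNReal.ofReal p) (volume.restrict Ω) := by congr 1; ext1 x; simp
      _ ≤ _ := eLpNorm_add_le ((((hv k).test _).memLp_grad (ENNReal.ofReal p) _).sub
          (hv k).memLp_grad).1 ((hv k).memLp_grad.sub hh).1 hq
      _ ≤ _ := add_le_add (hj2 k).le le_rfl

end Closedness

/-! ### The obstacle class -/

section ObstacleClass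

variable {n : ℕ} {Ω : Set (Rn n)} {p : ℝ} {ψ u₀ v w : Rn n → ℝ} {g : Rn n → Rn n}

lemma isSobolevPair_of_mem_obstacleClass (hΩ : IsOpen Ω) (hu₀ : MemW1p Ω p u₀)
    (hv : v ∈ obstacleClass Ω p ψ u₀) : IsSobolevPair Ω p v (weakGradient Ω v) := by
  have h := (IsSobolevPair.of_memW1p hv.1.1).add hΩ (IsSobolevPair.of_memW1p hu₀)
  simp only [sub_add_cancel] at h
  exact IsSobolevPair.of_memW1p (h.memW1p hΩ)

lemma exists_sobolevTendsto_of_mem_obstacleClass (hΩ : IsOpen Ω) (hu₀ : MemW1p Ω p u₀)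
    (hv : v ∈ obstacleClass Ω p ψ u₀) :
    ∃ φ, SobolevTendsto Ω p φ (fun x => v x - u₀ x)
      (fun x => weakGradient Ω v x - weakGradient Ω u₀ x) := by
  obtain ⟨φ, hφ⟩ := SobolevTendsto.of_memW1p0 hv.1
  exact ⟨φ, hφ.congr (EventuallyEq.refl _ _) (((isSobolevPair_of_mem_obstacleClass hΩ hu₀ hv).sub
    hΩ (IsSobolevPair.of_memW1p hu₀)).weak.weakGradient_ae_eq hΩ)⟩

lemma mem_obstacleClass_of_sobolevTendsto (hΩ : IsOpen Ω) (hp : 1 < p) (hu₀ : MemW1p Ω p u₀)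
    {φ : ℕ → Rn n → ℝ} (h : SobolevTendsto Ω p φ (fun x => v x - u₀ x)
      (fun x => g x - weakGradient Ω u₀ x)) (hle : ∀ᵐ x ∂(volume.restrict Ω), ψ x ≤ v x) :
    v ∈ obstacleClass Ω p ψ u₀ ∧ weakGradient Ω v =ᵐ[volume.restrict Ω] g := by
  refine ⟨⟨h.memW1p0 hΩ hp, hle⟩, ?_⟩
  have h' := (h.isSobolevPair hΩ hp).add hΩ (IsSobolevPair.of_memW1p hu₀)
  simp only [sub_add_cancel] at h'
  exact h'.weak.weakGradient_ae_eq hΩ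

/-- Admissible functions may be varied by any `W^{1,p}_0` function that respects the obstacle. -/
lemma add_mem_obstacleClass (hΩ : IsOpen Ω) (hp : 1 < p) (hu₀ : MemW1p Ω p u₀)
    (hv : v ∈ obstacleClass Ω p ψ u₀) {φ : ℕ → Rn n → ℝ} (h : SobolevTendsto Ω p φ w g)
    (hle : ∀ᵐ x ∂(volume.restrict Ω), ψ x ≤ v x + w x) :
    (fun x => v x + w x) ∈ obstacleClass Ω p ψ u₀ ∧
      weakGradient Ω (fun x => v x + w x) =ᵐ[volume.restrict Ω]
        fun x => weakGradient Ω v x + g x := by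
  obtain ⟨χ, hχ⟩ := exists_sobolevTendsto_of_mem_obstacleClass hΩ hu₀ hv
  refine mem_obstacleClass_of_sobolevTendsto hΩ hp hu₀ ((hχ.add hp h).congr
    (Eventually.of_forall fun x => ?_) (Eventually.of_forall fun x => ?_)) hle
  · simp only; ring
  · simp only; abel

lemma combo_mem_obstacleClass (hΩ : IsOpen Ω) (hp : 1 < p) (hu₀ : MemW1p Ω p u₀)
    (hv : v ∈ obstacleClass Ω p ψ u₀) (hw : w ∈ obstacleClass Ω p ψ u₀) {t : ℝ} (h0 : 0 ≤ t)
    (h1 : t ≤ 1) :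
    (fun x => v x + t * (w x - v x)) ∈ obstacleClass Ω p ψ u₀ ∧
      weakGradient Ω (fun x => v x + t * (w x - v x)) =ᵐ[volume.restrict Ω]
        fun x => weakGradient Ω v x + t • (weakGradient Ω w x - weakGradient Ω v x) := by
  obtain ⟨φ, hφ⟩ := exists_sobolevTendsto_of_mem_obstacleClass hΩ hu₀ hv
  obtain ⟨χ, hχ⟩ := exists_sobolevTendsto_of_mem_obstacleClass hΩ hu₀ hw
  refine add_mem_obstacleClass hΩ hp hu₀ hv (((hχ.sub hp hφ).const_mul t).congr
    (Eventually.of_forall fun x => ?_) (Eventually.of_forall fun x => ?_)) ?_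
  · simp only; ring
  · simp only [sub_sub_sub_cancel_right]
  · filter_upwards [hv.2, hw.2] with x hx hy
    nlinarith [mul_nonneg h0 (sub_nonneg.2 hy), mul_nonneg (sub_nonneg.2 h1) (sub_nonneg.2 hx)]

end ObstacleClass

/-! ### Growth conditions -/

section Growth

variable {n : ℕ} {Ω : Set (Rn n)} {p : ℝ} {G : Rn n → ℝ} {ℓ L : ℝ}

lemma exists_abs_le_of_growth (hℓ : 0 < ℓ) (hlow : ∀ ξ, ℓ * (‖ξ‖ ^ p - 1) ≤ G ξ)
    (hup : ∀ ξ, G ξ ≤ L * (1 + ‖ξ‖ ^ p)) :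
    ∃ C : ℝ, 0 ≤ C ∧ ∀ ξ, |G ξ| ≤ C * (1 + ‖ξ‖ ^ p) := by
  refine ⟨|L| + ℓ, by positivity, fun ξ => abs_le.2 ⟨?_, ?_⟩⟩
  · have h := hlow ξ
    have : 0 ≤ ‖ξ‖ ^ p := by positivity
    nlinarith [mul_nonneg (abs_nonneg L) this, mul_nonneg hℓ.le this, abs_nonneg L]
  · have h := hup ξ
    have : 0 ≤ ‖ξ‖ ^ p := by positivity
    nlinarith [mul_nonneg (sub_nonneg.2 (le_abs_self L)) this, mul_nonneg hℓ.le this,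
      le_abs_self L]

lemma integrable_norm_rpow (hp : 1 < p) {α E : Type*} [MeasurableSpace α] [NormedAddCommGroup E]
    {ν : Measure α} {g : α → E} (hg : MemLp g (ENNReal.ofReal p) ν) :
    Integrable (fun x => ‖g x‖ ^ p) ν := by
  have := hg.integrable_norm_rpow (by simpa using zero_lt_one.trans hp) ENNReal.ofReal_ne_top
  rwa [ENNReal.toReal_ofReal (by linarith)] at this

lemma integrable_comp_of_growth (hp : 1 < p) (hG : Continuous G) {C : ℝ}
    (hC : ∀ ξ, |G ξ| ≤ C * (1 + ‖ξ‖ ^ p)) {α : Type*} [MeasurableSpace α] {ν : Measure α}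
    [IsFiniteMeasure ν] {g : α → Rn n} (hg : MemLp g (ENNReal.ofReal p) ν) :
    Integrable (fun x => G (g x)) ν :=
  (((integrable_const 1).add (integrable_norm_rpow hp hg)).const_mul C).mono'
    (hG.comp_aestronglyMeasurable hg.1) (Eventually.of_forall fun x => hC (g x))

end Growth

/-! ### Existence of a minimizer -/

section Minimizer

variable {n : ℕ} {Ω : Set (Rn n)} {p : ℝ} {G : Rn n → ℝ} {ℓ C : ℝ} {ψ u₀ v w : Rn n → ℝ}

lemma exists_eLpNorm_lt_of_integral_lt (hp : 1 < p) {α E : Type*} [MeasurableSpace α]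
    [NormedAddCommGroup E] {ν : Measure α} {ε : ℝ≥0∞} (hε : 0 < ε) :
    ∃ δ : ℝ, 0 < δ ∧ ∀ f : α → E, MemLp f (ENNReal.ofReal p) ν → ∫ x, ‖f x‖ ^ p ∂ν < δ →
      eLpNorm f (ENNReal.ofReal p) ν < ε := by
  have hp0 : 0 < p := zero_lt_one.trans hp
  rcases eq_or_ne ε ⊤ with rfl | ht
  · exact ⟨1, one_pos, fun f hf _ => hf.2⟩
  have he : 0 < ε.toReal := ENNReal.toReal_pos hε.ne' ht
  refine ⟨ε.toReal ^ p, Real.rpow_pos_of_pos he p, fun f hf h => ?_⟩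
  rw [hf.eLpNorm_eq_integral_rpow_norm (by simpa using hp0) ENNReal.ofReal_ne_top,
    ENNReal.toReal_ofReal hp0.le]
  refine (ENNReal.ofReal_lt_iff_lt_toReal (by positivity) ht).2 ?_
  calc (∫ x, ‖f x‖ ^ p ∂ν) ^ p⁻¹ < (ε.toReal ^ p) ^ p⁻¹ :=
        Real.rpow_lt_rpow (by positivity) h (inv_pos.2 hp0)
    _ = ε.toReal := Real.rpow_rpow_inv he.le hp0.ne'

lemma mul_sub_le_energy [IsFiniteMeasure (volume.restrict Ω)] (hp : 1 < p) (hG : Continuous G)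
    (hlow : ∀ ξ, ℓ * (‖ξ‖ ^ p - 1) ≤ G ξ) (hC : ∀ ξ, |G ξ| ≤ C * (1 + ‖ξ‖ ^ p))
    (hv : MemLp (weakGradient Ω v) (ENNReal.ofReal p) (volume.restrict Ω)) :
    ℓ * ((∫ x in Ω, ‖weakGradient Ω v x‖ ^ p) - (volume.restrict Ω).real univ) ≤ energy Ω G v := by
  have hi := integrable_norm_rpow hp hv
  have h1 : ∫ x in Ω, ℓ * (‖weakGradient Ω v x‖ ^ p - 1) ≤ energy Ω G v :=
    integral_mono ((hi.sub (integrable_const 1)).const_mul ℓ)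
      (integrable_comp_of_growth hp hG hC hv) fun x => hlow _
  rw [integral_const_mul, integral_sub hi (integrable_const 1)] at h1
  simpa using h1

lemma energy_half_le [IsFiniteMeasure (volume.restrict Ω)] (hΩ : IsOpen Ω) (hp : 1 < p)
    (hG : Continuous G) (hconv : ConvexOn ℝ univ G) (hC : ∀ ξ, |G ξ| ≤ C * (1 + ‖ξ‖ ^ p))
    (hu₀ : MemW1p Ω p u₀) (hv : v ∈ obstacleClass Ω p ψ u₀) (hw : w ∈ obstacleClass Ω p ψ u₀) :
    energy Ω G (fun x => v x + 1 / 2 * (w x - v x)) ≤ 1 / 2 * energy Ω G v + 1 / 2 * energy Ω G w := by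
  have hg := (combo_mem_obstacleClass hΩ hp hu₀ hv hw (t := 1 / 2) (by norm_num) (by norm_num)).2
  have mv := (isSobolevPair_of_mem_obstacleClass hΩ hu₀ hv).memLp_grad
  have mw := (isSobolevPair_of_mem_obstacleClass hΩ hu₀ hw).memLp_grad
  have iv := integrable_comp_of_growth hp hG hC mv
  have iw := integrable_comp_of_growth hp hG hC mw
  have im := integrable_comp_of_growth hp hG hC (mv.add ((mw.sub mv).const_smul (1 / 2 : ℝ)))
  rw [energy, energy, energy, integral_congr_ae (g := fun x => G (weakGradient Ω v x +
    (1 / 2 : ℝ) • (weakGradient Ω w x - weakGradient Ω v x)))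
    (by filter_upwards [hg] with x hx; rw [hx]), ← integral_const_mul, ← integral_const_mul,
    ← integral_add (iv.const_mul _) (iw.const_mul _)]
  refine integral_mono im ((iv.const_mul _).add (iw.const_mul _)) fun x => ?_
  have := hconv.2 (mem_univ (weakGradient Ω v x)) (mem_univ (weakGradient Ω w x))
    (show (0 : ℝ) ≤ 1 / 2 by norm_num) (show (0 : ℝ) ≤ 1 / 2 by norm_num) (by norm_num)
  simp only [smul_eq_mul] at this
  refine le_trans (le_of_eq ?_) this
  congr 1
  module

/-- The energy is lower semicontinuous along gradients converging in `L^p`, by Fatou's lemma. -/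
lemma integral_le_of_tendsto [IsFiniteMeasure (volume.restrict Ω)] (hp : 1 < p)
    (hG : Continuous G) (hℓ : 0 < ℓ)
    (hlow : ∀ ξ, ℓ * (‖ξ‖ ^ p - 1) ≤ G ξ) (hC : ∀ ξ, |G ξ| ≤ C * (1 + ‖ξ‖ ^ p))
    {gk : ℕ → Rn n → Rn n} {g : Rn n → Rn n}
    (hgk : ∀ k, MemLp (gk k) (ENNReal.ofReal p) (volume.restrict Ω))
    (hg : MemLp g (ENNReal.ofReal p) (volume.restrict Ω))
    (h : Tendsto (fun k => eLpNorm (fun x => gk k x - g x) (ENNReal.ofReal p)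
      (volume.restrict Ω)) atTop (𝓝 0)) {a : ℕ → ℝ} {m : ℝ} (ha : Tendsto a atTop (𝓝 m))
    (hle : ∀ k, ∫ x in Ω, G (gk k x) ≤ a k) : ∫ x in Ω, G (g x) ≤ m := by
  have h0 : ENNReal.ofReal p ≠ 0 := (zero_lt_one.trans_le (one_le_ofReal hp)).ne'
  obtain ⟨ns, hns, hae⟩ := (tendstoInMeasure_of_tendsto_eLpNorm h0 (fun k => (hgk k).1) hg.1
    h).exists_seq_tendsto_ae
  have hpos : ∀ ξ, 0 ≤ G ξ + ℓ := fun ξ => by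
    have h1 : 0 ≤ ‖ξ‖ ^ p := by positivity
    nlinarith [hlow ξ, mul_nonneg hℓ.le h1]
  have ii : ∀ {f : Rn n → Rn n}, MemLp f (ENNReal.ofReal p) (volume.restrict Ω) →
      Integrable (fun x => G (f x) + ℓ) (volume.restrict Ω) := fun hf =>
    (integrable_comp_of_growth hp hG hC hf).add (integrable_const ℓ)
  set c := ∫ _ in Ω, ℓ with hc
  have ie : ∀ {f : Rn n → Rn n}, MemLp f (ENNReal.ofReal p) (volume.restrict Ω) →
      ∫⁻ x in Ω, ENNReal.ofReal (G (f x) + ℓ) = ENNReal.ofReal ((∫ x in Ω, G (f x)) + c) :=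
    fun hf => by
      rw [← ofReal_integral_eq_lintegral_ofReal (ii hf) (Eventually.of_forall fun x => hpos _),
        integral_add (integrable_comp_of_growth hp hG hC hf) (integrable_const ℓ)]
  have hF : ∫⁻ x in Ω, ENNReal.ofReal (G (g x) + ℓ) ≤
      liminf (fun k => ∫⁻ x in Ω, ENNReal.ofReal (G (gk (ns k) x) + ℓ)) atTop := by
    refine le_trans (le_of_eq (lintegral_congr_ae ?_)) (lintegral_liminf_le' fun k =>
      (ii (hgk (ns k))).1.aemeasurable.ennreal_ofReal)
    filter_upwards [hae] with x hx
    refine (Tendsto.liminf_eq ?_).symm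
    exact (ENNReal.continuous_ofReal.tendsto _).comp
      (((hG.tendsto _).comp hx).add tendsto_const_nhds)
  have hlim : Tendsto (fun k => ENNReal.ofReal (a (ns k) + c)) atTop
      (𝓝 (ENNReal.ofReal (m + c))) :=
    (ENNReal.continuous_ofReal.tendsto _).comp
      ((ha.comp hns.tendsto_atTop).add tendsto_const_nhds)
  have hfin : ENNReal.ofReal ((∫ x in Ω, G (g x)) + c) ≤ ENNReal.ofReal (m + c) := by
    rw [← ie hg, ← hlim.liminf_eq]
    refine hF.trans (liminf_le_liminf (Eventually.of_forall fun k => ?_))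
    rw [ie (hgk _)]
    exact ENNReal.ofReal_le_ofReal (by linarith [hle (ns k)])
  have hmc : 0 ≤ m + c := by
    refine ge_of_tendsto' (ha.add_const c) fun k => ?_
    have : 0 ≤ ∫ x in Ω, (G (gk k x) + ℓ) := integral_nonneg fun x => hpos _
    rw [integral_add (integrable_comp_of_growth hp hG hC (hgk k)) (integrable_const ℓ)] at this
    linarith [hle k]
  have := (ENNReal.ofReal_le_ofReal_iff hmc).1 hfin
  linarith

/-- The direct method. Instead of weak compactness, the minimizing sequence is chosen so that each
member nearly minimizes the `L^p` norm of the gradient on a sublevel set of the energy; the uniform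
convexity of that norm then makes the gradients converge strongly. -/
lemma exists_isMinOn_energy (hn : 2 ≤ n) (hΩ : IsOpen Ω) (hΩb : Bornology.IsBounded Ω)
    (hp : 1 < p) (hG : Continuous G) (hconv : ConvexOn ℝ univ G) (hℓ : 0 < ℓ)
    (hlow : ∀ ξ, ℓ * (‖ξ‖ ^ p - 1) ≤ G ξ) (hC : ∀ ξ, |G ξ| ≤ C * (1 + ‖ξ‖ ^ p))
    (hu₀ : MemW1p Ω p u₀) (hK : (obstacleClass Ω p ψ u₀).Nonempty) :
    ∃ u ∈ obstacleClass Ω p ψ u₀, IsMinOn (energy Ω G) (obstacleClass Ω p ψ u₀) u := by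
  have hq := one_le_ofReal hp
  have hfin : IsFiniteMeasure (volume.restrict Ω) :=
    ⟨by simpa using hΩb.measure_lt_top⟩
  set K := obstacleClass Ω p ψ u₀ with hKdef
  set V := (volume.restrict Ω).real univ with hV
  set N : (Rn n → ℝ) → ℝ := fun v => ∫ x in Ω, ‖weakGradient Ω v x‖ ^ p with hN
  have hN0 : ∀ v, 0 ≤ N v := fun v => integral_nonneg fun x => by positivity
  have hmem : ∀ v ∈ K, MemLp (weakGradient Ω v) (ENNReal.ofReal p) (volume.restrict Ω) :=
    fun v hv => (isSobolevPair_of_mem_obstacleClass hΩ hu₀ hv).memLp_grad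
  have hcoer : ∀ v ∈ K, ℓ * (N v - V) ≤ energy Ω G v := fun v hv =>
    mul_sub_le_energy hp hG hlow hC (hmem v hv)
  have hbdd : BddBelow (energy Ω G '' K) := by
    refine ⟨-(ℓ * V), ?_⟩
    rintro _ ⟨v, hv, rfl⟩
    have := hcoer v hv
    nlinarith [mul_nonneg hℓ.le (hN0 v)]
  set m := sInf (energy Ω G '' K) with hm
  have hmle : ∀ v ∈ K, m ≤ energy Ω G v := fun v hv => csInf_le hbdd (mem_image_of_mem _ hv)
  -- the sublevel sets, the least value of `N` on each, and near-minimizers of `N` in them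
  set S : ℕ → Set (Rn n → ℝ) := fun k => {v | v ∈ K ∧ energy Ω G v ≤ m + 1 / ((k : ℝ) + 1)} with hS
  have hSne : ∀ k, (S k).Nonempty := fun k => by
    have hk : m < m + 1 / ((k : ℝ) + 1) := lt_add_of_pos_right _ (by positivity)
    obtain ⟨_, ⟨v, hv, rfl⟩, hlt⟩ := exists_lt_of_csInf_lt (hK.image _) hk
    exact ⟨v, hv, hlt.le⟩
  have hSanti : ∀ k j, k ≤ j → S j ⊆ S k := fun k j hkj v hv =>
    ⟨hv.1, hv.2.trans (by gcongr)⟩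
  have hNbdd : ∀ k, BddBelow (N '' S k) := fun k => ⟨0, by rintro _ ⟨v, -, rfl⟩; exact hN0 v⟩
  set I : ℕ → ℝ := fun k => sInf (N '' S k) with hI
  have hImono : Monotone I := fun k j hkj =>
    csInf_le_csInf (hNbdd k) ((hSne j).image _) (image_mono (hSanti k j hkj))
  have hIle : ∀ k, ∀ v ∈ S k, I k ≤ N v := fun k v hv => csInf_le (hNbdd k) (mem_image_of_mem _ hv)
  set B := (m + 1) / ℓ + V with hB
  have hNB : ∀ k, ∀ v ∈ S k, N v ≤ B := fun k v hv => by
    have h1 := (hcoer v hv.1).trans hv.2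
    have h2 : 1 / ((k : ℝ) + 1) ≤ 1 := by
      rw [div_le_one (by positivity)]; linarith [Nat.cast_nonneg (α := ℝ) k]
    rw [hB, ← sub_le_iff_le_add, le_div_iff₀ hℓ]
    linarith
  have hB0 : 0 ≤ B := by
    obtain ⟨v, hv⟩ := hSne 0
    exact (hN0 v).trans (hNB 0 v hv)
  have hIbdd : BddAbove (range I) := ⟨B, by
    rintro _ ⟨k, rfl⟩
    obtain ⟨v, hv⟩ := hSne k
    exact (hIle k v hv).trans (hNB k v hv)⟩
  have hIlim := tendsto_atTop_ciSup hImono hIbdd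
  have hex : ∀ k, ∃ v ∈ S k, N v < I k + 1 / ((k : ℝ) + 1) := fun k => by
    have hk : I k < I k + 1 / ((k : ℝ) + 1) := lt_add_of_pos_right _ (by positivity)
    obtain ⟨_, ⟨v, hv, rfl⟩, hlt⟩ := exists_lt_of_csInf_lt ((hSne k).image _) hk
    exact ⟨v, hv, hlt⟩
  choose v hv hvN using hex
  -- near-minimality of `N` on nested convex sets bounds the convexity gap
  have hgap : ∀ {ε D : ℝ}, 0 ≤ D → (∀ a b : Rn n, ‖a - b‖ ^ p ≤ ε * (‖a‖ ^ p + ‖b‖ ^ p) +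
      D * (‖a‖ ^ p + ‖b‖ ^ p - 2 * ‖(1 / 2 : ℝ) • (a + b)‖ ^ p)) → 0 < ε → ∀ k j, k ≤ j →
      ∫ x in Ω, ‖weakGradient Ω (v k) x - weakGradient Ω (v j) x‖ ^ p ≤
        ε * (2 * B) + D * ((⨆ i, I i) - I k + 2 * (1 / ((k : ℝ) + 1))) := by
    intro ε D hD hab hε k j hkj
    have hvj : v j ∈ S k := hSanti k j hkj (hv j)
    have mk := hmem _ (hv k).1
    have mj := hmem _ (hv j).1
    have hc := combo_mem_obstacleClass hΩ hp hu₀ (hv k).1 (hv j).1 (t := 1 / 2)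
      (by norm_num) (by norm_num)
    have hmid : (fun x => v k x + 1 / 2 * (v j x - v k x)) ∈ S k :=
      ⟨hc.1, (energy_half_le hΩ hp hG hconv hC hu₀ (hv k).1 (hv j).1).trans
        (by linarith [(hv k).2, hvj.2])⟩
    have hIm := hIle k _ hmid
    have eN : N (fun x => v k x + 1 / 2 * (v j x - v k x)) =
        ∫ x in Ω, ‖(1 / 2 : ℝ) • (weakGradient Ω (v k) x + weakGradient Ω (v j) x)‖ ^ p := by
      refine integral_congr_ae ?_
      filter_upwards [hc.2] with x hx
      rw [hx]
      congr 2
      module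
    have ik := integrable_norm_rpow hp mk
    have ij := integrable_norm_rpow hp mj
    have im := integrable_norm_rpow hp ((mk.add mj).const_smul (1 / 2 : ℝ))
    have hint : ∫ x in Ω, ‖weakGradient Ω (v k) x - weakGradient Ω (v j) x‖ ^ p ≤
        ∫ x in Ω, (ε * (‖weakGradient Ω (v k) x‖ ^ p + ‖weakGradient Ω (v j) x‖ ^ p) +
          D * (‖weakGradient Ω (v k) x‖ ^ p + ‖weakGradient Ω (v j) x‖ ^ p -
            2 * ‖(1 / 2 : ℝ) • (weakGradient Ω (v k) x + weakGradient Ω (v j) x)‖ ^ p)) :=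
      integral_mono (integrable_norm_rpow hp (mk.sub mj))
        (((ik.add ij).const_mul ε).add (((ik.add ij).sub (im.const_mul 2)).const_mul D))
        fun x => hab _ _
    have hlin : ∀ {a b c : Rn n → ℝ}, Integrable a (volume.restrict Ω) →
        Integrable b (volume.restrict Ω) → Integrable c (volume.restrict Ω) →
        ∫ x in Ω, (ε * (a x + b x) + D * (a x + b x - 2 * c x)) =
          ε * ((∫ x in Ω, a x) + ∫ x in Ω, b x) +
          D * ((∫ x in Ω, a x) + (∫ x in Ω, b x) - 2 * ∫ x in Ω, c x) := by
      intro a b c ha hb hc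
      have i1 : Integrable (fun x => a x + b x) (volume.restrict Ω) := ha.add hb
      have i2 : Integrable (fun x => 2 * c x) (volume.restrict Ω) := hc.const_mul 2
      have i3 : Integrable (fun x => a x + b x - 2 * c x) (volume.restrict Ω) := i1.sub i2
      rw [integral_add (i1.const_mul ε) (i3.const_mul D), integral_const_mul, integral_const_mul,
        integral_sub i1 i2, integral_const_mul, integral_add ha hb]
    have hsplit : ∫ x in Ω, (ε * (‖weakGradient Ω (v k) x‖ ^ p + ‖weakGradient Ω (v j) x‖ ^ p) +
          D * (‖weakGradient Ω (v k) x‖ ^ p + ‖weakGradient Ω (v j) x‖ ^ p -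
            2 * ‖(1 / 2 : ℝ) • (weakGradient Ω (v k) x + weakGradient Ω (v j) x)‖ ^ p)) =
        ε * (N (v k) + N (v j)) + D * (N (v k) + N (v j) -
          2 * N (fun x => v k x + 1 / 2 * (v j x - v k x))) := by
      rw [eN]
      exact hlin ik ij im
    rw [hsplit] at hint
    refine hint.trans (add_le_add (mul_le_mul_of_nonneg_left ?_ hε.le)
      (mul_le_mul_of_nonneg_left ?_ hD))
    · linarith [hNB k _ (hv k), hNB j _ (hv j)]
    · have h1 : 1 / ((j : ℝ) + 1) ≤ 1 / ((k : ℝ) + 1) := by gcongr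
      linarith [hvN k, hvN j, le_ciSup hIbdd j]
  have hcauchy : ∀ δ : ℝ, 0 < δ → ∃ k₀, ∀ k ≥ k₀, ∀ j ≥ k,
      ∫ x in Ω, ‖weakGradient Ω (v k) x - weakGradient Ω (v j) x‖ ^ p < δ := by
    intro δ hδ
    have hε : 0 < δ / (2 * (2 * B + 1)) := by positivity
    obtain ⟨D, hD, hab⟩ := exists_norm_sub_rpow_le (E := Rn n) hp hε
    have hlim : Tendsto (fun k : ℕ => D * ((⨆ i, I i) - I k + 2 * (1 / ((k : ℝ) + 1)))) atTop
        (𝓝 (D * ((⨆ i, I i) - (⨆ i, I i) + 2 * 0))) :=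
      ((tendsto_const_nhds.sub hIlim).add
        (tendsto_one_div_add_atTop_nhds_zero_nat.const_mul 2)).const_mul D
    rw [sub_self, mul_zero, add_zero, mul_zero] at hlim
    obtain ⟨k₀, hk₀⟩ := eventually_atTop.1 (hlim.eventually_lt_const (half_pos hδ))
    refine ⟨k₀, fun k hk j hj => (hgap hD hab hε k j hj).trans_lt ?_⟩
    have h1 : δ / (2 * (2 * B + 1)) * (2 * B) ≤ δ / 2 := by
      rw [div_mul_eq_mul_div, div_le_div_iff₀ (by positivity) (by positivity)]
      nlinarith
    linarith [hk₀ k hk]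
  have hcE : ∀ ε : ℝ≥0∞, 0 < ε → ∃ k₀, ∀ k ≥ k₀, ∀ j ≥ k₀,
      eLpNorm (fun x => weakGradient Ω (v k) x - weakGradient Ω (v j) x) (ENNReal.ofReal p)
        (volume.restrict Ω) < ε := by
    intro ε hε
    obtain ⟨δ, hδ, hlt⟩ := exists_eLpNorm_lt_of_integral_lt (E := Rn n)
      (ν := volume.restrict Ω) hp hε
    obtain ⟨k₀, hk₀⟩ := hcauchy δ hδ
    refine ⟨k₀, fun k hk j hj => hlt _ ((hmem _ (hv k).1).sub (hmem _ (hv j).1)) ?_⟩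
    rcases le_total k j with h | h
    · exact hk₀ k hk j h
    · refine lt_of_eq_of_lt ?_ (hk₀ j hj k h)
      simp only [norm_sub_rev]
  have hsob : ∀ k, ∃ φ, SobolevTendsto Ω p φ (fun x => v k x - u₀ x)
      (fun x => weakGradient Ω (v k) x - weakGradient Ω u₀ x) := fun k =>
    exists_sobolevTendsto_of_mem_obstacleClass hΩ hu₀ (hv k).1
  choose φ hφ using hsob
  obtain ⟨h, hh, hlimh⟩ := exists_tendsto_eLpNorm_of_cauchy hq (fun k => (hφ k).memLp_grad)
    (by simpa only [sub_sub_sub_cancel_right] using hcE)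
  obtain ⟨P, hP, hpoin⟩ := exists_poincare hn hΩb hp
  obtain ⟨w, hw, hlimw⟩ := exists_tendsto_eLpNorm_of_cauchy hq (fun k => (hφ k).memLp)
    (fun ε hε => by
      obtain ⟨k₀, hk₀⟩ := hcE (ε / P) (ENNReal.div_pos hε.ne' hP)
      refine ⟨k₀, fun k hk j hj => ?_⟩
      refine (hpoin _ _ _ ((hφ k).sub hp (hφ j))).trans_lt ?_
      simp only [sub_sub_sub_cancel_right]
      exact ENNReal.mul_lt_of_lt_div' (hk₀ k hk j hj))
  obtain ⟨χ, hχ⟩ := SobolevTendsto.exists_of_tendsto hp hφ hw hh hlimw hlimh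
  have h0 : ENNReal.ofReal p ≠ 0 := (zero_lt_one.trans_le hq).ne'
  obtain ⟨ns, hns, hae⟩ := (tendstoInMeasure_of_tendsto_eLpNorm h0 (fun k => (hφ k).memLp.1) hw.1
    hlimw).exists_seq_tendsto_ae
  have hobs : ∀ᵐ x ∂(volume.restrict Ω), ψ x ≤ w x + u₀ x := by
    have hall : ∀ᵐ x ∂(volume.restrict Ω), ∀ k, ψ x ≤ v k x := ae_all_iff.2 fun k => (hv k).1.2
    filter_upwards [hae, hall] with x hx hx'
    have := ge_of_tendsto' hx fun k => sub_le_sub_right (hx' (ns k)) (u₀ x)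
    linarith
  obtain ⟨hu, hgu⟩ := mem_obstacleClass_of_sobolevTendsto (v := fun x => w x + u₀ x)
    (g := fun x => h x + weakGradient Ω u₀ x) hΩ hp hu₀
    (hχ.congr (Eventually.of_forall fun x => by simp) (Eventually.of_forall fun x => by simp)) hobs
  refine ⟨_, hu, fun z hz => ?_⟩
  refine le_trans ?_ (hmle z hz)
  rw [energy, integral_congr_ae (g := fun x => G (h x + weakGradient Ω u₀ x))
    (by filter_upwards [hgu] with x hx; rw [hx])]
  have ha : Tendsto (fun k : ℕ => m + 1 / ((k : ℝ) + 1)) atTop (𝓝 (m + 0)) :=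
    tendsto_const_nhds.add tendsto_one_div_add_atTop_nhds_zero_nat
  rw [add_zero] at ha
  refine integral_le_of_tendsto hp hG hℓ hlow hC (fun k => hmem _ (hv k).1)
    (hh.add (IsSobolevPair.of_memW1p hu₀).memLp_grad) ?_ ha (fun k => (hv k).2)
  refine hlimh.congr fun k => ?_
  congr 1
  ext1 x
  simp only [Pi.add_apply]
  abel

end Minimizer

/-! ### The Fenchel conjugate -/

section Fenchel

variable {n : ℕ} {p : ℝ} {G : Rn n → ℝ} {ℓ C : ℝ}

lemma hasDerivAt_line (hG : Differentiable ℝ G) (ξ η : Rn n) :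
    HasDerivAt (fun t : ℝ => G (ξ + t • η)) (inner ℝ (gradient G ξ) η) 0 := by
  have h1 : HasDerivAt (fun t : ℝ => ξ + t • η) η 0 := by
    simpa using ((hasDerivAt_id (0 : ℝ)).smul_const η).const_add ξ
  have h2 : HasFDerivAt G (InnerProductSpace.toDual ℝ (Rn n) (gradient G ξ)) (ξ + (0 : ℝ) • η) := by
    rw [zero_smul, add_zero]
    exact (hG ξ).hasGradientAt.hasFDerivAt
  exact h2.comp_hasDerivAt (0 : ℝ) h1

lemma convexOn_line (hconv : ConvexOn ℝ univ G) (ξ η : Rn n) :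
    ConvexOn ℝ univ (fun t : ℝ => G (ξ + t • η)) := by
  refine ⟨convex_univ, fun s _ t _ a b ha hb hab => ?_⟩
  have h := hconv.2 (mem_univ (ξ + s • η)) (mem_univ (ξ + t • η)) ha hb hab
  refine le_trans (le_of_eq ?_) h
  simp only
  congr 1
  have : ξ = a • ξ + b • ξ := by rw [← add_smul, hab, one_smul]
  nth_rewrite 1 [this]
  simp only [smul_eq_mul]
  module

lemma inner_gradient_le_slope (hG : Differentiable ℝ G) (hconv : ConvexOn ℝ univ G) (ξ η : Rn n)
    {t : ℝ} (ht : 0 < t) : inner ℝ (gradient G ξ) η ≤ t⁻¹ * (G (ξ + t • η) - G ξ) := by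
  have h := (convexOn_line hconv ξ η).le_slope_of_hasDerivAt (mem_univ 0) (mem_univ t) ht
    (hasDerivAt_line hG ξ η)
  simpa [slope_def_field, div_eq_inv_mul] using h

/-- The subgradient inequality. -/
lemma inner_gradient_le (hG : Differentiable ℝ G) (hconv : ConvexOn ℝ univ G) (ξ η : Rn n) :
    inner ℝ (gradient G ξ) η ≤ G (ξ + η) - G ξ := by
  simpa using inner_gradient_le_slope hG hconv ξ η one_pos

lemma slope_le_sub (hconv : ConvexOn ℝ univ G) (ξ η : Rn n) {t : ℝ} (ht : 0 < t) (ht1 : t ≤ 1) :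
    t⁻¹ * (G (ξ + t • η) - G ξ) ≤ G (ξ + η) - G ξ := by
  have h := hconv.2 (mem_univ ξ) (mem_univ (ξ + η)) (sub_nonneg.2 ht1) ht.le (by ring)
  have e : (1 - t) • ξ + t • (ξ + η) = ξ + t • η := by module
  rw [e, smul_eq_mul, smul_eq_mul] at h
  rw [inv_mul_le_iff₀ ht]
  linarith

/-- The superlinear growth of `G` bounds its conjugate by the conjugate power. -/
lemma exists_inner_sub_le (hp : 1 < p) (hℓ : 0 < ℓ) (hlow : ∀ ξ, ℓ * (‖ξ‖ ^ p - 1) ≤ G ξ) :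
    ∃ D : ℝ, 0 ≤ D ∧ ∀ ζ ξ : Rn n, inner ℝ ζ ξ - G ξ ≤ D * ‖ζ‖ ^ p.conjExponent + ℓ := by
  have hp0 : 0 < p := zero_lt_one.trans hp
  have hpq := Real.HolderConjugate.conjExponent hp
  have hq0 : 0 < p.conjExponent := hpq.symm.pos
  -- scaling in Young's inequality absorbs the power of `‖ξ‖` into `ℓ * ‖ξ‖ ^ p`
  set a := ℓ ^ p⁻¹ with ha
  have ha0 : 0 < a := Real.rpow_pos_of_pos hℓ _
  have hap : a ^ p = ℓ := Real.rpow_inv_rpow hℓ.le hp0.ne'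
  refine ⟨a⁻¹ ^ p.conjExponent / p.conjExponent, by positivity, fun ζ ξ => ?_⟩
  have h1 : inner ℝ ζ ξ ≤ (a * ‖ξ‖) * (a⁻¹ * ‖ζ‖) :=
    (real_inner_le_norm ζ ξ).trans_eq (by field_simp)
  have h2 := Real.young_inequality_of_nonneg (a := a * ‖ξ‖) (b := a⁻¹ * ‖ζ‖) (by positivity)
    (by positivity) hpq
  rw [Real.mul_rpow ha0.le (norm_nonneg _), hap, Real.mul_rpow (inv_nonneg.2 ha0.le)
    (norm_nonneg _)] at h2
  have h3 : ℓ * ‖ξ‖ ^ p / p ≤ ℓ * ‖ξ‖ ^ p := div_le_self (by positivity) hp.le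
  have h4 := hlow ξ
  have h5 : a⁻¹ ^ p.conjExponent / p.conjExponent * ‖ζ‖ ^ p.conjExponent =
    a⁻¹ ^ p.conjExponent * ‖ζ‖ ^ p.conjExponent / p.conjExponent := by ring
  linarith

lemma bddAbove_polar (hp : 1 < p) (hℓ : 0 < ℓ) (hlow : ∀ ξ, ℓ * (‖ξ‖ ^ p - 1) ≤ G ξ) (ζ : Rn n) :
    BddAbove (range fun ξ : Rn n => inner ℝ ζ ξ - G ξ) := by
  obtain ⟨D, -, h⟩ := exists_inner_sub_le hp hℓ hlow
  exact ⟨_, by rintro _ ⟨ξ, rfl⟩; exact h ζ ξ⟩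

lemma convexOn_polar (hb : ∀ ζ, BddAbove (range fun ξ : Rn n => inner ℝ ζ ξ - G ξ)) :
    ConvexOn ℝ univ (polar G) := by
  refine ⟨convex_univ, fun x _ y _ a b ha hb' hab => ciSup_le fun ξ => ?_⟩
  have hx : inner ℝ x ξ - G ξ ≤ polar G x := le_ciSup (hb x) ξ
  have hy : inner ℝ y ξ - G ξ ≤ polar G y := le_ciSup (hb y) ξ
  rw [inner_add_left, real_inner_smul_left, real_inner_smul_left, smul_eq_mul, smul_eq_mul]
  have e : G ξ = a * G ξ + b * G ξ := by rw [← add_mul, hab, one_mul]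
  nlinarith [mul_le_mul_of_nonneg_left hx ha, mul_le_mul_of_nonneg_left hy hb']

lemma continuous_polar (hb : ∀ ζ, BddAbove (range fun ξ : Rn n => inner ℝ ζ ξ - G ξ)) :
    Continuous (polar G) :=
  continuousOn_univ.1 ((convexOn_polar hb).continuousOn isOpen_univ)

/-- Equality in the Fenchel–Young inequality. -/
lemma polar_gradient (hG : Differentiable ℝ G) (hconv : ConvexOn ℝ univ G) (ξ : Rn n) :
    polar G (gradient G ξ) = inner ℝ (gradient G ξ) ξ - G ξ := by
  have h : ∀ η, inner ℝ (gradient G ξ) η - G η ≤ inner ℝ (gradient G ξ) ξ - G ξ := fun η => by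
    have := inner_gradient_le hG hconv ξ (η - ξ)
    rw [inner_sub_right, add_sub_cancel] at this
    linarith
  exact le_antisymm (ciSup_le h) (le_ciSup (f := fun η => inner ℝ (gradient G ξ) η - G η)
    ⟨_, by rintro _ ⟨η, rfl⟩; exact h η⟩ ξ)

/-- A convex function of `p`-growth has a gradient of `(p - 1)`-growth. -/
lemma norm_gradient_le (hp : 1 < p) (hG : Differentiable ℝ G) (hconv : ConvexOn ℝ univ G)
    (hC0 : 0 ≤ C) (hC : ∀ ξ, |G ξ| ≤ C * (1 + ‖ξ‖ ^ p)) (ξ : Rn n) :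
    ‖gradient G ξ‖ ≤ C * (3 + 2 ^ p) * (1 + ‖ξ‖) ^ (p - 1) := by
  have hp0 : 0 < p := zero_lt_one.trans hp
  set r := 1 + ‖ξ‖ with hr
  have hr1 : 1 ≤ r := by simp [hr]
  have hr0 : 0 < r := by linarith
  rcases eq_or_ne (gradient G ξ) 0 with h0 | h0
  · rw [h0, norm_zero]; positivity
  have hn : 0 < ‖gradient G ξ‖ := norm_pos_iff.2 h0
  -- test the subgradient inequality with a vector of length `1 + ‖ξ‖` along the gradient
  set η : Rn n := (r * ‖gradient G ξ‖⁻¹) • gradient G ξ with hη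
  have hηn : ‖η‖ = r := by
    rw [hη, norm_smul, Real.norm_of_nonneg (by positivity), mul_assoc, inv_mul_cancel₀ hn.ne',
      mul_one]
  have hin : inner ℝ (gradient G ξ) η = r * ‖gradient G ξ‖ := by
    rw [hη, real_inner_smul_right, real_inner_self_eq_norm_sq]
    field_simp
  have h1 := inner_gradient_le hG hconv ξ η
  rw [hin] at h1
  have hrp : 1 ≤ r ^ p := Real.one_le_rpow hr1 hp0.le
  have hξ : ‖ξ‖ ^ p ≤ r ^ p := Real.rpow_le_rpow (norm_nonneg _) (by simp [hr]) hp0.le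
  have hξη : ‖ξ + η‖ ^ p ≤ 2 ^ p * r ^ p := by
    rw [← Real.mul_rpow zero_le_two hr0.le]
    refine Real.rpow_le_rpow (norm_nonneg _) ((norm_add_le _ _).trans ?_) hp0.le
    rw [hηn]; linarith
  have h2 := (abs_le.1 (hC ξ)).1
  have h3 := (abs_le.1 (hC (ξ + η))).2
  have h4 : C * (1 + ‖ξ‖ ^ p) + C * (1 + ‖ξ + η‖ ^ p) ≤ C * ((3 + 2 ^ p) * r ^ p) := by
    rw [← mul_add]
    exact mul_le_mul_of_nonneg_left (by linarith) hC0
  have h5 : r ^ p = r * r ^ (p - 1) := by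
    rw [Real.rpow_sub_one hr0.ne']; field_simp
  refine le_of_mul_le_mul_left ?_ hr0
  calc r * ‖gradient G ξ‖ ≤ C * ((3 + 2 ^ p) * r ^ p) := by linarith
    _ = r * (C * (3 + 2 ^ p) * r ^ (p - 1)) := by rw [h5]; ring

variable {α : Type*} [MeasurableSpace α] {ν : Measure α} [IsFiniteMeasure ν]

lemma integrable_polar_comp (hp : 1 < p) (hℓ : 0 < ℓ) (hlow : ∀ ξ, ℓ * (‖ξ‖ ^ p - 1) ≤ G ξ)
    {σ : α → Rn n} (hσ : MemLp σ (ENNReal.ofReal p.conjExponent) ν) :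
    Integrable (fun x => polar G (σ x)) ν := by
  obtain ⟨D, hD, h⟩ := exists_inner_sub_le hp hℓ hlow
  have hb := bddAbove_polar hp hℓ hlow
  have hq : 1 < p.conjExponent := (Real.HolderConjugate.conjExponent hp).symm.lt
  refine (((integrable_norm_rpow hq hσ).const_mul D).add (integrable_const (ℓ + |G 0|))).mono'
    ((continuous_polar hb).comp_aestronglyMeasurable hσ.1) (Eventually.of_forall fun x => ?_)
  have h1 : polar G (σ x) ≤ D * ‖σ x‖ ^ p.conjExponent + ℓ := ciSup_le (h (σ x))
  have h2 : inner ℝ (σ x) (0 : Rn n) - G 0 ≤ polar G (σ x) := le_ciSup (hb (σ x)) 0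
  rw [inner_zero_right] at h2
  have h3 : 0 ≤ D * ‖σ x‖ ^ p.conjExponent := by positivity
  simp only [Pi.add_apply]
  exact abs_le.2 ⟨by linarith [le_abs_self (G 0)], by linarith [abs_nonneg (G 0)]⟩

lemma memLp_gradient_comp (hp : 1 < p) (hG : ContDiff ℝ 1 G) (hconv : ConvexOn ℝ univ G)
    (hC0 : 0 ≤ C) (hC : ∀ ξ, |G ξ| ≤ C * (1 + ‖ξ‖ ^ p)) {g : α → Rn n}
    (hg : MemLp g (ENNReal.ofReal p) ν) :
    MemLp (fun x => gradient G (g x)) (ENNReal.ofReal p.conjExponent) ν := by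
  have hp1 : 0 < p - 1 := by linarith
  have h1 : MemLp (fun x => (1 : ℝ) + ‖g x‖) (ENNReal.ofReal p) ν :=
    (memLp_const (1 : ℝ)).add hg.norm
  have h2 := h1.norm_rpow_div (ENNReal.ofReal (p - 1))
  rw [← ENNReal.ofReal_div_of_pos hp1, ENNReal.toReal_ofReal hp1.le] at h2
  refine MemLp.of_le_mul (c := C * (3 + 2 ^ p)) h2
    ((continuous_gradient hG).comp_aestronglyMeasurable hg.1) (Eventually.of_forall fun x => ?_)
  have h3 : 0 ≤ 1 + ‖g x‖ := by positivity
  rw [Real.norm_of_nonneg h3, Real.norm_of_nonneg (by positivity)]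
  exact norm_gradient_le hp (hG.differentiable (by simp)) hconv hC0 hC (g x)

end Fenchel

/-! ### The variational inequality -/

section Variation

variable {n : ℕ} {Ω : Set (Rn n)} {p : ℝ} {G : Rn n → ℝ} {C : ℝ} {ψ u₀ u : Rn n → ℝ}

/-- The variational inequality of the obstacle problem. The difference quotients of the energy
density are dominated, by convexity, by the derivative and by the increment for `t = 1`. -/
lemma integral_inner_gradient_nonneg [IsFiniteMeasure (volume.restrict Ω)] (hΩ : IsOpen Ω)
    (hp : 1 < p) (hG : ContDiff ℝ 1 G) (hconv : ConvexOn ℝ univ G) (hC0 : 0 ≤ C)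
    (hC : ∀ ξ, |G ξ| ≤ C * (1 + ‖ξ‖ ^ p)) (hu₀ : MemW1p Ω p u₀)
    (hu : u ∈ obstacleClass Ω p ψ u₀)
    (hmin : IsMinOn (energy Ω G) (obstacleClass Ω p ψ u₀) u) {φ : ℕ → Rn n → ℝ} {w : Rn n → ℝ}
    {g : Rn n → Rn n} (hw : SobolevTendsto Ω p φ w g)
    (hle : ∀ᵐ x ∂(volume.restrict Ω), ψ x ≤ u x + w x) :
    0 ≤ ∫ x in Ω, inner ℝ (gradient G (weakGradient Ω u x)) (g x) := by
  have hd : Differentiable ℝ G := hG.differentiable (by simp)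
  have mu := (isSobolevPair_of_mem_obstacleClass hΩ hu₀ hu).memLp_grad
  set Du := weakGradient Ω u with hDu
  have iu := integrable_comp_of_growth hp hG.continuous hC mu
  have iug := integrable_comp_of_growth hp hG.continuous hC (mu.add hw.memLp_grad)
  have it : ∀ t : ℝ, Integrable (fun x => G (Du x + t • g x)) (volume.restrict Ω) := fun t =>
    integrable_comp_of_growth hp hG.continuous hC (mu.add (hw.memLp_grad.const_smul t))
  have hi := integrable_inner_of_memLp hp (memLp_gradient_comp hp hG hconv hC0 hC mu) hw.memLp_grad
  set t : ℕ → ℝ := fun k => 1 / ((k : ℝ) + 1) with ht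
  have ht0 : ∀ k, 0 < t k := fun k => by simp only [ht]; positivity
  have ht1 : ∀ k, t k ≤ 1 := fun k => by
    simp only [ht]
    rw [div_le_one (by positivity)]; linarith [Nat.cast_nonneg (α := ℝ) k]
  have htl : Tendsto t atTop (𝓝[>] 0) :=
    tendsto_nhdsWithin_iff.2 ⟨tendsto_one_div_add_atTop_nhds_zero_nat,
      Eventually.of_forall fun k => ht0 k⟩
  have hlim : Tendsto (fun k => ∫ x in Ω, (t k)⁻¹ * (G (Du x + t k • g x) - G (Du x))) atTop
      (𝓝 (∫ x in Ω, inner ℝ (gradient G (Du x)) (g x))) := by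
    refine tendsto_integral_of_dominated_convergence
      (fun x => |inner ℝ (gradient G (Du x)) (g x)| + |G (Du x + g x) - G (Du x)|)
      (fun k => (((it (t k)).sub iu).const_mul _).1) (hi.abs.add (iug.sub iu).abs)
      (fun k => Eventually.of_forall fun x => ?_) (Eventually.of_forall fun x => ?_)
    · have h1 := inner_gradient_le_slope hd hconv (Du x) (g x) (ht0 k)
      have h2 := slope_le_sub hconv (Du x) (g x) (ht0 k) (ht1 k)
      refine abs_le.2 ⟨?_, ?_⟩
      · linarith [neg_abs_le (inner ℝ (gradient G (Du x)) (g x)),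
          abs_nonneg (G (Du x + g x) - G (Du x))]
      · linarith [le_abs_self (G (Du x + g x) - G (Du x)),
          abs_nonneg (inner ℝ (gradient G (Du x)) (g x))]
    · have := (hasDerivAt_line hd (Du x) (g x)).tendsto_slope_zero_right.comp htl
      simpa [Function.comp_def] using this
  refine ge_of_tendsto' hlim fun k => ?_
  obtain ⟨hmem, hgr⟩ := add_mem_obstacleClass hΩ hp hu₀ hu (hw.const_mul (t k)) (by
    filter_upwards [hle, hu.2] with x hx hx'
    nlinarith [mul_le_mul_of_nonneg_left hx (ht0 k).le,
      mul_le_mul_of_nonneg_left hx' (sub_nonneg.2 (ht1 k))])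
  have hE : energy Ω G u ≤ energy Ω G (fun x => u x + t k * w x) := hmin hmem
  have e : energy Ω G (fun x => u x + t k * w x) = ∫ x in Ω, G (Du x + t k • g x) :=
    integral_congr_ae (by filter_upwards [hgr] with x hx; rw [hx])
  rw [integral_const_mul, integral_sub (it _) iu]
  rw [e] at hE
  exact mul_nonneg (inv_nonneg.2 (ht0 k).le) (sub_nonneg.2 hE)

end Variation

/-! ### Duality -/

section Duality

variable {n : ℕ} {Ω : Set (Rn n)} {p : ℝ} {G : Rn n → ℝ} {ℓ C : ℝ} {ψ u₀ u v : Rn n → ℝ}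
  {σ : Rn n → Rn n}

/-- On `u₀ + W^{1,p}_0`, integration by parts turns the pairing into the integral of `⟨σ, Dv⟩`. -/
lemma pairing_eq_integral (hΩ : IsOpen Ω) (hp : 1 < p) (hu₀ : MemW1p Ω p u₀)
    (hσ : σ ∈ fieldClass Ω p) (hv : v ∈ obstacleClass Ω p ψ u₀) :
    pairing Ω p u₀ σ v = ((∫ x in Ω, inner ℝ (σ x) (weakGradient Ω v x) : ℝ) : EReal) := by
  obtain ⟨φ, hφ⟩ := exists_sobolevTendsto_of_mem_obstacleClass hΩ hu₀ hv
  have mv := (isSobolevPair_of_mem_obstacleClass hΩ hu₀ hv).memLp_grad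
  have m0 := (IsSobolevPair.of_memW1p hu₀).memLp_grad
  obtain ⟨hi, he⟩ := (isNegDivMeasure_negDiv hΩ hp hσ).integral_quasicontRep hΩ hp hσ hφ
    ((hφ.isSobolevPair hΩ hp).isQuasicontRep hΩ hp)
  rw [pairing, extIntegral_eq_integral hi, he, ← EReal.coe_add]
  simp only [inner_sub_right]
  rw [integral_sub (integrable_inner_of_memLp hp hσ.1 mv) (integrable_inner_of_memLp hp hσ.1 m0),
    sub_add_cancel]

lemma pairing_mono {U W : Rn n → ℝ} (h : ∀ᵐ x ∂(negDiv Ω σ),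
    quasicontRep Ω p (fun y => U y - u₀ y) x ≤ quasicontRep Ω p (fun y => W y - u₀ y) x) :
    pairing Ω p u₀ σ U ≤ pairing Ω p u₀ σ W :=
  add_le_add (extIntegral_mono h) le_rfl

lemma quasicontRep_le (hΩ : IsOpen Ω) (hp : 1 < p) (hψ : MemW1p Ω p ψ) (hu₀ : MemW1p Ω p u₀)
    (hσ : σ ∈ fieldClass Ω p) (hv : v ∈ obstacleClass Ω p ψ u₀) :
    ∀ᵐ x ∂(negDiv Ω σ), quasicontRep Ω p (fun y => ψ y - u₀ y) x ≤
      quasicontRep Ω p (fun y => v y - u₀ y) x := by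
  have hf := (IsSobolevPair.of_memW1p hψ).sub hΩ (IsSobolevPair.of_memW1p hu₀)
  have hw := (isSobolevPair_of_mem_obstacleClass hΩ hu₀ hv).sub hΩ (IsSobolevPair.of_memW1p hu₀)
  exact (isNegDivMeasure_negDiv hΩ hp hσ).ae_le hΩ hp hσ hf (hf.isQuasicontRep hΩ hp) hw
    (hw.isQuasicontRep hΩ hp) (hv.2.mono fun x hx => sub_le_sub_right hx _)

lemma lintegral_quasicontRep_lt_top (hΩ : IsOpen Ω) (hp : 1 < p) (hψ : MemW1p Ω p ψ)
    (hu₀ : MemW1p Ω p u₀) (hσ : σ ∈ fieldClass Ω p) (hv : v ∈ obstacleClass Ω p ψ u₀) :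
    ∫⁻ x, ENNReal.ofReal (quasicontRep Ω p (fun y => ψ y - u₀ y) x) ∂(negDiv Ω σ) < ⊤ := by
  obtain ⟨φ, hφ⟩ := exists_sobolevTendsto_of_mem_obstacleClass hΩ hu₀ hv
  obtain ⟨hi, -⟩ := (isNegDivMeasure_negDiv hΩ hp hσ).integral_quasicontRep hΩ hp hσ hφ
    ((hφ.isSobolevPair hΩ hp).isQuasicontRep hΩ hp)
  refine (lintegral_mono_ae ?_).trans_lt hi.2
  filter_upwards [quasicontRep_le hΩ hp hψ hu₀ hσ hv] with x hx
  exact (ENNReal.ofReal_le_ofReal hx).trans (Real.ofReal_le_enorm _)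

/-- Weak duality: integrate the Fenchel–Young inequality. -/
lemma dualEnergy_le_energy [IsFiniteMeasure (volume.restrict Ω)] (hΩ : IsOpen Ω) (hp : 1 < p)
    (hG : Continuous G) (hℓ : 0 < ℓ) (hlow : ∀ ξ, ℓ * (‖ξ‖ ^ p - 1) ≤ G ξ)
    (hC : ∀ ξ, |G ξ| ≤ C * (1 + ‖ξ‖ ^ p)) (hψ : MemW1p Ω p ψ) (hu₀ : MemW1p Ω p u₀)
    (hσ : σ ∈ fieldClass Ω p) (hv : v ∈ obstacleClass Ω p ψ u₀) :
    dualEnergy Ω p G ψ u₀ σ ≤ ((energy Ω G v : ℝ) : EReal) := by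
  have mv := (isSobolevPair_of_mem_obstacleClass hΩ hu₀ hv).memLp_grad
  have i1 := integrable_inner_of_memLp hp hσ.1 mv
  have i2 := integrable_polar_comp hp hℓ hlow hσ.1
  have i3 := integrable_comp_of_growth hp hG hC mv
  refine (EReal.sub_le_sub (pairing_mono (quasicontRep_le hΩ hp hψ hu₀ hσ hv))
    le_rfl).trans ?_
  rw [pairing_eq_integral hΩ hp hu₀ hσ hv, ← EReal.coe_sub, EReal.coe_le_coe_iff, ← integral_sub i1 i2]
  refine integral_mono (i1.sub i2) i3 fun x => ?_
  have := le_ciSup (bddAbove_polar hp hℓ hlow (σ x)) (weakGradient Ω v x)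
  have h2 : inner ℝ (σ x) (weakGradient Ω v x) - G (weakGradient Ω v x) ≤ polar G (σ x) := this
  linarith

lemma gradient_mem_fieldClass [IsFiniteMeasure (volume.restrict Ω)] (hΩ : IsOpen Ω) (hp : 1 < p)
    (hG : ContDiff ℝ 1 G) (hconv : ConvexOn ℝ univ G) (hC0 : 0 ≤ C)
    (hC : ∀ ξ, |G ξ| ≤ C * (1 + ‖ξ‖ ^ p)) (hu₀ : MemW1p Ω p u₀)
    (hu : u ∈ obstacleClass Ω p ψ u₀)
    (hmin : IsMinOn (energy Ω G) (obstacleClass Ω p ψ u₀) u) :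
    (fun x => gradient G (weakGradient Ω u x)) ∈ fieldClass Ω p := by
  refine ⟨memLp_gradient_comp hp hG hconv hC0 hC
    (isSobolevPair_of_mem_obstacleClass hΩ hu₀ hu).memLp_grad, fun φ hφ hφ0 => ?_⟩
  have hs : SobolevTendsto Ω p (fun _ => φ) φ (fun x => gradient φ x) :=
    ⟨fun _ => hφ, hφ.memLp _ _, hφ.memLp_grad _ _, by simp, by simp⟩
  refine integral_inner_gradient_nonneg hΩ hp hG hconv hC0 hC hu₀ hu hmin hs ?_
  filter_upwards [hu.2] with x hx
  linarith [hφ0 x]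

/-- Strong duality: the measure `-div G'(Du)` is concentrated on the contact set, so that there the
obstacle may be replaced by the minimizer in the pairing. -/
lemma energy_eq_dualEnergy [IsFiniteMeasure (volume.restrict Ω)] (hΩ : IsOpen Ω) (hp : 1 < p)
    (hG : ContDiff ℝ 1 G) (hconv : ConvexOn ℝ univ G) (hℓ : 0 < ℓ)
    (hlow : ∀ ξ, ℓ * (‖ξ‖ ^ p - 1) ≤ G ξ) (hC0 : 0 ≤ C)
    (hC : ∀ ξ, |G ξ| ≤ C * (1 + ‖ξ‖ ^ p)) (hψ : MemW1p Ω p ψ) (hu₀ : MemW1p Ω p u₀)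
    (hu : u ∈ obstacleClass Ω p ψ u₀)
    (hmin : IsMinOn (energy Ω G) (obstacleClass Ω p ψ u₀) u) :
    ((energy Ω G u : ℝ) : EReal) =
      dualEnergy Ω p G ψ u₀ (fun x => gradient G (weakGradient Ω u x)) := by
  have hσ := gradient_mem_fieldClass hΩ hp hG hconv hC0 hC hu₀ hu hmin
  have hup := isSobolevPair_of_mem_obstacleClass hΩ hu₀ hu
  have hf := (IsSobolevPair.of_memW1p hψ).sub hΩ (IsSobolevPair.of_memW1p hu₀)
  have hw := hup.sub hΩ (IsSobolevPair.of_memW1p hu₀)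
  have hcontact := (isNegDivMeasure_negDiv hΩ hp hσ).ae_eq_of_forall_le hΩ hp hσ hf
    (hf.isQuasicontRep hΩ hp) hw (hw.isQuasicontRep hΩ hp)
    (hu.2.mono fun x hx => sub_le_sub_right hx _) fun η hη h01 => by
      -- the competitor `u - η (u - ψ)`
      have h := integral_inner_gradient_nonneg hΩ hp hG hconv hC0 hC hu₀ hu hmin
        (((hw.sub hΩ hf).sobolevTendsto_mul hΩ hp hη).const_mul (-1)) (by
          filter_upwards [hu.2] with x hx
          nlinarith [mul_nonneg (sub_nonneg.2 hx) (sub_nonneg.2 (h01 x).2)])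
      simp only [neg_smul, one_smul, inner_neg_right, integral_neg] at h
      linarith
  have i1 := integrable_inner_of_memLp hp hσ.1 hup.memLp_grad
  have i2 := integrable_polar_comp hp hℓ hlow hσ.1
  have he := le_antisymm (pairing_mono (hcontact.mono fun x hx => hx.le))
    (pairing_mono (hcontact.mono fun x hx => hx.ge))
  rw [dualEnergy, he, pairing_eq_integral hΩ hp hu₀ hσ hu, ← EReal.coe_sub,
    EReal.coe_eq_coe_iff, ← integral_sub i1 i2]
  refine integral_congr_ae (Eventually.of_forall fun x => ?_)
  simp only [polar_gradient (hG.differentiable (by simp)) hconv]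
  ring

end Duality

theorem theorem2p6 (n : ℕ) (hn : 2 ≤ n) (Ω : Set (Rn n)) (hΩ : IsOpen Ω)
    (hΩb : Bornology.IsBounded Ω) (p : ℝ) (hp : 1 < p)
    (G : Rn n → ℝ) (hG : ContDiff ℝ 1 G) (hGconv : StrictConvexOn ℝ univ G)
    (ℓ L : ℝ) (hℓ : 0 < ℓ) (hlow : ∀ ξ, ℓ * (‖ξ‖ ^ p - 1) ≤ G ξ)
    (hup : ∀ ξ, G ξ ≤ L * (1 + ‖ξ‖ ^ p))
    (ψ u₀ : Rn n → ℝ) (hψ : MemW1p Ω p ψ) (hu₀ : MemW1p Ω p u₀)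
    (hK : (obstacleClass Ω p ψ u₀).Nonempty) :
    -- all quantities below are well defined
    (∀ ζ, BddAbove (range fun ξ : Rn n => inner ℝ ζ ξ - G ξ)) ∧
    (∀ v ∈ obstacleClass Ω p ψ u₀, IntegrableOn (fun x => G (weakGradient Ω v x)) Ω) ∧
    (∀ σ ∈ fieldClass Ω p, IntegrableOn (fun x => polar G (σ x)) Ω ∧
      IntegrableOn (fun x => inner ℝ (σ x) (weakGradient Ω u₀ x)) Ω ∧
      ∫⁻ x, ENNReal.ofReal (quasicontRep Ω p (fun y => ψ y - u₀ y) x) ∂(negDiv Ω σ) < ⊤) ∧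
    -- the minimum and the maximum are attained and equal
    (∃ m : ℝ, IsLeast (energy Ω G '' obstacleClass Ω p ψ u₀) m ∧
      IsGreatest (dualEnergy Ω p G ψ u₀ '' fieldClass Ω p) (m : EReal)) ∧
    -- the maximum is attained at `G'(Du)`
    (∀ u ∈ obstacleClass Ω p ψ u₀, IsMinOn (energy Ω G) (obstacleClass Ω p ψ u₀) u →
      (fun x => gradient G (weakGradient Ω u x)) ∈ fieldClass Ω p ∧
      IsMaxOn (dualEnergy Ω p G ψ u₀) (fieldClass Ω p)
        (fun x => gradient G (weakGradient Ω u x)) ∧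
      ((energy Ω G u : ℝ) : EReal) =
        dualEnergy Ω p G ψ u₀ (fun x => gradient G (weakGradient Ω u x))) := by
  have hconv := hGconv.convexOn
  obtain ⟨C, hC0, hC⟩ := exists_abs_le_of_growth hℓ hlow hup
  have hfin : IsFiniteMeasure (volume.restrict Ω) := ⟨by simpa using hΩb.measure_lt_top⟩
  have hweak : ∀ v ∈ obstacleClass Ω p ψ u₀, ∀ σ ∈ fieldClass Ω p,
      dualEnergy Ω p G ψ u₀ σ ≤ ((energy Ω G v : ℝ) : EReal) := fun v hv σ hσ =>
    dualEnergy_le_energy hΩ hp hG.continuous hℓ hlow hC hψ hu₀ hσ hv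
  have hstrong : ∀ u ∈ obstacleClass Ω p ψ u₀,
      IsMinOn (energy Ω G) (obstacleClass Ω p ψ u₀) u →
      (fun x => gradient G (weakGradient Ω u x)) ∈ fieldClass Ω p ∧
      ((energy Ω G u : ℝ) : EReal) =
        dualEnergy Ω p G ψ u₀ (fun x => gradient G (weakGradient Ω u x)) := fun u hu hmin =>
    ⟨gradient_mem_fieldClass hΩ hp hG hconv hC0 hC hu₀ hu hmin,
      energy_eq_dualEnergy hΩ hp hG hconv hℓ hlow hC0 hC hψ hu₀ hu hmin⟩
  refine ⟨bddAbove_polar hp hℓ hlow, fun v hv => ?_, fun σ hσ => ⟨?_, ?_, ?_⟩, ?_,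
    fun u hu hmin => ⟨(hstrong u hu hmin).1, fun σ hσ => ?_, (hstrong u hu hmin).2⟩⟩
  · exact integrable_comp_of_growth hp hG.continuous hC
      (isSobolevPair_of_mem_obstacleClass hΩ hu₀ hv).memLp_grad
  · exact integrable_polar_comp hp hℓ hlow hσ.1
  · exact integrable_inner_of_memLp hp hσ.1 (IsSobolevPair.of_memW1p hu₀).memLp_grad
  · exact lintegral_quasicontRep_lt_top hΩ hp hψ hu₀ hσ hK.some_mem
  · obtain ⟨u, hu, hmin⟩ := exists_isMinOn_energy hn hΩ hΩb hp hG.continuous hconv hℓ hlow hC hu₀ hK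
    obtain ⟨hσ, he⟩ := hstrong u hu hmin
    refine ⟨energy Ω G u, ⟨mem_image_of_mem _ hu, ?_⟩, ⟨⟨_, hσ, he.symm⟩, ?_⟩⟩
    · rintro _ ⟨v, hv, rfl⟩
      exact hmin hv
    · rintro _ ⟨σ, hσ, rfl⟩
      exact hweak u hu σ hσ
  · exact (hweak u hu σ hσ).trans_eq (hstrong u hu hmin).2
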